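/- Let $n\ge 1$, let $\delta$ be the Euclidean metric of $\mathbb R^{n+1}$ and $E_{n+1}$ the last coordinate vector. Let $\Sigma$ be a compact smooth $n$-dimensional manifold with (possibly empty) boundary. Let $B$ be a domain with boundary hypersurface $S$ in hyperbolic space $(\mathbb H^{n+1},\bar g)$, and let $\overline N$ be the unit normal of $S$ pointing out of $B$. A smooth immersion $x:\Sigma\to B$ with $x(\operatorname{int}\Sigma)\subset B\setminus S$ and $x(\partial\Sigma)\subset S$, together with a smooth unit normal field $\nu$ along $x$, is a capillary hypersurface supported on $S$ with contact angle $\theta\in(0,\pi)$ if the angle between $\overline N$ and $-\nu$ is $\theta$ everywhere on $\partial\Sigma$, i.e. $\bar g(\overline N,-\nu)=\cos\theta$. Let $\overline\nabla$ be the Levi-Civita connection of $\bar g$, let $h(Y,Z)=\bar g(\overline\nabla_Y\nu,Z)$ be the second fundamental form, let $\lambda_1,\dots,\lambda_n$ be its eigenvalues with respect to the induced metric, and put $$H_k=\binom nk^{-1}\sum_{1\le i_1<\dots<i_k\le n}\lambda_{i_1}\cdots\lambda_{i_k},\qquad H_0=1 .$$ Let $dA$ be the area measure of the induced metric. Let $k\in\{1,\dots,n\}$.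 (1) In the Poincaré ball model $\{|x|<1\}$, $\bar g=\frac{4}{(1-|x|^2)^2}\delta$, put $B=\{|x|<1,\ x_{n+1}\ge0\}$, $P=\{|x|<1,\ x_{n+1}=0\}$, $V_0=\frac{1+|x|^2}{1-|x|^2}$ and $Y_{n+1}=\frac12(1+|x|^2)E_{n+1}-\delta(x,E_{n+1})\,x$. If $x:\Sigma\to B$ is a compact immersed capillary hypersurface supported on $P$ with constant contact angle $\theta\in(0,\pi)$, then $$\int_\Sigma\big[H_{k-1}\big(V_0-\cos\theta\,\bar g(Y_{n+1},\nu)\big)-H_k\,\bar g(x,\nu)\big]\,dA=0 .$$ (2) In the Poincaré half space model $\{x_{n+1}>0\}$, $\bar g=\frac{1}{x_{n+1}^2}\delta$, let $0\le\phi<\frac\pi2$ and let $a\in\mathbb R^{n+1}$ satisfy $\delta(a,E_{n+1})=0$, $\delta(a,a)=1$. Put $B=\{x_{n+1}>0,\ x_{n+1}-1\ge\tan\phi\,\delta(x,a)\}$, $L_{\phi,a}=\{x_{n+1}>0,\ x_{n+1}-1=\tan\phi\,\delta(x,a)\}$, $V_{n+1}=\frac1{x_{n+1}}$, let $\tilde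 x$ be the position vector and $X_{n+1}=\tilde x-E_{n+1}$. If $x:\Sigma\to B$ is a compact immersed capillary hypersurface supported on $L_{\phi,a}$ with constant contact angle $\theta\in(0,\pi)$, then $$\int_\Sigma\big[H_{k-1}\big(V_{n+1}-\cos\theta\sec\phi\,\bar g(\tilde x,\nu)\big)-H_k\,\bar g(X_{n+1},\nu)\big]\,dA=0 .$$ In both cases the integrand is integrable. -/

import Mathlib

open MeasureTheory Set
open scoped Manifold ContDiff InnerProductSpace

noncomputable section

namespace HypCapillary

/-- Euclidean space `ℝ^m` with its Euclidean norm. -/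
abbrev Euc (m : ℕ) := EuclideanSpace ℝ (Fin m)

/-! ### Conformally flat metrics and their Levi-Civita connection -/

/-- The metric `c • δ`, i.e. `v, w ↦ c(y) ⟨v, w⟩` at the point `y`, conformal to the Euclidean
metric `δ`. -/
def metric {m : ℕ} (c : Euc m → ℝ) (y v w : Euc m) : ℝ := c y * ⟪v, w⟫_ℝ

/-- Connection term of the Levi-Civita connection of `metric c` in the standard coordinates of
`ℝ^m`: `∇_v W = D_v W + christoffel c y v W` at `y`. It is the Koszul formula for `c • δ`;
`christoffel_symm` (no torsion) and `christoffel_compat` (compatibility with the metric) are the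
two properties that characterise it. -/
def christoffel {m : ℕ} (c : Euc m → ℝ) (y v w : Euc m) : Euc m :=
  (2 * c y)⁻¹ • (fderiv ℝ c y v • w + fderiv ℝ c y w • v - ⟪v, w⟫_ℝ • gradient c y)

theorem christoffel_symm {m : ℕ} (c : Euc m → ℝ) (y v w : Euc m) :
    christoffel c y v w = christoffel c y w v := by
  unfold christoffel
  rw [real_inner_comm v w, add_comm (fderiv ℝ c y v • w)]

theorem christoffel_compat {m : ℕ} (c : Euc m → ℝ) (y : Euc m) (hd : DifferentiableAt ℝ c y)
    (hc : c y ≠ 0) (z v w : Euc m) :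
    fderiv ℝ (fun y' => metric c y' v w) y z =
      metric c y (christoffel c y z v) w + metric c y v (christoffel c y z w) := by
  have h1 : ∀ u : Euc m, ⟪gradient c y, u⟫_ℝ = fderiv ℝ c y u := fun u => by
    rw [← toDual_gradient, InnerProductSpace.toDual_apply_apply]
  have h2 : fderiv ℝ (fun y' => metric c y' v w) y z = fderiv ℝ c y z * ⟪v, w⟫_ℝ := by
    unfold metric
    rw [fderiv_mul_const hd]
    simp [mul_comm]
  rw [h2]
  unfold metric christoffel
  simp only [inner_smul_left, inner_smul_right, inner_add_left, inner_add_right, inner_sub_left,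
    inner_sub_right, h1, conj_trivial]
  rw [real_inner_comm (gradient c y) v, h1, real_inner_comm z v]
  field_simp
  ring

/-! ### Geometry of an immersed hypersurface `x : M → (ℝ^{n+1}, c • δ)`

`M` is an `n`-dimensional manifold with (possibly empty) boundary. -/

section Hypersurface

variable {n : ℕ} [NeZero n] {M : Type*} [TopologicalSpace M]
  [ChartedSpace (EuclideanHalfSpace n) M]

/-- The differential at `p` of a map `f : M → ℝ^{n+1}`; the tangent space of `M` at `p` is `ℝ^n`,
through the preferred chart at `p`. -/
def tangentMap (f : M → Euc (n + 1)) (p : M) : Euc n →L[ℝ] Euc (n + 1) :=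
  mfderiv (𝓡∂ n) 𝓘(ℝ, Euc (n + 1)) f p

/-- The covariant derivative `∇_v W` of a vector field `W` along `x`, for a tangent vector `v` of
`M` at `p`. -/
def covDerivAlong (c : Euc (n + 1) → ℝ) (x W : M → Euc (n + 1)) (p : M) (v : Euc n) :
    Euc (n + 1) :=
  tangentMap W p v + christoffel c (x p) (tangentMap x p v) (W p)

/-- The first fundamental form at `p`: `g_{ij} = metric (dx e_i, dx e_j)`. -/
def firstForm (c : Euc (n + 1) → ℝ) (x : M → Euc (n + 1)) (p : M) : Matrix (Fin n) (Fin n) ℝ :=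
  Matrix.of fun i j => metric c (x p) (tangentMap x p (EuclideanSpace.single i 1))
    (tangentMap x p (EuclideanSpace.single j 1))

/-- The second fundamental form at `p` with respect to the unit normal field `ν`:
`h_{ij} = metric (∇_{e_i} ν, dx e_j)`. -/
def secondForm (c : Euc (n + 1) → ℝ) (x ν : M → Euc (n + 1)) (p : M) :
    Matrix (Fin n) (Fin n) ℝ :=
  Matrix.of fun i j => metric c (x p) (covDerivAlong c x ν p (EuclideanSpace.single i 1))
    (tangentMap x p (EuclideanSpace.single j 1))

/-- The principal curvatures at `p`, with multiplicity: the eigenvalues of the second fundamental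
form with respect to the first one. -/
def principalCurvatures (c : Euc (n + 1) → ℝ) (x ν : M → Euc (n + 1)) (p : M) : Multiset ℝ :=
  ((firstForm c x p)⁻¹ * secondForm c x ν p).charpoly.roots

/-- The normalized `k`-th mean curvature `H_k`, with `H_0 = 1`: the `k`-th elementary symmetric
function of the principal curvatures, divided by `n.choose k`. -/
def meanCurv (c : Euc (n + 1) → ℝ) (x ν : M → Euc (n + 1)) (k : ℕ) (p : M) : ℝ :=
  (n.choose k : ℝ)⁻¹ * (principalCurvatures c x ν p).esymm k

/-- The Gram matrix `g_{ij}(y)` of the induced metric in the coordinates `y ∈ ℝ^n` of the chart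
at `p`. -/
def chartGram (c : Euc (n + 1) → ℝ) (x : M → Euc (n + 1)) (p : M) (y : Euc n) :
    Matrix (Fin n) (Fin n) ℝ :=
  Matrix.of fun i j =>
    metric c (x ((extChartAt (𝓡∂ n) p).symm y))
      (fderivWithin ℝ (x ∘ (extChartAt (𝓡∂ n) p).symm) (range (𝓡∂ n)) y
        (EuclideanSpace.single i 1))
      (fderivWithin ℝ (x ∘ (extChartAt (𝓡∂ n) p).symm) (range (𝓡∂ n)) y
        (EuclideanSpace.single j 1))

/-- The area measure `√(det g_{ij}(y)) dy` on the domain of the chart at `p`, extended by zero. -/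
def chartArea [MeasurableSpace M] (c : Euc (n + 1) → ℝ) (x : M → Euc (n + 1)) (p : M) :
    Measure M :=
  ((volume.restrict (extChartAt (𝓡∂ n) p).target).withDensity
    fun y => ENNReal.ofReal (Real.sqrt (chartGram c x p y).det)).map (extChartAt (𝓡∂ n) p).symm

/-- The area measure `dA` of the induced metric: the measure that agrees with `√(det g_{ij}) dy`
on every chart domain. As these local measures agree on overlaps, it is their supremum in the
lattice of measures. -/
def area [MeasurableSpace M] (c : Euc (n + 1) → ℝ) (x : M → Euc (n + 1)) : Measure M :=
  ⨆ p : M, chartArea c x p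

/-- `x : M → B` is a smoothly immersed capillary hypersurface, with unit normal field `ν`, of the
domain `B` with boundary `S` in `(ℝ^{n+1}, c • δ)`, with contact angle `θ`. Here `N` is the unit
normal field of `S` pointing out of `B`, and `θ` is the angle between `N` and `-ν`. -/
structure IsCapillary (c : Euc (n + 1) → ℝ) (B S : Set (Euc (n + 1)))
    (N : Euc (n + 1) → Euc (n + 1)) (θ : ℝ) (x ν : M → Euc (n + 1)) : Prop where
  smooth : ContMDiff (𝓡∂ n) 𝓘(ℝ, Euc (n + 1)) ∞ x
  immersion : ∀ p, Function.Injective (tangentMap x p)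
  maps_interior : ∀ p ∈ (𝓡∂ n).interior M, x p ∈ B \ S
  maps_boundary : ∀ p ∈ (𝓡∂ n).boundary M, x p ∈ S
  smooth_normal : ContMDiff (𝓡∂ n) 𝓘(ℝ, Euc (n + 1)) ∞ ν
  unit_normal : ∀ p, metric c (x p) (ν p) (ν p) = 1
  normal : ∀ p v, metric c (x p) (ν p) (tangentMap x p v) = 0
  contact_angle : ∀ p ∈ (𝓡∂ n).boundary M, metric c (x p) (N (x p)) (-ν p) = Real.cos θ

end Hypersurface

/-! ### The two models of hyperbolic space -/

section Models

variable {n : ℕ}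

/-- The last coordinate vector `E_{n+1}`. -/
def lastVec : Euc (n + 1) := EuclideanSpace.single (Fin.last n) 1

/-- Conformal factor of the Poincaré ball model. -/
def ballFactor (y : Euc (n + 1)) : ℝ := 4 / (1 - ‖y‖ ^ 2) ^ 2

/-- The half ball `{|y| < 1, y_{n+1} ≥ 0}`. -/
def halfBall : Set (Euc (n + 1)) := {y | ‖y‖ < 1 ∧ 0 ≤ ⟪y, lastVec⟫_ℝ}

/-- The totally geodesic plane `P = {|y| < 1, y_{n+1} = 0}`. -/
def planeP : Set (Euc (n + 1)) := {y | ‖y‖ < 1 ∧ ⟪y, lastVec⟫_ℝ = 0}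

/-- The unit normal of `P` pointing out of the half ball. -/
def normalP (y : Euc (n + 1)) : Euc (n + 1) := -(((1 - ‖y‖ ^ 2) / 2) • lastVec)

/-- `V_0 = (1 + |y|^2) / (1 - |y|^2)`. -/
def potV0 (y : Euc (n + 1)) : ℝ := (1 + ‖y‖ ^ 2) / (1 - ‖y‖ ^ 2)

/-- The Killing field `Y_{n+1} = (1 + |y|^2)/2 E_{n+1} - δ(y, E_{n+1}) y` of the ball model. -/
def killingY (y : Euc (n + 1)) : Euc (n + 1) :=
  ((1 + ‖y‖ ^ 2) / 2) • lastVec - ⟪y, lastVec⟫_ℝ • y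

/-- Conformal factor of the Poincaré half space model. -/
def halfSpaceFactor (y : Euc (n + 1)) : ℝ := 1 / (y (Fin.last n)) ^ 2

/-- The domain `{y_{n+1} > 0, y_{n+1} - 1 ≥ tan φ δ(y, a)}` of the half space model. -/
def domainL (φ : ℝ) (a : Euc (n + 1)) : Set (Euc (n + 1)) :=
  {y | 0 < y (Fin.last n) ∧ Real.tan φ * ⟪y, a⟫_ℝ ≤ y (Fin.last n) - 1}

/-- The umbilical hypersurface `L_{φ,a} = {y_{n+1} > 0, y_{n+1} - 1 = tan φ δ(y, a)}`. -/
def surfaceL (φ : ℝ) (a : Euc (n + 1)) : Set (Euc (n + 1)) :=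
  {y | 0 < y (Fin.last n) ∧ y (Fin.last n) - 1 = Real.tan φ * ⟪y, a⟫_ℝ}

/-- The unit normal of `L_{φ,a}` pointing out of `domainL φ a`. -/
def normalL (φ : ℝ) (a y : Euc (n + 1)) : Euc (n + 1) :=
  y (Fin.last n) • (-(Real.cos φ) • lastVec + Real.sin φ • a)

/-- `V_{n+1} = 1 / y_{n+1}`. -/
def potV (y : Euc (n + 1)) : ℝ := 1 / y (Fin.last n)

/-- The conformal Killing field `X_{n+1} = y - E_{n+1}` of the half space model. -/
def conformalX (y : Euc (n + 1)) : Euc (n + 1) := y - lastVec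

end Models

/-! ### The integrands of the two formulae -/

section Integrands

variable {n : ℕ} [NeZero n] {M : Type*} [TopologicalSpace M]
  [ChartedSpace (EuclideanHalfSpace n) M]

/-- `H_{k-1} (V_0 - cos θ g(Y_{n+1}, ν)) - H_k g(x, ν)` in the ball model. -/
def ballIntegrand (θ : ℝ) (x ν : M → Euc (n + 1)) (k : ℕ) (p : M) : ℝ :=
  meanCurv ballFactor x ν (k - 1) p *
      (potV0 (x p) - Real.cos θ * metric ballFactor (x p) (killingY (x p)) (ν p)) -
    meanCurv ballFactor x ν k p * metric ballFactor (x p) (x p) (ν p)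

/-- `H_{k-1} (V_{n+1} - cos θ sec φ g(x, ν)) - H_k g(X_{n+1}, ν)` in the half space model. -/
def halfSpaceIntegrand (θ φ : ℝ) (x ν : M → Euc (n + 1)) (k : ℕ) (p : M) : ℝ :=
  meanCurv halfSpaceFactor x ν (k - 1) p *
      (potV (x p) -
        Real.cos θ * (1 / Real.cos φ) * metric halfSpaceFactor (x p) (x p) (ν p)) -
    meanCurv halfSpaceFactor x ν k p * metric halfSpaceFactor (x p) (conformalX (x p)) (ν p)

end Integrands

end HypCapillary

end

open HypCapillary

/-!
Both models of hyperbolic space are mapped isometrically into the hyperboloid `{B(w, w) = -1}` of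
Minkowski space `W = ℝ × ℝ^{n+1}`. There a hypersurface has a position `f` and a unit normal `N`,
both with values in `W`, and its fundamental forms are `g = B(∂f, ∂f)` and `h = B(∂N, ∂f)`.

Let `r` be a skew endomorphism of `W`, `q` a vector, `κ, ϑ` numbers, `u = r (q + κ f + ϑ N)`, and
let `z = f + t N`. With a volume form `vol` of `W`, consider the field `X` with components
`X_i = vol(u, f, ∂₁z, …, N, …, ∂ₙz)`, where `N` is in the slot of `∂ᵢz`.

* Its divergence contains no second derivatives of `z` (`LorentzForm.sum_fderiv_vol_eq`). As `r` is
  skew and the Newton tensors commute with the shape operator, the derivatives of `u` do not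
  contribute either. Multiplied by `vol(f, N, ∂f) = ±√(det g)` it equals
  `B(u, f) tr(g adj(g + t h)) - B(u, N) tr(h adj(g + t h))`
  (`IsPatch.flux_differentiableAt_and_sum_fderiv`). The coefficients in `t` are
  multiples of `(H_{k-1} B(u, f) - H_k B(u, N)) det g` (`weakIntegrand_one_zero`).
* If `B(q, f) = κ` and `B(q, N) = -ϑ` on the boundary, then the functional `B(q + κ f + ϑ N, ·)`
  kills `u`, `f`, `N` and the tangential derivatives of `z` there, so that the flux of `X` through
  the boundary vanishes (`IsPatch.flux_eq_zero`).

Multiplying `X` by the functions of a partition of unity and applying the divergence theorem in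
charts gives `∫ (H_{k-1} B(u, f) - H_k B(u, N)) dA = 0` (`integral_meanCurv_eq_zero`).

In both models `r` is a multiple of the boost in the plane of the time axis and the last coordinate
axis, and `ϑ = cos θ`. The support is umbilical: its unit normal lifts to `q + κ Φ` with `q`
constant, where `Φ` is the isometry into the hyperboloid. Hence the boundary conditions on `f` and
`N` hold because the boundary lies on the support with contact angle `θ`. The functions `B(u, f)`
and `B(u, N)` are the two weights in the integrands (`integral_ballIntegrand`,
`integral_halfSpaceIntegrand`).
-/

noncomputable section

namespace HypCapillary

/-! ### Linear algebra of a pair of quadratic forms -/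

section LinearAlgebra

open Matrix

variable {n : ℕ}

/-- Replacing one row at a time and summing the determinants is a trace against the adjugate. -/
theorem sum_det_updateRow (A R : Matrix (Fin n) (Fin n) ℝ) :
    ∑ i, (A.updateRow i (R i)).det = (R * A.adjugate).trace := by
  refine Finset.sum_congr rfl fun i _ => ?_
  rw [← cramer_transpose_apply, cramer_eq_adjugate_mulVec, ← adjugate_transpose,
    Matrix.diag_apply, Matrix.mul_apply, Matrix.mulVec, dotProduct]
  exact Finset.sum_congr rfl fun j _ => by rw [Matrix.transpose_apply, mul_comm]

theorem trace_mul_adjugate_congr (P A R : Matrix (Fin n) (Fin n) ℝ) :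
    ((Pᵀ * R * P) * (Pᵀ * A * P).adjugate).trace = P.det ^ 2 * (R * A.adjugate).trace := by
  rw [adjugate_mul_distrib, adjugate_mul_distrib]
  have h : Pᵀ * R * P * (P.adjugate * (A.adjugate * Pᵀ.adjugate)) =
      P.det • (Pᵀ * (R * A.adjugate) * Pᵀ.adjugate) := by
    calc _ = Pᵀ * R * (P * P.adjugate) * A.adjugate * Pᵀ.adjugate := by
          simp only [Matrix.mul_assoc]
      _ = _ := by
          rw [mul_adjugate]
          simp [Matrix.mul_assoc]
  rw [h, trace_smul, trace_mul_cycle, adjugate_mul, det_transpose]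
  simp [pow_two, mul_assoc]

theorem exists_orthogonal_diagonal (A : Matrix (Fin n) (Fin n) ℝ) (hA : A.IsHermitian) :
    ∃ U : Matrix (Fin n) (Fin n) ℝ, U * Uᵀ = 1 ∧ A = U * diagonal hA.eigenvalues * Uᵀ :=
  ⟨hA.eigenvectorUnitary, Unitary.coe_mul_star_self hA.eigenvectorUnitary,
    hA.spectral_theorem.trans (Unitary.conjStarAlgAut_apply _ _)⟩

/-- Simultaneous diagonalisation of a positive definite form `g` and a symmetric form `h`. -/
theorem exists_simultaneous_diagonal (g h : Matrix (Fin n) (Fin n) ℝ) (hg : g.PosDef)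
    (hh : hᵀ = h) : ∃ (K : Matrix (Fin n) (Fin n) ℝ) (lam : Fin n → ℝ),
      IsUnit K.det ∧ g = Kᵀ * K ∧ h = Kᵀ * diagonal lam * K := by
  obtain ⟨B, hB⟩ : ∃ B : Matrix (Fin n) (Fin n) ℝ, g = Bᵀ * B := by
    obtain ⟨U, -, hU⟩ := exists_orthogonal_diagonal g hg.1
    refine ⟨diagonal (fun i => √(hg.1.eigenvalues i)) * Uᵀ, ?_⟩
    have h2 : (fun i => √(hg.1.eigenvalues i) * √(hg.1.eigenvalues i)) = hg.1.eigenvalues :=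
      funext fun i => Real.mul_self_sqrt (hg.eigenvalues_pos i).le
    rw [transpose_mul, transpose_transpose, diagonal_transpose, Matrix.mul_assoc U,
      ← Matrix.mul_assoc (diagonal _) (diagonal _), diagonal_mul_diagonal, ← Matrix.mul_assoc U,
      h2]
    exact hU
  have hBd : IsUnit B.det := by
    have := hg.det_pos
    rw [hB, det_mul, det_transpose] at this
    exact isUnit_iff_ne_zero.2 fun h0 => by simp [h0] at this
  have hC : ((B⁻¹)ᵀ * h * B⁻¹).IsHermitian := by
    unfold Matrix.IsHermitian
    rw [conjTranspose_eq_transpose_of_trivial, transpose_mul, transpose_mul, hh,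
      transpose_transpose, Matrix.mul_assoc]
  -- diagonalise `h` in the coordinates in which `g` is the identity
  obtain ⟨U, hU, hU'⟩ := exists_orthogonal_diagonal _ hC
  refine ⟨Uᵀ * B, hC.eigenvalues, ?_, ?_, ?_⟩
  · rw [det_mul]
    refine IsUnit.mul ?_ hBd
    refine IsUnit.of_mul_eq_one (det U) ?_
    rw [mul_comm, ← det_mul, hU, det_one]
  · rw [hB, transpose_mul, transpose_transpose, Matrix.mul_assoc, ← Matrix.mul_assoc U, hU,
      Matrix.one_mul]
  · generalize hC.eigenvalues = lam at hU'
    calc h = Bᵀ * ((B⁻¹)ᵀ * h * B⁻¹) * B := by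
          simp only [← Matrix.mul_assoc]
          rw [← transpose_mul, nonsing_inv_mul _ hBd, transpose_one, Matrix.one_mul,
            Matrix.mul_assoc, nonsing_inv_mul _ hBd, Matrix.mul_one]
      _ = _ := by
          rw [hU', transpose_mul, transpose_transpose]
          simp only [Matrix.mul_assoc]

theorem prod_one_add_mul_eq_sum_esymm (lam : Fin n → ℝ) (t : ℝ) :
    ∏ i, (1 + t * lam i) =
      ∑ k ∈ Finset.range (n + 1), t ^ k * (Finset.univ.val.map lam).esymm k := by
  rw [Finset.prod_one_add, Finset.sum_powerset]
  simp only [Finset.card_univ, Fintype.card_fin]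
  refine Finset.sum_congr rfl fun k _ => ?_
  rw [Finset.esymm_map_val, Finset.mul_sum]
  refine Finset.sum_congr rfl fun s hs => ?_
  rw [Finset.prod_mul_distrib, Finset.prod_const, (Finset.mem_powersetCard.1 hs).2]

/-- Derivative in `t` of the generating polynomial of the elementary symmetric functions. -/
theorem sum_mul_prod_erase_eq_sum_esymm (lam : Fin n → ℝ) (t : ℝ) :
    ∑ i, lam i * ∏ j ∈ Finset.univ.erase i, (1 + t * lam j) =
      ∑ k ∈ Finset.range (n + 1),
        (k : ℝ) * t ^ (k - 1) * (Finset.univ.val.map lam).esymm k := by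
  have h1 : HasDerivAt (fun t : ℝ => ∏ i, (1 + t * lam i))
      (∑ i, (∏ j ∈ Finset.univ.erase i, (1 + t * lam j)) • lam i) t := by
    refine HasDerivAt.fun_finsetProd fun i _ => ?_
    simpa using ((hasDerivAt_id t).mul_const (lam i)).const_add 1
  have h2 : HasDerivAt (fun t : ℝ => ∏ i, (1 + t * lam i))
      (∑ k ∈ Finset.range (n + 1),
        (k : ℝ) * t ^ (k - 1) * (Finset.univ.val.map lam).esymm k) t := by
    simp only [prod_one_add_mul_eq_sum_esymm]
    refine HasDerivAt.fun_sum fun k _ => ?_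
    exact (hasDerivAt_pow k t).mul_const _
  rw [← h1.unique h2]
  exact Finset.sum_congr rfl fun i _ => by rw [smul_eq_mul, mul_comm]

/-- The summands are those of the product rule without the factor `lam i`; they are recovered from
`∏ j, (1 + t * lam j)` and its derivative. -/
theorem sum_prod_erase_eq_sum_esymm (lam : Fin n → ℝ) (t : ℝ) :
    ∑ i, ∏ j ∈ Finset.univ.erase i, (1 + t * lam j) =
      ∑ k ∈ Finset.range (n + 1),
        ((n : ℝ) - k) * t ^ k * (Finset.univ.val.map lam).esymm k := by
  have h1 : ∀ i : Fin n, ∏ j ∈ Finset.univ.erase i, (1 + t * lam j) =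
      (∏ j, (1 + t * lam j)) - t * (lam i * ∏ j ∈ Finset.univ.erase i, (1 + t * lam j)) := by
    intro i
    rw [← Finset.mul_prod_erase Finset.univ _ (Finset.mem_univ i)]
    ring
  rw [Finset.sum_congr rfl fun i _ => h1 i, Finset.sum_sub_distrib, ← Finset.mul_sum,
    sum_mul_prod_erase_eq_sum_esymm, Finset.sum_const, Finset.card_univ, Fintype.card_fin,
    prod_one_add_mul_eq_sum_esymm, nsmul_eq_mul, Finset.mul_sum, Finset.mul_sum,
    ← Finset.sum_sub_distrib]
  refine Finset.sum_congr rfl fun k _ => ?_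
  rcases k with _ | k
  · simp
  · simp only [Nat.add_sub_cancel, pow_succ]
    push_cast
    ring

/-- The elementary symmetric function of the eigenvalues of `h` with respect to `g`, as the roots of
the characteristic polynomial of `g⁻¹ * h`. If `g`, `h` are the fundamental forms of a hypersurface,
these eigenvalues are the principal curvatures. -/
def relEsymm (g h : Matrix (Fin n) (Fin n) ℝ) (k : ℕ) : ℝ := (g⁻¹ * h).charpoly.roots.esymm k

theorem relEsymm_congr (P g h : Matrix (Fin n) (Fin n) ℝ) (hP : IsUnit P.det)
    (k : ℕ) : relEsymm (Pᵀ * g * P) (Pᵀ * h * P) k = relEsymm g h k := by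
  have hPt : IsUnit (Pᵀ).det := by rwa [det_transpose]
  have h1 : (Pᵀ * g * P)⁻¹ * (Pᵀ * h * P) = P⁻¹ * (g⁻¹ * h * P) := by
    rw [Matrix.mul_inv_rev, Matrix.mul_inv_rev]
    calc _ = P⁻¹ * (g⁻¹ * ((Pᵀ)⁻¹ * Pᵀ) * h * P) := by simp only [Matrix.mul_assoc]
      _ = _ := by rw [nonsing_inv_mul _ hPt, Matrix.mul_one]
  unfold relEsymm
  rw [h1, charpoly_mul_comm, Matrix.mul_assoc, mul_nonsing_inv _ hP, Matrix.mul_one]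

theorem relEsymm_diagonal (lam : Fin n → ℝ) (k : ℕ) :
    relEsymm 1 (diagonal lam) k = (Finset.univ.val.map lam).esymm k := by
  unfold relEsymm
  rw [inv_one, Matrix.one_mul, charpoly_diagonal]
  have h := Polynomial.roots_multiset_prod_X_sub_C (Finset.univ.val.map lam)
  rw [Multiset.map_map] at h
  exact congrArg (fun s : Multiset ℝ => s.esymm k) h

theorem adjugate_one_add_smul_diagonal (lam : Fin n → ℝ) (t : ℝ) :
    (1 + t • diagonal lam).adjugate =
      diagonal fun i => ∏ j ∈ Finset.univ.erase i, (1 + t * lam j) := by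
  rw [← diagonal_one, ← diagonal_smul, diagonal_add, adjugate_diagonal]
  rfl

variable {g h : Matrix (Fin n) (Fin n) ℝ}

/-- With the next lemma, the generating functions through which the symmetric functions of the
principal curvatures enter the divergence of the flux density. -/
theorem trace_mul_adjugate_add_smul (hg : g.PosDef) (hh : hᵀ = h) (t : ℝ) :
    (g * (g + t • h).adjugate).trace =
      g.det * ∑ k ∈ Finset.range (n + 1), ((n : ℝ) - k) * t ^ k * relEsymm g h k := by
  obtain ⟨K, lam, hK, rfl, rfl⟩ := exists_simultaneous_diagonal g h hg hh
  have h1 : Kᵀ * K = Kᵀ * 1 * K := by rw [Matrix.mul_one]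
  have h2 : Kᵀ * K + t • (Kᵀ * diagonal lam * K) = Kᵀ * (1 + t • diagonal lam) * K := by
    rw [Matrix.mul_add, Matrix.add_mul, Matrix.mul_smul, Matrix.smul_mul, Matrix.mul_one]
  simp only [h2]
  simp only [h1, relEsymm_congr K _ _ hK, relEsymm_diagonal, ← sum_prod_erase_eq_sum_esymm,
    det_mul, det_transpose, det_one, trace_mul_adjugate_congr, adjugate_one_add_smul_diagonal,
    Matrix.one_mul, trace_diagonal]
  ring

theorem trace_snd_mul_adjugate_add_smul (hg : g.PosDef) (hh : hᵀ = h) (t : ℝ) :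
    (h * (g + t • h).adjugate).trace =
      g.det * ∑ k ∈ Finset.range (n + 1), (k : ℝ) * t ^ (k - 1) * relEsymm g h k := by
  obtain ⟨K, lam, hK, rfl, rfl⟩ := exists_simultaneous_diagonal g h hg hh
  have h1 : Kᵀ * K = Kᵀ * 1 * K := by rw [Matrix.mul_one]
  have h2 : Kᵀ * K + t • (Kᵀ * diagonal lam * K) = Kᵀ * (1 + t • diagonal lam) * K := by
    rw [Matrix.mul_add, Matrix.add_mul, Matrix.mul_smul, Matrix.smul_mul, Matrix.mul_one]
  simp only [h2]
  simp only [h1, relEsymm_congr K _ _ hK, relEsymm_diagonal, ← sum_mul_prod_erase_eq_sum_esymm,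
    det_mul, det_transpose, det_one, trace_mul_adjugate_congr, adjugate_one_add_smul_diagonal,
    diagonal_mul_diagonal, trace_diagonal]
  ring

/-- The Newton tensor commutes with the shape operator and is symmetric, so that it is
trace-orthogonal to a skew form, and to a skew form composed with the shape operator. -/
theorem trace_skew_mul_adjugate_add_smul (hg : g.PosDef) (hh : hᵀ = h)
    {Q : Matrix (Fin n) (Fin n) ℝ} (hQ : Qᵀ = -Q) (t : ℝ) :
    (h * g⁻¹ * Q * (g + t • h).adjugate).trace = 0 ∧ (Q * (g + t • h).adjugate).trace = 0 := by
  obtain ⟨K, lam, hK, rfl, rfl⟩ := exists_simultaneous_diagonal g h hg hh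
  have hKt : IsUnit (Kᵀ).det := by rwa [det_transpose]
  have h2 : Kᵀ * K + t • (Kᵀ * diagonal lam * K) = Kᵀ * (1 + t • diagonal lam) * K := by
    rw [Matrix.mul_add, Matrix.add_mul, Matrix.mul_smul, Matrix.smul_mul, Matrix.mul_one]
  obtain ⟨Q', hQ', rfl⟩ : ∃ Q' : Matrix (Fin n) (Fin n) ℝ, Q'ᵀ = -Q' ∧ Q = Kᵀ * Q' * K := by
    refine ⟨(K⁻¹)ᵀ * Q * K⁻¹, ?_, ?_⟩
    · rw [transpose_mul, transpose_mul, transpose_transpose, hQ]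
      simp [Matrix.mul_assoc]
    · simp only [← Matrix.mul_assoc]
      rw [← transpose_mul, nonsing_inv_mul _ hK, transpose_one, Matrix.one_mul,
        Matrix.mul_assoc, nonsing_inv_mul _ hK, Matrix.mul_one]
  have hd : ∀ i, Q' i i = 0 := fun i => by
    have := congrFun (congrFun hQ' i) i
    simp only [transpose_apply, Matrix.neg_apply] at this
    linarith
  have h3 : Kᵀ * diagonal lam * K * (Kᵀ * K)⁻¹ * (Kᵀ * Q' * K) =
      Kᵀ * (diagonal lam * Q') * K := by
    rw [Matrix.mul_inv_rev]
    calc _ = Kᵀ * diagonal lam * (K * K⁻¹) * ((Kᵀ)⁻¹ * Kᵀ) * Q' * K := by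
          simp only [Matrix.mul_assoc]
      _ = _ := by
          rw [mul_nonsing_inv _ hK, nonsing_inv_mul _ hKt]
          simp only [Matrix.mul_assoc, Matrix.one_mul]
  rw [h2, h3, trace_mul_adjugate_congr, trace_mul_adjugate_congr,
    adjugate_one_add_smul_diagonal]
  constructor <;>
  · simp only [Matrix.trace, diag_apply, mul_diagonal, diagonal_mul, hd]
    simp

end LinearAlgebra

/-! ### Lorentz forms with a volume form -/

/-- A symmetric bilinear form of Lorentz signature on an `(n + 2)`-dimensional space `W`, together
with a volume form normalised by it: `vol m * vol m'` is minus the mixed Gram determinant of `m`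
and `m'`. -/
structure LorentzForm (n : ℕ) (W : Type*) [NormedAddCommGroup W] [NormedSpace ℝ W] where
  form : W →L[ℝ] W →L[ℝ] ℝ
  symm : ∀ v w, form v w = form w v
  vol : W [⋀^Fin (n + 2)]→L[ℝ] ℝ
  finrank_eq : Module.finrank ℝ W = n + 2
  vol_mul_vol : ∀ m m', vol m * vol m' = -(Matrix.of fun i j => form (m i) (m' j)).det

/-- The family `a, b, L₀, …, Lₙ₋₁`. -/
def cons₂ {n : ℕ} {W : Type*} (a b : W) (L : Fin n → W) : Fin (n + 2) → W :=
  Fin.cons (α := fun _ => W) a (Fin.cons (α := fun _ => W) b L)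

section Cons

variable {n : ℕ} {W : Type*} (a b c : W) (L : Fin n → W) (i : Fin n)

@[simp] theorem cons₂_zero : cons₂ a b L 0 = a := rfl

@[simp] theorem cons₂_succ_succ : cons₂ a b L i.succ.succ = L i := rfl

@[simp] theorem cons₂_one : cons₂ a b L 1 = b := rfl

@[simp] theorem cons₂_succ_zero : cons₂ a b L (Fin.succ 0) = b := rfl

theorem update_cons₂_zero : Function.update (cons₂ a b L) 0 c = cons₂ c b L :=
  Fin.update_cons_zero _ _ _

theorem update_cons₂_one : Function.update (cons₂ a b L) (Fin.succ 0) c = cons₂ a c L := by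
  unfold cons₂
  rw [← Fin.cons_update, Fin.update_cons_zero]

theorem update_cons₂_succ_succ :
    Function.update (cons₂ a b L) i.succ.succ c = cons₂ a b (Function.update L i c) := by
  unfold cons₂
  rw [← Fin.cons_update, ← Fin.cons_update]

end Cons

namespace LorentzForm

open Matrix

variable {n : ℕ} {W : Type*} [NormedAddCommGroup W] [NormedSpace ℝ W] (B : LorentzForm n W)

theorem vol_cons₂_swap (a b : W) (L : Fin n → W) :
    B.vol (cons₂ a b L) = -B.vol (cons₂ b a L) := by
  have h := B.vol.toAlternatingMap.map_swap (cons₂ b a L) (i := 0) (j := Fin.succ 0)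
    (Fin.succ_ne_zero _).symm
  have h2 : cons₂ b a L ∘ Equiv.swap 0 (Fin.succ 0) = cons₂ a b L := by
    rw [Equiv.comp_swap_eq_update, update_cons₂_one, update_cons₂_zero]
    rfl
  rw [h2] at h
  exact h

theorem vol_cons₂_update_swap (a b c : W) (L : Fin n → W) (i : Fin n) :
    B.vol (cons₂ a b (Function.update L i c)) = -B.vol (cons₂ a c (Function.update L i b)) := by
  have h := B.vol.toAlternatingMap.map_swap (cons₂ a c (Function.update L i b))
    (i := Fin.succ 0) (j := i.succ.succ)
    (fun h => (Fin.succ_ne_zero _).symm (Fin.succ_injective _ h))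
  have h2 : cons₂ a c (Function.update L i b) ∘ Equiv.swap (Fin.succ 0) i.succ.succ =
      cons₂ a b (Function.update L i c) := by
    rw [Equiv.comp_swap_eq_update, update_cons₂_succ_succ, update_cons₂_one,
      cons₂_succ_succ, Function.update_self, Function.update_idem]
    rfl
  rw [h2] at h
  exact h

theorem vol_cons₂_update_update_swap (a b c d : W) (L : Fin n → W) {i j : Fin n} (hij : i ≠ j) :
    B.vol (cons₂ a b (Function.update (Function.update L i c) j d)) =
      -B.vol (cons₂ a b (Function.update (Function.update L j c) i d)) := by
  have h := B.vol.toAlternatingMap.map_swap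
    (cons₂ a b (Function.update (Function.update L j c) i d))
    (i := i.succ.succ) (j := j.succ.succ)
    (fun h => hij (Fin.succ_injective _ (Fin.succ_injective _ h)))
  have h2 : cons₂ a b (Function.update (Function.update L j c) i d) ∘
      Equiv.swap i.succ.succ j.succ.succ =
      cons₂ a b (Function.update (Function.update L i c) j d) := by
    rw [Equiv.comp_swap_eq_update, update_cons₂_succ_succ, update_cons₂_succ_succ,
      cons₂_succ_succ, cons₂_succ_succ, Function.update_self,
      Function.update_of_ne hij.symm, Function.update_self]
    congr 1
    ext k
    by_cases hk : k = i
    · subst hk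
      simp [Function.update_of_ne hij]
    · by_cases hk' : k = j
      · subst hk'
        simp [Function.update_of_ne hk]
      · simp [hk, hk']
  rw [h2] at h
  exact h

theorem span_range_eq_top {m : Fin (n + 2) → W} (hm : B.vol m ≠ 0) :
    Submodule.span ℝ (Set.range m) = ⊤ := by
  have hli : LinearIndependent ℝ m := by
    by_contra hli
    exact hm (B.vol.toAlternatingMap.map_linearDependent m hli)
  exact hli.span_eq_top_of_card_eq_finrank (by rw [Fintype.card_fin, B.finrank_eq])

/-- A volume vanishes if a nonzero functional kills all the vectors. -/
theorem vol_eq_zero_of_form_eq_zero {w w' : W} (hw : B.form w w' ≠ 0) {m : Fin (n + 2) → W}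
    (hm : ∀ i, B.form w (m i) = 0) : B.vol m = 0 := by
  by_contra h
  have hle : Submodule.span ℝ (Set.range m) ≤ LinearMap.ker (B.form w).toLinearMap :=
    Submodule.span_le.2 (by rintro _ ⟨i, rfl⟩; exact hm i)
  rw [B.span_range_eq_top h] at hle
  exact hw (hle (Submodule.mem_top (x := w')))

/-- The form is nondegenerate. -/
theorem eq_zero_of_form_eq_zero {m : Fin (n + 2) → W} (hm : B.vol m ≠ 0) {w : W}
    (hw : ∀ i, B.form w (m i) = 0) : w = 0 := by
  have hmem : w ∈ Submodule.span ℝ (Set.range m) := by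
    rw [B.span_range_eq_top hm]
    exact Submodule.mem_top
  obtain ⟨c, hc⟩ := (Submodule.mem_span_range_iff_exists_fun ℝ).1 hmem
  have h1 : ∀ k, B.vol (Function.update m k w) = 0 := fun k => by
    have := B.vol_mul_vol (Function.update m k w) m
    rw [Matrix.det_eq_zero_of_row_eq_zero k (fun j => by simp [hw j]), neg_zero] at this
    exact (mul_eq_zero.1 this).resolve_right hm
  have h2 : ∀ k, c k = 0 := fun k => by
    have h3 := h1 k
    rw [← hc] at h3
    change B.vol.toMultilinearMap _ = 0 at h3
    rw [MultilinearMap.map_update_sum, Finset.sum_eq_single k] at h3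
    · rw [MultilinearMap.map_update_smul, Function.update_eq_self, smul_eq_mul] at h3
      exact (mul_eq_zero.1 h3).resolve_right hm
    · intro l _ hl
      rw [MultilinearMap.map_update_smul]
      exact smul_eq_zero_of_right _ (B.vol.toAlternatingMap.map_update_self m hl.symm)
    · simp
  rw [← hc]
  simp [h2]

/-- The mixed Gram determinant of a family, against a frame whose last `n` vectors are orthogonal
to the two unit vectors in front of them. -/
theorem vol_cons₂_mul_vol {f N : W} {F : Fin n → W} (hff : B.form f f = -1)
    (hNN : B.form N N = 1) (hfN : B.form f N = 0) (hfF : ∀ i, B.form f (F i) = 0)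
    (hNF : ∀ i, B.form N (F i) = 0) (L : Fin n → W) :
    B.vol (cons₂ f N L) * B.vol (cons₂ f N F) =
      (Matrix.of fun i j => B.form (L i) (F j)).det := by
  have hNf : B.form N f = 0 := by rw [B.symm, hfN]
  rw [B.vol_mul_vol, det_succ_row_zero, Fin.sum_univ_succ, Finset.sum_eq_zero, det_succ_row_zero,
    Fin.sum_univ_succ, Finset.sum_eq_zero]
  · simp [hff, hNN, Matrix.submatrix]
  · intro i _
    simp [hNF]
  · intro i _
    refine Fin.cases ?_ (fun i => ?_) i <;> simp [hfN, hfF]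

/-- The mixed Gram determinant of a family whose last `n` vectors are orthogonal to the two unit
vectors in front of the frame. -/
theorem vol_cons₂_mul_vol_of_orthogonal {f N : W} {F : Fin n → W} (a b : W) {L : Fin n → W}
    (hLf : ∀ i, B.form (L i) f = 0) (hLN : ∀ i, B.form (L i) N = 0) :
    B.vol (cons₂ a b L) * B.vol (cons₂ f N F) =
      (B.form a N * B.form b f - B.form a f * B.form b N) *
        (Matrix.of fun i j => B.form (L i) (F j)).det := by
  rw [B.vol_mul_vol, det_succ_column_zero, Fin.sum_univ_succ, Fin.sum_univ_succ,
    Finset.sum_eq_zero, det_succ_column_zero, Fin.sum_univ_succ, Finset.sum_eq_zero,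
    det_succ_column_zero, Fin.sum_univ_succ, Finset.sum_eq_zero]
  · have e1 : Fin.succAbove (1 : Fin (n + 2)) 0 = 0 := Fin.succAbove_ne_zero_zero (by simp)
    have e2 : ∀ k : Fin n, Fin.succAbove (1 : Fin (n + 2)) k.succ = k.succ.succ := fun k =>
      Fin.succ_succAbove_succ 0 k
    simp [Matrix.submatrix, e1, e2]
    ring
  · intro i _
    simp [hLN]
  · intro i _
    simp [hLN]
  · intro i _
    simp [hLf]

/-- The Piola identity: the divergence of `y ↦ vol (u, f, ∂z with i-th slot N)` involves no second
derivatives of `z`, because these enter symmetrically and the volume form is alternating. -/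
theorem sum_fderiv_vol_eq {u f N : Euc n → W} {L : Fin n → Euc n → W} {y : Euc n}
    (hu : DifferentiableAt ℝ u y) (hf : DifferentiableAt ℝ f y) (hN : DifferentiableAt ℝ N y)
    (hL : ∀ l, DifferentiableAt ℝ (L l) y)
    (hsymm : ∀ i l, fderiv ℝ (L l) y (EuclideanSpace.single i 1) =
      fderiv ℝ (L i) y (EuclideanSpace.single l 1)) :
    (∀ i, DifferentiableAt ℝ (fun y => B.vol (cons₂ (u y) (f y)
        (Function.update (fun l => L l y) i (N y)))) y) ∧
    ∑ i, fderiv ℝ (fun y => B.vol (cons₂ (u y) (f y)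
        (Function.update (fun l => L l y) i (N y)))) y (EuclideanSpace.single i 1) =
      ∑ i, (B.vol (cons₂ (fderiv ℝ u y (EuclideanSpace.single i 1)) (f y)
          (Function.update (fun l => L l y) i (N y))) +
        B.vol (cons₂ (u y) (fderiv ℝ f y (EuclideanSpace.single i 1))
          (Function.update (fun l => L l y) i (N y))) +
        B.vol (cons₂ (u y) (f y) (Function.update (fun l => L l y) i
          (fderiv ℝ N y (EuclideanSpace.single i 1))))) := by
  let G : Fin n → Fin (n + 2) → Euc n → W := fun i => cons₂ u f (Function.update L i N)
  have hG : ∀ i y, (fun j => G i j y) =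
      cons₂ (u y) (f y) (Function.update (fun l => L l y) i (N y)) := by
    intro i y
    funext j
    refine Fin.cases rfl (fun j => Fin.cases rfl (fun j => ?_) j) j
    by_cases h : j = i
    · subst h
      simp [G]
    · simp [G, h]
  have hGd : ∀ i j, DifferentiableAt ℝ (G i j) y := by
    intro i j
    refine Fin.cases hu (fun j => Fin.cases hf (fun j => ?_) j) j
    by_cases h : j = i
    · subst h
      simpa [G] using hN
    · simpa [G, h] using hL j
  have hder : ∀ i, HasFDerivAt (fun y => B.vol (cons₂ (u y) (f y)
        (Function.update (fun l => L l y) i (N y)))) _ y := fun i => by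
    have := (hasFDerivAt_const B.vol y).continuousAlternatingMap_apply
      (fun j => (hGd i j).hasFDerivAt)
    simpa only [hG] using this
  refine ⟨fun i => (hder i).differentiableAt, ?_⟩
  -- the terms with a second derivative of `z`; they cancel in pairs
  set T : Fin n → Fin n → ℝ := fun i l => if l = i then 0 else
    B.vol (cons₂ (u y) (f y) (Function.update (Function.update (fun l => L l y) i (N y)) l
      (fderiv ℝ (L l) y (EuclideanSpace.single i 1)))) with hT
  have hTskew : ∀ i l, T i l = -T l i := by
    intro i l
    by_cases h : l = i
    · simp [hT, h]
    · simp only [hT, if_neg h, if_neg (Ne.symm h)]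
      rw [B.vol_cons₂_update_update_swap _ _ _ _ _ (Ne.symm h), hsymm i l]
  have hTsum : ∑ i, ∑ l, T i l = 0 := by
    have h1 : ∑ i, ∑ l, T i l = -∑ i, ∑ l, T i l := by
      conv_lhs => rw [Finset.sum_comm]
      rw [← Finset.sum_neg_distrib]
      refine Finset.sum_congr rfl fun i _ => ?_
      rw [← Finset.sum_neg_distrib]
      exact Finset.sum_congr rfl fun l _ => hTskew l i
    linarith
  rw [← add_zero (∑ i, (_ + _ + _)), ← hTsum, ← Finset.sum_add_distrib]
  refine Finset.sum_congr rfl fun i _ => ?_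
  have hd := fderiv_continuousAlternatingMap_apply_apply (𝕜 := ℝ)
    (differentiableAt_const (c := B.vol) (x := y)) (hGd i) (EuclideanSpace.single i 1)
  simp only [hG] at hd
  rw [hd, Fin.sum_univ_succ, Fin.sum_univ_succ]
  simp only [update_cons₂_zero, update_cons₂_one, update_cons₂_succ_succ]
  have hrest : ∀ l, B.vol (cons₂ (u y) (f y) (Function.update (Function.update (fun l => L l y) i
        (N y)) l (fderiv ℝ (G i l.succ.succ) y (EuclideanSpace.single i 1)))) =
      T i l + if l = i then B.vol (cons₂ (u y) (f y) (Function.update (fun l => L l y) i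
          (fderiv ℝ N y (EuclideanSpace.single i 1)))) else 0 := by
    intro l
    by_cases h : l = i
    · subst h
      simp [hT, G]
    · simp [hT, G, h]
  simp only [hrest, Finset.sum_add_distrib, Finset.sum_ite_eq', Finset.mem_univ, if_true]
  have e2 : fderiv ℝ (fun _ : Euc n => B.vol) y (EuclideanSpace.single i 1)
      (cons₂ (u y) (f y) (Function.update (fun l => L l y) i (N y))) = 0 := by
    rw [fderiv_fun_const]
    rfl
  have e0 : G i 0 = u := rfl
  have e1 : G i (Fin.succ 0) = f := rfl
  rw [e0, e1, e2]
  ring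

end LorentzForm

/-! ### Hypersurface patches in the hyperboloid -/

section Patch

open Matrix Topology Filter

variable {n : ℕ} {W : Type*} [NormedAddCommGroup W] [NormedSpace ℝ W]

theorem two_le_infty : (1 + 1 : WithTop ℕ∞) ≤ ∞ := by
  rw [one_add_one_eq_two]
  exact WithTop.coe_le_coe.2 (le_top : (2 : ℕ∞) ≤ ⊤)

/-- The `i`-th partial derivative of `f` within `T`. -/
def partialDeriv (T : Set (Euc n)) (f : Euc n → W) (i : Fin n) (y : Euc n) : W :=
  fderivWithin ℝ f T y (EuclideanSpace.single i 1)

/-- The matrix `B(∂ᵢ a, ∂ⱼ b)`. -/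
def gramMatrix (B : LorentzForm n W) (T : Set (Euc n)) (a b : Euc n → W) (y : Euc n) :
    Matrix (Fin n) (Fin n) ℝ :=
  Matrix.of fun i j => B.form (partialDeriv T a i y) (partialDeriv T b j y)

/-- A piece `f : T → {B(f, f) = -1}` of a hypersurface of the hyperboloid, parametrised by a set
`T ⊆ ℝⁿ`, with unit normal field `N`. Derivatives are taken within `T`, which may contain boundary
points; `posDef` says that `f` is an immersion. -/
structure IsPatch (B : LorentzForm n W) (T : Set (Euc n)) (f N : Euc n → W) : Prop where
  uniqueDiffOn : UniqueDiffOn ℝ T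
  contDiffOn : ContDiffOn ℝ ∞ f T
  contDiffOn_normal : ContDiffOn ℝ ∞ N T
  form_self : ∀ y ∈ T, B.form (f y) (f y) = -1
  form_normal_self : ∀ y ∈ T, B.form (N y) (N y) = 1
  form_normal : ∀ y ∈ T, B.form (f y) (N y) = 0
  form_normal_partialDeriv : ∀ y ∈ T, ∀ i, B.form (N y) (partialDeriv T f i y) = 0
  posDef : ∀ y ∈ T, (gramMatrix B T f f y).PosDef

/-- The frame volume `vol(f, N, ∂₁f, …, ∂ₙf)`, a square root of the Gram determinant. -/
def frameVol (B : LorentzForm n W) (T : Set (Euc n)) (f N : Euc n → W) (y : Euc n) : ℝ :=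
  B.vol (cons₂ (f y) (N y) (fun l => partialDeriv T f l y))

/-- The field `r (q + κ f + ϑ N)` along a hypersurface with position `f` and normal `N`. -/
def rotField (r : W →L[ℝ] W) (q : W) (κ ϑ : ℝ) (f N : Euc n → W) (y : Euc n) : W :=
  r (q + κ • f y + ϑ • N y)

/-- The `i`-th component of the flux density: `vol(u, f, ∂z)` with the `i`-th slot replaced by `N`,
where `z = f + t N` is the parallel hypersurface. -/
def flux (B : LorentzForm n W) (T : Set (Euc n)) (f N u : Euc n → W) (t : ℝ) (i : Fin n)
    (y : Euc n) : ℝ :=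
  B.vol (cons₂ (u y) (f y)
    (Function.update (fun l => partialDeriv T f l y + t • partialDeriv T N l y) i (N y)))

namespace LorentzForm

/-- Leibniz rule for the form, within a set. -/
theorem fderivWithin_form (B : LorentzForm n W) {T : Set (Euc n)} {a b : Euc n → W} {y : Euc n}
    (hT : UniqueDiffWithinAt ℝ T y) (ha : DifferentiableWithinAt ℝ a T y)
    (hb : DifferentiableWithinAt ℝ b T y) (v : Euc n) :
    fderivWithin ℝ (fun y => B.form (a y) (b y)) T y v =
      B.form (fderivWithin ℝ a T y v) (b y) + B.form (a y) (fderivWithin ℝ b T y v) := by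
  have h := (B.form.isBoundedBilinearMap.hasFDerivAt (a y, b y)).comp_hasFDerivWithinAt y
    (ha.hasFDerivWithinAt.prodMk hb.hasFDerivWithinAt)
  have h2 : HasFDerivWithinAt (fun y => B.form (a y) (b y)) _ T y := h
  rw [h2.fderivWithin hT]
  simp [IsBoundedBilinearMap.deriv_apply, add_comm]

end LorentzForm

namespace IsPatch

variable {B : LorentzForm n W} {T : Set (Euc n)} {f N : Euc n → W} (P : IsPatch B T f N)
include P

theorem differentiableWithinAt {y : Euc n} (hy : y ∈ T) : DifferentiableWithinAt ℝ f T y :=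
  (P.contDiffOn y hy).differentiableWithinAt (by simp)

theorem differentiableWithinAt_normal {y : Euc n} (hy : y ∈ T) :
    DifferentiableWithinAt ℝ N T y :=
  (P.contDiffOn_normal y hy).differentiableWithinAt (by simp)

theorem fderivWithin_form_eq_zero {a b : Euc n → W} {c : ℝ} {y : Euc n} (hy : y ∈ T)
    (ha : DifferentiableWithinAt ℝ a T y) (hb : DifferentiableWithinAt ℝ b T y)
    (hc : ∀ y ∈ T, B.form (a y) (b y) = c) (v : Euc n) :
    B.form (fderivWithin ℝ a T y v) (b y) + B.form (a y) (fderivWithin ℝ b T y v) = 0 := by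
  rw [← B.fderivWithin_form (P.uniqueDiffOn y hy) ha hb, fderivWithin_congr (f := fun _ => c) hc
    (hc y hy), fderivWithin_fun_const]
  rfl

theorem form_partialDeriv {y : Euc n} (hy : y ∈ T) (i : Fin n) :
    B.form (f y) (partialDeriv T f i y) = 0 := by
  have h := P.fderivWithin_form_eq_zero hy (P.differentiableWithinAt hy)
    (P.differentiableWithinAt hy) P.form_self (EuclideanSpace.single i 1)
  rw [B.symm _ (f y)] at h
  unfold partialDeriv
  linarith

theorem form_normal_partialDeriv_normal {y : Euc n} (hy : y ∈ T) (i : Fin n) :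
    B.form (N y) (partialDeriv T N i y) = 0 := by
  have h := P.fderivWithin_form_eq_zero hy (P.differentiableWithinAt_normal hy)
    (P.differentiableWithinAt_normal hy) P.form_normal_self (EuclideanSpace.single i 1)
  rw [B.symm _ (N y)] at h
  unfold partialDeriv
  linarith

theorem form_partialDeriv_normal {y : Euc n} (hy : y ∈ T) (i : Fin n) :
    B.form (f y) (partialDeriv T N i y) = 0 := by
  have h := P.fderivWithin_form_eq_zero hy (P.differentiableWithinAt hy)
    (P.differentiableWithinAt_normal hy) P.form_normal (EuclideanSpace.single i 1)
  have h2 := P.form_normal_partialDeriv y hy i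
  rw [B.symm] at h2
  unfold partialDeriv at *
  linarith

theorem frameVol_sq {y : Euc n} (hy : y ∈ T) :
    frameVol B T f N y ^ 2 = (gramMatrix B T f f y).det := by
  rw [pow_two]
  exact B.vol_cons₂_mul_vol (P.form_self y hy) (P.form_normal_self y hy) (P.form_normal y hy)
    (P.form_partialDeriv hy) (P.form_normal_partialDeriv y hy) _

theorem frameVol_ne_zero {y : Euc n} (hy : y ∈ T) : frameVol B T f N y ≠ 0 := fun h => by
  have h1 := P.frameVol_sq hy
  rw [h] at h1
  exact (P.posDef y hy).det_pos.ne' (by rw [← h1]; simp)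

omit P in
theorem frame_gram_add_smul (t : ℝ) (y : Euc n) (i : Fin n) (w : W) :
    (Matrix.of fun k j => B.form (Function.update
        (fun l => partialDeriv T f l y + t • partialDeriv T N l y) i w k) (partialDeriv T f j y)) =
      (gramMatrix B T f f y + t • gramMatrix B T N f y).updateRow i
        (fun j => B.form w (partialDeriv T f j y)) := by
  ext k j
  by_cases h : k = i
  · subst h
    simp
  · simp [h, gramMatrix]

/-- The flux density, multiplied by the frame volume, in terms of the fundamental forms. -/
theorem flux_mul_frameVol (u : Euc n → W) (t : ℝ) {y : Euc n} (hy : y ∈ T) (i : Fin n) :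
    flux B T f N u t i y * frameVol B T f N y =
      ((gramMatrix B T f f y + t • gramMatrix B T N f y).updateRow i
        (fun j => B.form (u y) (partialDeriv T f j y))).det := by
  unfold flux frameVol
  rw [B.vol_cons₂_swap, B.vol_cons₂_update_swap, neg_neg,
    B.vol_cons₂_mul_vol (P.form_self y hy) (P.form_normal_self y hy) (P.form_normal y hy)
    (P.form_partialDeriv hy) (P.form_normal_partialDeriv y hy), frame_gram_add_smul]

/-- The derivative of the normal is the combination of the partial derivatives of the position
that the fundamental forms prescribe. -/
theorem partialDeriv_normal_eq {y : Euc n} (hy : y ∈ T) (i : Fin n) :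
    partialDeriv T N i y = ∑ m, (gramMatrix B T N f y * (gramMatrix B T f f y)⁻¹) i m •
      partialDeriv T f m y := by
  set S := gramMatrix B T N f y * (gramMatrix B T f f y)⁻¹ with hS
  have hg : IsUnit (gramMatrix B T f f y).det := (P.posDef y hy).det_pos.ne'.isUnit
  set w := partialDeriv T N i y - ∑ m, S i m • partialDeriv T f m y with hw
  suffices h : w = 0 from sub_eq_zero.1 h
  have hwf : B.form w (f y) = 0 := by
    rw [B.symm, hw]
    simp [P.form_partialDeriv_normal hy, P.form_partialDeriv hy]
  have hwN : B.form w (N y) = 0 := by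
    rw [B.symm, hw]
    simp [P.form_normal_partialDeriv_normal hy, P.form_normal_partialDeriv y hy]
  have hwF : ∀ j, B.form w (partialDeriv T f j y) = 0 := by
    intro j
    have h1 : (S * gramMatrix B T f f y) i j = gramMatrix B T N f y i j := by
      rw [hS, Matrix.mul_assoc, nonsing_inv_mul _ hg, Matrix.mul_one]
    rw [Matrix.mul_apply] at h1
    rw [hw]
    simp only [map_sub, map_sum, map_smul, _root_.sub_apply, _root_.sum_apply, _root_.smul_apply,
      smul_eq_mul]
    rw [sub_eq_zero]
    exact h1.symm
  refine B.eq_zero_of_form_eq_zero (P.frameVol_ne_zero hy) fun k => ?_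
  exact Fin.cases hwf (fun k => Fin.cases hwN hwF k) k

/-- In the interior the second fundamental form is symmetric. -/
theorem gramMatrix_normal_transpose {y : Euc n} (hy : T ∈ 𝓝 y) :
    (gramMatrix B T N f y)ᵀ = gramMatrix B T N f y := by
  have hyT := mem_of_mem_nhds hy
  have hf2 : ContDiffAt ℝ ∞ f y := P.contDiffOn.contDiffAt hy
  have hdf : DifferentiableAt ℝ (fderiv ℝ f) y :=
    (hf2.fderiv_right (m := 1) two_le_infty).differentiableAt (by simp)
  have hN : DifferentiableAt ℝ N y := (P.contDiffOn_normal.contDiffAt hy).differentiableAt (by simp)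
  have hsymm : IsSymmSndFDerivAt ℝ f y := hf2.isSymmSndFDerivAt
      (by simpa [one_add_one_eq_two] using two_le_infty)
  have hTn : ∀ᶠ y' in 𝓝 y, T ∈ 𝓝 y' := eventually_mem_nhds_iff.2 hy
  -- differentiate `B(N, ∂ⱼf) = 0`
  have key : ∀ i j, gramMatrix B T N f y i j = -B.form (N y)
      (fderiv ℝ (fderiv ℝ f) y (EuclideanSpace.single i 1) (EuclideanSpace.single j 1)) := by
    intro i j
    have hd : DifferentiableAt ℝ (fun y => fderiv ℝ f y (EuclideanSpace.single j 1)) y :=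
      hdf.clm_apply (differentiableAt_const _)
    have h0 : fderiv ℝ (fun y => B.form (N y) (fderiv ℝ f y (EuclideanSpace.single j 1))) y
        (EuclideanSpace.single i 1) = 0 := by
      have h : (fun y => B.form (N y) (fderiv ℝ f y (EuclideanSpace.single j 1))) =ᶠ[𝓝 y]
          fun _ => 0 := by
        filter_upwards [hTn] with y' hy'
        rw [← P.form_normal_partialDeriv y' (mem_of_mem_nhds hy') j, partialDeriv,
          fderivWithin_of_mem_nhds hy']
      rw [h.fderiv_eq, fderiv_fun_const]
      rfl
    have h1 := B.fderivWithin_form uniqueDiffWithinAt_univ hN.differentiableWithinAt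
      hd.differentiableWithinAt (EuclideanSpace.single i 1)
    simp only [fderivWithin_univ] at h1
    rw [h0, fderiv_clm_apply hdf (differentiableAt_const _)] at h1
    simp only [fderiv_fun_const] at h1
    simp only [gramMatrix, partialDeriv, Matrix.of_apply, fderivWithin_of_mem_nhds hy]
    simp at h1
    linarith
  ext i j
  rw [Matrix.transpose_apply, key, key, hsymm.eq]

/-- The divergence of the flux density. Differentiating `N` and `f` in it gives the two terms on the
right-hand side; differentiating `u` gives the traces of `trace_skew_mul_adjugate_add_smul`, since
`r` is skew. -/
theorem flux_differentiableAt_and_sum_fderiv {r : W →L[ℝ] W}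
    (hr : ∀ v w, B.form (r v) w = -B.form v (r w)) (q : W) (κ ϑ t : ℝ) {y : Euc n}
    (hy : T ∈ 𝓝 y) :
    (∀ i, DifferentiableAt ℝ (flux B T f N (rotField r q κ ϑ f N) t i) y) ∧
    (∑ i, fderiv ℝ (flux B T f N (rotField r q κ ϑ f N) t i) y (EuclideanSpace.single i 1)) *
        frameVol B T f N y =
      B.form (rotField r q κ ϑ f N y) (f y) *
          (gramMatrix B T f f y *
            (gramMatrix B T f f y + t • gramMatrix B T N f y).adjugate).trace -
        B.form (rotField r q κ ϑ f N y) (N y) *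
          (gramMatrix B T N f y *
            (gramMatrix B T f f y + t • gramMatrix B T N f y).adjugate).trace := by
  have hyT := mem_of_mem_nhds hy
  have hTn : ∀ᶠ y' in 𝓝 y, T ∈ 𝓝 y' := eventually_mem_nhds_iff.2 hy
  have hf2 : ContDiffAt ℝ ∞ f y := P.contDiffOn.contDiffAt hy
  have hN2 : ContDiffAt ℝ ∞ N y := P.contDiffOn_normal.contDiffAt hy
  have hf : DifferentiableAt ℝ f y := hf2.differentiableAt (by simp)
  have hN : DifferentiableAt ℝ N y := hN2.differentiableAt (by simp)
  have hdf : DifferentiableAt ℝ (fderiv ℝ f) y :=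
    (hf2.fderiv_right (m := 1) two_le_infty).differentiableAt (by simp)
  have hdN : DifferentiableAt ℝ (fderiv ℝ N) y :=
    (hN2.fderiv_right (m := 1) two_le_infty).differentiableAt (by simp)
  set u := rotField r q κ ϑ f N with hu'
  have hud : HasFDerivAt u (r.comp (κ • fderiv ℝ f y + ϑ • fderiv ℝ N y)) y :=
    r.hasFDerivAt.comp y (((hf.hasFDerivAt.const_smul κ).const_add q).add
      (hN.hasFDerivAt.const_smul ϑ))
  set e : Fin n → Euc n := fun i => EuclideanSpace.single i 1 with he
  let L : Fin n → Euc n → W := fun l y => fderiv ℝ f y (e l) + t • fderiv ℝ N y (e l)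
  have hL : ∀ l, HasFDerivAt (L l) ((fderiv ℝ (fderiv ℝ f) y).flip (e l) +
      t • (fderiv ℝ (fderiv ℝ N) y).flip (e l)) y := fun l =>
    (((ContinuousLinearMap.apply ℝ W (e l)).hasFDerivAt.comp y hdf.hasFDerivAt)).add
      (((ContinuousLinearMap.apply ℝ W (e l)).hasFDerivAt.comp y hdN.hasFDerivAt).const_smul t)
  have hsymm : ∀ i l, fderiv ℝ (L l) y (e i) = fderiv ℝ (L i) y (e l) := by
    intro i l
    rw [(hL l).fderiv, (hL i).fderiv]
    have h1 : IsSymmSndFDerivAt ℝ f y := hf2.isSymmSndFDerivAt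
      (by simpa [one_add_one_eq_two] using two_le_infty)
    have h2 : IsSymmSndFDerivAt ℝ N y := hN2.isSymmSndFDerivAt
      (by simpa [one_add_one_eq_two] using two_le_infty)
    simp [h1.eq (e i) (e l), h2.eq (e i) (e l)]
  obtain ⟨hd, hsum⟩ := B.sum_fderiv_vol_eq hud.differentiableAt hf hN
    (fun l => (hL l).differentiableAt) hsymm
  have hev : ∀ i, flux B T f N u t i =ᶠ[𝓝 y] fun y => B.vol (cons₂ (u y) (f y)
      (Function.update (fun l => L l y) i (N y))) := by
    intro i
    filter_upwards [hTn] with y' hy'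
    simp only [flux, partialDeriv, fderivWithin_of_mem_nhds hy', L, he]
  refine ⟨fun i => (hd i).congr_of_eventuallyEq (hev i), ?_⟩
  rw [Finset.sum_congr rfl fun i _ => by rw [(hev i).fderiv_eq], hsum, Finset.sum_mul]
  have hpf : ∀ l, fderiv ℝ f y (e l) = partialDeriv T f l y := fun l => by
    rw [partialDeriv, fderivWithin_of_mem_nhds hy]
  have hpN : ∀ l, fderiv ℝ N y (e l) = partialDeriv T N l y := fun l => by
    rw [partialDeriv, fderivWithin_of_mem_nhds hy]
  set g := gramMatrix B T f f y with hg
  set h := gramMatrix B T N f y with hh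
  have hLy : (fun l => L l y) = fun l => partialDeriv T f l y + t • partialDeriv T N l y :=
    funext fun l => by simp only [L, hpf, hpN]
  have hff := P.form_self y hyT
  have hNN := P.form_normal_self y hyT
  have hfN := P.form_normal y hyT
  have hNf : B.form (N y) (f y) = 0 := by rw [B.symm, hfN]
  -- the row `B(∂ᵢu, ∂ⱼf)` is a skew form composed with the shape operator
  set Q : Matrix (Fin n) (Fin n) ℝ := Matrix.of fun m j =>
    B.form (r (partialDeriv T f m y)) (partialDeriv T f j y) with hQ
  have hQskew : Qᵀ = -Q := by
    ext i j
    simp only [hQ, Matrix.transpose_apply, Matrix.of_apply, Matrix.neg_apply]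
    rw [hr, B.symm]
  have hrow : ∀ i, (fun j => B.form (fderiv ℝ u y (e i)) (partialDeriv T f j y)) =
      (κ • Q + ϑ • (h * g⁻¹ * Q)) i := by
    intro i
    ext j
    rw [hud.fderiv]
    have h1 : B.form (r (partialDeriv T N i y)) (partialDeriv T f j y) = (h * g⁻¹ * Q) i j := by
      rw [P.partialDeriv_normal_eq hyT i, Matrix.mul_apply]
      simp [hQ, hh, hg]
    simp [hpf, hpN, h1, hQ]
  have hperp : ∀ (i : Fin n) (w : W), B.form w (f y) = 0 → B.form w (N y) = 0 →
      (∀ k, B.form (Function.update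
        (fun l => partialDeriv T f l y + t • partialDeriv T N l y) i w k) (f y) = 0) ∧
      (∀ k, B.form (Function.update
        (fun l => partialDeriv T f l y + t • partialDeriv T N l y) i w k) (N y) = 0) := by
    intro i w hw1 hw2
    refine ⟨fun k => ?_, fun k => ?_⟩
    all_goals
      by_cases hk : k = i
      · subst hk
        simpa
      · rw [Function.update_of_ne hk, B.symm]
        simp [P.form_partialDeriv hyT, P.form_partialDeriv_normal hyT,
          P.form_normal_partialDeriv y hyT, P.form_normal_partialDeriv_normal hyT]
  have hterm : ∀ i, (B.vol (cons₂ (fderiv ℝ u y (e i)) (f y)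
          (Function.update (fun l => L l y) i (N y))) +
        B.vol (cons₂ (u y) (fderiv ℝ f y (e i)) (Function.update (fun l => L l y) i (N y))) +
        B.vol (cons₂ (u y) (f y) (Function.update (fun l => L l y) i (fderiv ℝ N y (e i))))) *
        frameVol B T f N y =
      ((g + t • h).updateRow i ((κ • Q + ϑ • (h * g⁻¹ * Q)) i)).det +
        B.form (u y) (f y) * ((g + t • h).updateRow i (g i)).det -
        B.form (u y) (N y) * ((g + t • h).updateRow i (h i)).det := by
    intro i
    rw [hLy, add_mul, add_mul, hpf, hpN]
    have e1 := (P.flux_mul_frameVol (fun _ => fderiv ℝ u y (e i)) t hyT i)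
    rw [hrow] at e1
    obtain ⟨p1, p2⟩ := hperp i (partialDeriv T f i y)
      (by rw [B.symm]; exact P.form_partialDeriv hyT i)
      (by rw [B.symm]; exact P.form_normal_partialDeriv y hyT i)
    have e2 := B.vol_cons₂_mul_vol_of_orthogonal (F := fun l => partialDeriv T f l y)
      (u y) (N y) p1 p2
    obtain ⟨p3, p4⟩ := hperp i (partialDeriv T N i y)
      (by rw [B.symm]; exact P.form_partialDeriv_normal hyT i)
      (by rw [B.symm]; exact P.form_normal_partialDeriv_normal hyT i)
    have e3 := B.vol_cons₂_mul_vol_of_orthogonal (F := fun l => partialDeriv T f l y)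
      (u y) (f y) p3 p4
    rw [frame_gram_add_smul] at e2 e3
    rw [hff, hfN] at e3
    rw [hNN, hNf] at e2
    rw [B.vol_cons₂_update_swap (u y)]
    unfold flux at e1
    rw [e1]
    unfold frameVol
    rw [neg_mul, e2, e3, ← hg, ← hh]
    have q1 : (fun j => B.form (partialDeriv T f i y) (partialDeriv T f j y)) = g i := rfl
    have q2 : (fun j => B.form (partialDeriv T N i y) (partialDeriv T f j y)) = h i := rfl
    rw [q1, q2]
    ring
  rw [Finset.sum_congr rfl fun i _ => hterm i, Finset.sum_sub_distrib, Finset.sum_add_distrib,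
    ← Finset.mul_sum, ← Finset.mul_sum, sum_det_updateRow, sum_det_updateRow, sum_det_updateRow,
    Matrix.add_mul, trace_add, smul_mul, smul_mul, trace_smul, trace_smul]
  obtain ⟨z1, z2⟩ := trace_skew_mul_adjugate_add_smul (P.posDef y hyT)
    (P.gramMatrix_normal_transpose hy) hQskew t
  rw [z1, z2]
  simp

/-- The flux through the boundary vanishes: there the functional
`B(q + κ f + ϑ N, ·)` kills all the vectors whose volume is the flux density. -/
theorem flux_eq_zero {r : W →L[ℝ] W} (hr : ∀ v w, B.form (r v) w = -B.form v (r w)) {q : W}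
    {κ ϑ : ℝ} (t : ℝ) {y : Euc n} (hy : y ∈ T) (i : Fin n) (hqf : B.form q (f y) = κ)
    (hqN : B.form q (N y) = -ϑ) (hq : B.form q q + κ ^ 2 - ϑ ^ 2 ≠ 0)
    (hqdf : ∀ l, l ≠ i → B.form q (partialDeriv T f l y) = 0)
    (hqdN : ∀ l, l ≠ i → B.form q (partialDeriv T N l y) = 0) :
    flux B T f N (rotField r q κ ϑ f N) t i y = 0 := by
  have hff := P.form_self y hy
  have hNN := P.form_normal_self y hy
  have hfN := P.form_normal y hy
  have hNf : B.form (N y) (f y) = 0 := by rw [B.symm, hfN]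
  refine B.vol_eq_zero_of_form_eq_zero (w := q + κ • f y + ϑ • N y)
    (w' := q + κ • f y + ϑ • N y) ?_ ?_
  · have h1 : B.form (f y) q = κ := by rw [B.symm, hqf]
    have h2 : B.form (N y) q = -ϑ := by rw [B.symm, hqN]
    simp only [map_add, map_smul, _root_.add_apply, _root_.smul_apply, smul_eq_mul, hff, hNN,
      hfN, hNf, h1, h2, hqf, hqN]
    intro h0
    apply hq
    linarith
  · intro k
    refine Fin.cases ?_ (fun k => Fin.cases ?_ (fun k => ?_) k) k
    · have h := hr (q + κ • f y + ϑ • N y) (q + κ • f y + ϑ • N y)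
      rw [B.symm] at h
      rw [cons₂_zero, rotField]
      linarith
    · simp [hff, hNf, hqf]
    · rw [cons₂_succ_succ]
      by_cases hk : k = i
      · subst hk
        simp [hNN, hfN, hqN]
      · simp [hk, hqdf k hk, hqdN k hk, P.form_partialDeriv hy, P.form_partialDeriv_normal hy,
          P.form_normal_partialDeriv y hy, P.form_normal_partialDeriv_normal hy]

end IsPatch

end Patch

/-! ### The divergence theorem on a half-space -/

section Divergence

open Topology Filter

/-- The divergence of a compactly supported vector field on the half-space `{y₀ ≥ 0}` that is
tangent to the boundary has integral zero. -/
theorem integral_halfSpace_divergence_eq_zero {n : ℕ} [NeZero n] {F : Fin n → Euc n → ℝ}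
    {K : Set (Euc n)} (hK : IsCompact K) (hF : ∀ i, ∀ y ∉ K, F i y = 0)
    (hcont : ∀ i, ContinuousOn (F i) {y | 0 ≤ y 0})
    (hdiff : ∀ i y, 0 < y 0 → DifferentiableAt ℝ (F i) y)
    (hbd : ∀ y : Euc n, y 0 = 0 → F 0 y = 0) {G : Euc n → ℝ}
    (hG : ∀ y : Euc n, 0 < y 0 →
      ∑ i, fderiv ℝ (F i) y (EuclideanSpace.single i 1) = G y)
    (hGi : IntegrableOn G {y | 0 ≤ y 0}) : ∫ y in {y : Euc n | 0 ≤ y 0}, G y = 0 := by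
  obtain ⟨m, rfl⟩ : ∃ m, n = m + 1 := Nat.exists_eq_succ_of_ne_zero (NeZero.ne n)
  obtain ⟨R, hR0, hR⟩ : ∃ R : ℝ, 0 < R ∧ ∀ y ∈ K, ∀ i, |y i| < R := by
    obtain ⟨R, hR0, hR⟩ := hK.isBounded.exists_pos_norm_lt
    exact ⟨R, hR0, fun y hy i => (PiLp.norm_apply_le y i).trans_lt (hR y hy)⟩
  let e : (Fin (m + 1) → ℝ) ≃L[ℝ] Euc (m + 1) := (PiLp.continuousLinearEquiv 2 ℝ fun _ => ℝ).symm
  have he : ∀ x i, e x i = x i := fun x i => rfl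
  have hmp : MeasurePreserving e := PiLp.volume_preserving_toLp (Fin (m + 1))
  have hemb : MeasurableEmbedding e := e.toHomeomorph.measurableEmbedding
  have hGx : IntegrableOn (G ∘ e) {x | 0 ≤ x 0} :=
    (hmp.integrableOn_comp_preimage hemb (s := {y | 0 ≤ y 0})).2 hGi
  have hint : ∫ y in {y : Euc (m + 1) | 0 ≤ y 0}, G y =
      ∫ x in {x : Fin (m + 1) → ℝ | 0 ≤ x 0}, G (e x) :=
    (hmp.setIntegral_preimage_emb hemb G {y | 0 ≤ y 0}).symm
  rw [hint]
  let a : Fin (m + 1) → ℝ := Fin.cons 0 fun _ => -R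
  let b : Fin (m + 1) → ℝ := fun _ => R
  have ha0 : a 0 = 0 := rfl
  have ha : ∀ i : Fin m, a i.succ = -R := fun i => rfl
  have hab : a ≤ b := by
    intro i
    refine Fin.cases hR0.le (fun i => ?_) i
    rw [ha]
    change -R ≤ R
    linarith
  have hsub : Icc a b ⊆ {x | 0 ≤ x 0} := fun x hx => hx.1 0
  -- the support lies in the box `[0, R] × [-R, R]ᵐ`, to which the divergence theorem applies;
  -- outside the box the divergence vanishes almost everywhere
  have hout : ∀ᵐ x : Fin (m + 1) → ℝ, x ∈ {x : Fin (m + 1) → ℝ | 0 ≤ x 0} \ Icc a b →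
      G (e x) = 0 := by
    have h0 : ∀ᵐ x : Fin (m + 1) → ℝ, x 0 ≠ 0 :=
      Measure.ae_eval_ne (fun _ : Fin (m + 1) => (volume : Measure ℝ)) 0 0
    filter_upwards [h0] with x hx0 hx
    have hpos : 0 < e x 0 := lt_of_le_of_ne hx.1 (Ne.symm hx0)
    have hxK : e x ∉ K := by
      intro hxK
      refine hx.2 ⟨fun i => ?_, fun i => (abs_lt.1 (hR _ hxK i)).2.le⟩
      refine Fin.cases hx.1 (fun i => ?_) i
      rw [ha]
      exact (abs_lt.1 (hR _ hxK i.succ)).1.le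
    rw [← hG _ hpos]
    refine Finset.sum_eq_zero fun i _ => ?_
    have : F i =ᶠ[𝓝 (e x)] fun _ => 0 := by
      filter_upwards [hK.isClosed.isOpen_compl.mem_nhds hxK] with y hy using hF i y hy
    rw [this.fderiv_eq, fderiv_fun_const]
    rfl
  have hmeas : MeasurableSet {x : Fin (m + 1) → ℝ | 0 ≤ x 0} :=
    measurableSet_le measurable_const (measurable_pi_apply 0)
  rw [setIntegral_eq_of_subset_of_ae_sdiff_eq_zero hmeas.nullMeasurableSet hsub hout]
  have hIoo : ∀ x ∈ Set.pi univ fun i => Ioo (a i) (b i),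
      ∑ i, ((fderiv ℝ (F i) (e x)).comp (e : (Fin (m + 1) → ℝ) →L[ℝ] Euc (m + 1)))
        (Pi.single i 1) = G (e x) := fun x hx => hG _ (hx 0 trivial).1
  have hae : (fun x => ∑ i, ((fderiv ℝ (F i) (e x)).comp
      (e : (Fin (m + 1) → ℝ) →L[ℝ] Euc (m + 1))) (Pi.single i 1)) =ᵐ[volume.restrict (Icc a b)]
      fun x => G (e x) := by
    rw [volume_pi, ← Measure.restrict_congr_set Measure.univ_pi_Ioo_ae_eq_Icc]
    exact (ae_restrict_iff' (MeasurableSet.univ_pi fun i => measurableSet_Ioo)).2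
      (Eventually.of_forall hIoo)
  have hdiv := integral_divergence_of_hasFDerivAt_off_countable' a b hab (fun i x => F i (e x))
    (fun i x => (fderiv ℝ (F i) (e x)).comp (e : (Fin (m + 1) → ℝ) →L[ℝ] Euc (m + 1))) ∅
    countable_empty
    (fun i => (hcont i).comp e.continuous.continuousOn fun x hx => hsub hx)
    (fun x hx i => (hdiff i _ (hx.1 0 trivial).1).hasFDerivAt.comp x e.hasFDerivAt)
    ((hGx.mono_set hsub).congr hae.symm)
  rw [integral_congr_ae hae] at hdiv
  rw [hdiv]
  -- the field vanishes on every face of the box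
  refine Finset.sum_eq_zero fun i _ => ?_
  have hfront : ∀ x : Fin m → ℝ, F i (e (i.insertNth (b i) x)) = 0 := by
    intro x
    refine hF i _ fun hmem => ?_
    have := hR _ hmem i
    rw [he, Fin.insertNth_apply_same] at this
    exact absurd this (by simp [b, abs_of_pos hR0])
  have hback : ∀ x : Fin m → ℝ, F i (e (i.insertNth (a i) x)) = 0 := by
    intro x
    rcases Fin.eq_zero_or_eq_succ i with rfl | ⟨j, rfl⟩
    · exact hbd _ (by rw [he, Fin.insertNth_apply_same, ha0])
    · refine hF _ _ fun hmem => ?_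
      have := hR _ hmem j.succ
      rw [he, Fin.insertNth_apply_same, ha] at this
      exact absurd this (by simp [abs_of_pos hR0])
  simp [hfront, hback]

end Divergence

/-! ### The weak Minkowski formula on a patch -/

section PatchIntegral

open Matrix Topology Filter

variable {n : ℕ} {W : Type*} [NormedAddCommGroup W] [NormedSpace ℝ W]

theorem continuousOn_partialDeriv {T : Set (Euc n)} {f : Euc n → W} (hT : UniqueDiffOn ℝ T)
    (hf : ContDiffOn ℝ ∞ f T) (i : Fin n) : ContinuousOn (partialDeriv T f i) T :=
  (hf.continuousOn_fderivWithin hT (by simp)).clm_apply continuousOn_const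

theorem continuousOn_gramMatrix (B : LorentzForm n W) {T : Set (Euc n)} {a b : Euc n → W}
    (hT : UniqueDiffOn ℝ T) (ha : ContDiffOn ℝ ∞ a T) (hb : ContDiffOn ℝ ∞ b T) :
    ContinuousOn (gramMatrix B T a b) T :=
  continuousOn_pi.2 fun i => continuousOn_pi.2 fun j =>
    (B.form.continuous.comp_continuousOn (continuousOn_partialDeriv hT ha i)).clm_apply
      (continuousOn_partialDeriv hT hb j)

theorem continuousOn_trace_mul {T : Set (Euc n)} {R S : Euc n → Matrix (Fin n) (Fin n) ℝ}
    (hR : ContinuousOn R T) (hS : ContinuousOn S T) :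
    ContinuousOn (fun y => (R y * S y).trace) T := by
  simp only [Matrix.trace, Matrix.diag_apply, Matrix.mul_apply]
  exact continuousOn_finsetSum _ fun i _ => continuousOn_finsetSum _ fun j _ =>
    (continuousOn_pi.1 (continuousOn_pi.1 hR i) j).mul
      (continuousOn_pi.1 (continuousOn_pi.1 hS j) i)

/-- A function on a relatively open subset of `H`, vanishing off a compact part of that subset, is
continuous on `H` if it is so on the subset. -/
theorem continuousOn_of_eq_zero_off_compact {E : Type*} [TopologicalSpace E] [T2Space E]
    {O H K : Set E} (hO : IsOpen O) (hK : IsCompact K) (hKO : K ⊆ O ∩ H) {F : E → ℝ}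
    (hF : ContinuousOn F (O ∩ H)) (h0 : ∀ y ∉ K, F y = 0) : ContinuousOn F H := by
  intro y hy
  by_cases hyK : y ∈ K
  · have h := hF y (hKO hyK)
    rw [inter_comm] at h
    exact (continuousWithinAt_inter (hO.mem_nhds (hKO hyK).1)).1 h
  · have : F =ᶠ[𝓝 y] fun _ => 0 := by
      filter_upwards [hK.isClosed.isOpen_compl.mem_nhds hyK] with z hz using h0 z hz
    exact (continuousAt_const.congr this.symm).continuousWithinAt

/-- The tangential derivatives of a map whose image of the boundary lies in a level set of a
linear functional are in the kernel of that functional. -/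
theorem form_partialDeriv_eq_zero_of_boundary [NeZero n] (B : LorentzForm n W) {O : Set (Euc n)}
    (hO : IsOpen O) {f : Euc n → W} {q : W} {c : ℝ} {y : Euc n}
    (hy : y ∈ O ∩ {y : Euc n | 0 ≤ y 0})
    (hf : DifferentiableWithinAt ℝ f (O ∩ {y : Euc n | 0 ≤ y 0}) y) (hy0 : y 0 = 0)
    (hc : ∀ z ∈ O, z 0 = 0 → B.form q (f z) = c) {l : Fin n} (hl : l ≠ 0) :
    B.form q (partialDeriv (O ∩ {y : Euc n | 0 ≤ y 0}) f l y) = 0 := by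
  set T := O ∩ {y : Euc n | 0 ≤ y 0} with hT
  let γ : ℝ → Euc n := fun s => y + s • EuclideanSpace.single l 1
  have hγ0 : γ 0 = y := by simp [γ]
  have hγ : HasDerivAt γ (EuclideanSpace.single l 1) 0 := by
    have h := ((hasDerivAt_id (0 : ℝ)).smul_const (EuclideanSpace.single l (1 : ℝ))).const_add y
    rw [one_smul] at h
    exact h
  have hγz : ∀ s, γ s 0 = 0 := fun s => by simp [γ, hy0, hl]
  have hγO : ∀ᶠ s in 𝓝 (0 : ℝ), γ s ∈ O :=
    hγ.continuousAt.preimage_mem_nhds (hO.mem_nhds (by rw [hγ0]; exact hy.1))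
  have hS : γ ⁻¹' T ∈ 𝓝 (0 : ℝ) := by
    filter_upwards [hγO] with s hs using ⟨hs, (hγz s).ge⟩
  have hfd : HasFDerivWithinAt f (fderivWithin ℝ f T y) T (γ 0) := by
    rw [hγ0]
    exact hf.hasFDerivWithinAt
  have h1 : HasDerivAt (fun s => B.form q (f (γ s)))
      (B.form q (fderivWithin ℝ f T y (EuclideanSpace.single l 1))) 0 :=
    (B.form q).hasFDerivAt.comp_hasDerivAt 0
      ((hfd.comp_hasDerivWithinAt 0 hγ.hasDerivWithinAt (mapsTo_preimage γ T)).hasDerivAt hS)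
  have h2 : (fun s => B.form q (f (γ s))) =ᶠ[𝓝 0] fun _ => c := by
    filter_upwards [hγO] with s hs using hc _ hs (hγz s)
  exact h1.unique ((hasDerivAt_const 0 c).congr_of_eventuallyEq h2)

/-- The generating function in `t` of the integrands of the Minkowski formulae, weighted with `ψ`,
plus the derivative of `ψ` along the flux field. The matrices `g`, `h` are the fundamental forms,
`a = B(u, f)`, `b = B(u, N)`, `w` is the list of the `B(u, ∂ⱼf)` and `dψ` that of the `∂ᵢψ`. -/
def weakIntegrand (g h : Matrix (Fin n) (Fin n) ℝ) (a b t ψ : ℝ) (w dψ : Fin n → ℝ) : ℝ :=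
  (ψ * (a * (g * (g + t • h).adjugate).trace - b * (h * (g + t • h).adjugate).trace) +
    (vecMulVec dψ w * (g + t • h).adjugate).trace) / g.det

/-- `weakIntegrand` for a patch. -/
def patchIntegrand (B : LorentzForm n W) (T : Set (Euc n)) (f N u : Euc n → W) (t : ℝ)
    (ψ : Euc n → ℝ) (y : Euc n) : ℝ :=
  weakIntegrand (gramMatrix B T f f y) (gramMatrix B T N f y) (B.form (u y) (f y))
    (B.form (u y) (N y)) t (ψ y) (fun j => B.form (u y) (partialDeriv T f j y))
    (fun i => partialDeriv T ψ i y)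

namespace IsPatch

variable {B : LorentzForm n W} {T : Set (Euc n)} {f N : Euc n → W} (P : IsPatch B T f N)
include P

theorem continuousOn_rotField (r : W →L[ℝ] W) (q : W) (κ ϑ : ℝ) :
    ContinuousOn (rotField r q κ ϑ f N) T :=
  r.continuous.comp_continuousOn ((continuousOn_const.add
    (P.contDiffOn.continuousOn.const_smul κ)).add (P.contDiffOn_normal.continuousOn.const_smul ϑ))

omit P in
theorem continuousOn_vol_cons₂ {a b : Euc n → W} {L : Fin n → Euc n → W}
    (ha : ContinuousOn a T) (hb : ContinuousOn b T) (hL : ∀ l, ContinuousOn (L l) T) :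
    ContinuousOn (fun y => B.vol (cons₂ (a y) (b y) fun l => L l y)) T := by
  refine B.vol.cont.comp_continuousOn (continuousOn_pi.2 fun j => ?_)
  exact Fin.cases ha (fun j => Fin.cases hb (fun j => hL j) j) j

theorem continuousOn_frameVol : ContinuousOn (frameVol B T f N) T :=
  continuousOn_vol_cons₂ P.contDiffOn.continuousOn P.contDiffOn_normal.continuousOn
    fun l => continuousOn_partialDeriv P.uniqueDiffOn P.contDiffOn l

theorem continuousOn_flux {u : Euc n → W} (hu : ContinuousOn u T) (t : ℝ) (i : Fin n) :
    ContinuousOn (flux B T f N u t i) T := by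
  have h := continuousOn_vol_cons₂ (B := B) hu P.contDiffOn.continuousOn
    (L := Function.update (fun l y => partialDeriv T f l y + t • partialDeriv T N l y) i N) ?_
  · refine h.congr fun y _ => ?_
    unfold flux
    congr 2
    ext l
    by_cases hl : l = i
    · subst hl
      simp
    · simp [hl]
  · intro l
    by_cases hl : l = i
    · subst hl
      simpa using P.contDiffOn_normal.continuousOn
    · simp only [Function.update_of_ne hl]
      exact (continuousOn_partialDeriv P.uniqueDiffOn P.contDiffOn l).add
        ((continuousOn_partialDeriv P.uniqueDiffOn P.contDiffOn_normal l).const_smul t)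

theorem sqrt_det_gramMatrix {y : Euc n} (hy : y ∈ T) :
    √(gramMatrix B T f f y).det = |frameVol B T f N y| := by
  rw [← P.frameVol_sq hy, Real.sqrt_sq_eq_abs]

theorem continuousOn_patchIntegrand {u : Euc n → W} (hu : ContinuousOn u T) (t : ℝ)
    {ψ : Euc n → ℝ} (hψ : ContDiffOn ℝ ∞ ψ T) :
    ContinuousOn (patchIntegrand B T f N u t ψ) T := by
  have hg := continuousOn_gramMatrix B P.uniqueDiffOn P.contDiffOn P.contDiffOn
  have hh := continuousOn_gramMatrix B P.uniqueDiffOn P.contDiffOn_normal P.contDiffOn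
  have hform : ∀ {v : Euc n → W}, ContinuousOn v T → ContinuousOn (fun y => B.form (u y) (v y)) T :=
    fun hv => (B.form.continuous.comp_continuousOn hu).clm_apply hv
  have hadj : ContinuousOn (fun y =>
      (gramMatrix B T f f y + t • gramMatrix B T N f y).adjugate) T :=
    Continuous.comp_continuousOn (g := fun A : Matrix (Fin n) (Fin n) ℝ => A.adjugate)
      continuous_id.matrix_adjugate (hg.add (hh.const_smul t))
  have htr : ∀ R : Euc n → Matrix (Fin n) (Fin n) ℝ, ContinuousOn R T → ContinuousOn (fun y =>
      (R y * (gramMatrix B T f f y + t • gramMatrix B T N f y).adjugate).trace) T := fun R hR =>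
    continuousOn_trace_mul hR hadj
  have hdet : ContinuousOn (fun y => (gramMatrix B T f f y).det) T :=
    Continuous.comp_continuousOn (g := fun A : Matrix (Fin n) (Fin n) ℝ => A.det)
      continuous_id.matrix_det hg
  have hvec : ContinuousOn (fun y => vecMulVec (fun i => partialDeriv T ψ i y)
      (fun j => B.form (u y) (partialDeriv T f j y))) T :=
    continuousOn_pi.2 fun i => continuousOn_pi.2 fun j =>
      (continuousOn_partialDeriv P.uniqueDiffOn hψ i).mul
        (hform (continuousOn_partialDeriv P.uniqueDiffOn P.contDiffOn j))
  have h1 := (hform P.contDiffOn.continuousOn).mul (htr _ hg)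
  have h2 := (hform P.contDiffOn_normal.continuousOn).mul (htr _ hh)
  have h3 := (hψ.continuousOn.mul (h1.sub h2)).add (htr _ hvec)
  exact h3.div hdet fun y hy => (P.posDef y hy).det_pos.ne'

end IsPatch

/-- The weak Minkowski formula on a patch over a relatively open subset of the half-space: the
integrand is, up to the sign of the frame volume, the divergence of `ψ` times the flux density. -/
theorem IsPatch.integral_patchIntegrand_eq_zero [NeZero n] {B : LorentzForm n W}
    {O T : Set (Euc n)} (hO : IsOpen O) (hT : T = O ∩ {y : Euc n | 0 ≤ y 0})
    {f N : Euc n → W} (P : IsPatch B T f N) {r : W →L[ℝ] W}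
    (hr : ∀ v w, B.form (r v) w = -B.form v (r w)) {q : W} {κ ϑ : ℝ}
    (hqf : ∀ y ∈ T, y 0 = 0 → B.form q (f y) = κ) (hqN : ∀ y ∈ T, y 0 = 0 → B.form q (N y) = -ϑ)
    (hq : B.form q q + κ ^ 2 - ϑ ^ 2 ≠ 0) (t : ℝ) {ψ : Euc n → ℝ} (hψ : ContDiffOn ℝ ∞ ψ T)
    {K : Set (Euc n)} (hK : IsCompact K) (hKT : K ⊆ T) (hψK : ∀ y ∉ K, ψ y = 0) :
    IntegrableOn (fun y => patchIntegrand B T f N (rotField r q κ ϑ f N) t ψ y *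
        √(gramMatrix B T f f y).det) T ∧
      ∫ y in T, patchIntegrand B T f N (rotField r q κ ϑ f N) t ψ y *
        √(gramMatrix B T f f y).det = 0 := by
  set u := rotField r q κ ϑ f N with hu
  set D := frameVol B T f N with hD
  have hHm : MeasurableSet {y : Euc n | 0 ≤ y 0} :=
    (isClosed_le continuous_const (by fun_prop)).measurableSet
  have hTm : MeasurableSet T := hT ▸ hO.measurableSet.inter hHm
  have huc := P.continuousOn_rotField r q κ ϑ
  set G : Euc n → ℝ := T.indicator fun y => patchIntegrand B T f N u t ψ y *
        √(gramMatrix B T f f y).det with hG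
  have hnhds : ∀ y ∈ T, 0 < y 0 → T ∈ 𝓝 y := by
    intro y hy hy0
    rw [hT]
    exact inter_mem (hO.mem_nhds (hT ▸ hy).1)
      (mem_of_superset ((isOpen_lt continuous_const
          (by fun_prop : Continuous fun y : Euc n => y 0)).mem_nhds hy0)
        fun z (hz : 0 < z 0) => hz.le)
  have hψ0 : ∀ y ∉ K, ψ =ᶠ[𝓝 y] fun _ => 0 := fun y hy => by
    filter_upwards [hK.isClosed.isOpen_compl.mem_nhds hy] with z hz using hψK z hz
  have hG0 : ∀ y ∉ K, G y = 0 := by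
    intro y hy
    by_cases hyT : y ∈ T
    · rw [hG, indicator_of_mem hyT]
      have h1 : (fun i => partialDeriv T ψ i y) = 0 := by
        ext i
        rw [partialDeriv, ((hψ0 y hy).filter_mono nhdsWithin_le_nhds).fderivWithin_eq (hψK y hy),
          fderivWithin_fun_const]
        rfl
      simp [patchIntegrand, weakIntegrand, hψK y hy, h1]
    · exact indicator_of_notMem hyT _
  have hGcT : ContinuousOn G T :=
    ((P.continuousOn_patchIntegrand huc t hψ).mul (Real.continuous_sqrt.comp_continuousOn
      ((continuous_id.matrix_det).comp_continuousOn
        (continuousOn_gramMatrix B P.uniqueDiffOn P.contDiffOn P.contDiffOn)))).congr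
      fun y hy => indicator_of_mem hy _
  have hGi : Integrable G := by
    have h1 : IntegrableOn G K := (hGcT.mono hKT).integrableOn_compact hK
    exact (integrableOn_iff_integrable_of_support_subset
      (Function.support_subset_iff'.2 hG0)).1 h1
  -- the sign of the frame volume is locally constant
  set σ : Euc n → ℝ := fun y => D y / |D y| with hσ
  have hDne : ∀ y ∈ T, D y ≠ 0 := fun y hy => P.frameVol_ne_zero hy
  have hσc : ContinuousOn σ T := P.continuousOn_frameVol.div P.continuousOn_frameVol.abs
    fun y hy => abs_ne_zero.2 (hDne y hy)
  have hσloc : ∀ y ∈ T, T ∈ 𝓝 y → σ =ᶠ[𝓝 y] fun _ => σ y := by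
    intro y hy hTy
    have hDc : ContinuousAt D y := P.continuousOn_frameVol.continuousAt hTy
    rcases (hDne y hy).lt_or_gt with h | h
    · filter_upwards [hDc.eventually_lt_const h] with z hz
      simp only [hσ, abs_of_neg hz, abs_of_neg h, div_neg, div_self hz.ne, div_self h.ne]
    · filter_upwards [hDc.eventually_const_lt h] with z hz
      simp only [hσ, abs_of_pos hz, abs_of_pos h, div_self hz.ne', div_self h.ne']
  set F : Fin n → Euc n → ℝ := fun i y => ψ y * (σ y * flux B T f N u t i y) with hF
  have hFd : ∀ i, ∀ y ∈ T, 0 < y 0 → HasFDerivAt (F i)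
      (ψ y • (σ y • fderiv ℝ (flux B T f N u t i) y) +
        (σ y * flux B T f N u t i y) • fderiv ℝ ψ y) y := by
    intro i y hy hy0
    have hTy := hnhds y hy hy0
    have h1 : HasFDerivAt (fun z => σ z * flux B T f N u t i z)
        (σ y • fderiv ℝ (flux B T f N u t i) y) y := by
      have h2 := ((P.flux_differentiableAt_and_sum_fderiv hr q κ ϑ t hTy).1 i).hasFDerivAt.const_mul
        (σ y)
      refine h2.congr_of_eventuallyEq ?_
      filter_upwards [hσloc y hy hTy] with z hz
      rw [hz]
    exact (((hψ.contDiffAt hTy).differentiableAt (by simp)).hasFDerivAt).mul h1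
  have hFzero : ∀ i, ∀ y ∉ K, F i y = 0 := fun i y hy => by simp [hF, hψK y hy]
  have hint := integral_halfSpace_divergence_eq_zero (F := F) (G := G) hK hFzero ?_ ?_ ?_ ?_
    hGi.integrableOn
  · have h1 : ∫ y in T, patchIntegrand B T f N u t ψ y * √(gramMatrix B T f f y).det =
        ∫ y, G y := (integral_indicator hTm).symm
    refine ⟨(integrable_indicator_iff hTm).1 hGi, ?_⟩
    rw [h1, ← hint]
    refine (setIntegral_eq_integral_of_forall_compl_eq_zero fun y hy => ?_).symm
    exact indicator_of_notMem (fun hyT => hy (hT ▸ hyT).2) _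
  · intro i
    refine continuousOn_of_eq_zero_off_compact hO hK (hT ▸ hKT) ?_ (hFzero i)
    rw [← hT]
    exact hψ.continuousOn.mul (hσc.mul (P.continuousOn_flux huc t i))
  · intro i y hy0
    by_cases hy : y ∈ T
    · exact (hFd i y hy hy0).differentiableAt
    · have : F i =ᶠ[𝓝 y] fun _ => 0 := by
        filter_upwards [hK.isClosed.isOpen_compl.mem_nhds fun h => hy (hKT h)] with z hz
          using hFzero i z hz
      exact (differentiableAt_const 0).congr_of_eventuallyEq this
  · intro y hy0
    by_cases hy : y ∈ T
    · have h0 : flux B T f N u t 0 y = 0 := by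
        refine P.flux_eq_zero hr t hy 0 (hqf y hy hy0) (hqN y hy hy0) hq ?_ ?_
        · intro l hl
          have hd := P.differentiableWithinAt hy
          subst hT
          exact form_partialDeriv_eq_zero_of_boundary B hO hy hd hy0
            (fun z hz hz0 => hqf z ⟨hz, hz0.ge⟩ hz0) hl
        · intro l hl
          have hd := P.differentiableWithinAt_normal hy
          subst hT
          exact form_partialDeriv_eq_zero_of_boundary B hO hy hd hy0
            (fun z hz hz0 => hqN z ⟨hz, hz0.ge⟩ hz0) hl
      simp [hF, h0]
    · exact hFzero 0 y fun h => hy (hKT h)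
  · intro y hy0
    by_cases hy : y ∈ T
    · have hTy := hnhds y hy hy0
      have hsum := (P.flux_differentiableAt_and_sum_fderiv hr q κ ϑ t hTy).2
      have hfl := fun i => P.flux_mul_frameVol u t hy i
      have hDy := hDne y hy
      have hsq := P.frameVol_sq hy
      rw [hG, indicator_of_mem hy, P.sqrt_det_gramMatrix hy, patchIntegrand, weakIntegrand, ← hsq,
        ← hD]
      set g := gramMatrix B T f f y
      set h := gramMatrix B T N f y
      have hR : (vecMulVec (fun i => partialDeriv T ψ i y)
          (fun j => B.form (u y) (partialDeriv T f j y)) * (g + t • h).adjugate).trace =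
          ∑ i, partialDeriv T ψ i y * (flux B T f N u t i y * D y) := by
        rw [← sum_det_updateRow]
        refine Finset.sum_congr rfl fun i _ => ?_
        rw [hfl, ← det_updateRow_smul]
        rfl
      rw [hR, ← hsum]
      have hpψ : ∀ i, fderiv ℝ ψ y (EuclideanSpace.single i 1) = partialDeriv T ψ i y := fun i => by
        rw [partialDeriv, fderivWithin_of_mem_nhds hTy]
      simp only [(hFd _ y hy hy0).fderiv, _root_.add_apply, _root_.smul_apply, smul_eq_mul, hpψ]
      have hs : σ y = D y / D y ^ 2 * |D y| := by
        have habs : |D y| ≠ 0 := abs_ne_zero.2 hDy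
        simp only [hσ]
        rw [← sq_abs (D y)]
        field_simp
      have hfac : ∑ i, partialDeriv T ψ i y * (flux B T f N u t i y * D y) =
          (∑ i, partialDeriv T ψ i y * flux B T f N u t i y) * D y := by
        rw [Finset.sum_mul]
        exact Finset.sum_congr rfl fun i _ => by ring
      rw [hfac, ← hu, ← hD]
      have hring : ∀ A S : ℝ, (ψ y * (A * D y) + S * D y) / D y ^ 2 * |D y| =
          σ y * (ψ y * A + S) := fun A S => by
        rw [hs]
        ring
      rw [hring, Finset.mul_sum, ← Finset.sum_add_distrib, Finset.mul_sum]
      exact Finset.sum_congr rfl fun i _ => by ring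
    · have h0 : ∀ i, F i =ᶠ[𝓝 y] fun _ => 0 := fun i => by
        filter_upwards [hK.isClosed.isOpen_compl.mem_nhds fun h => hy (hKT h)] with z hz
          using hFzero i z hz
      rw [hG0 y fun h => hy (hKT h)]
      refine Finset.sum_eq_zero fun i _ => ?_
      rw [(h0 i).fderiv_eq, fderiv_fun_const]
      rfl

end PatchIntegral

/-! ### Maps on a manifold with boundary in its charts -/

section Charts

open Topology Filter

variable {n : ℕ} [NeZero n] {M : Type*} [TopologicalSpace M]
  [ChartedSpace (EuclideanHalfSpace n) M]
  {E : Type*} [NormedAddCommGroup E] [NormedSpace ℝ E]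

variable (n) in
/-- The domain in `ℝⁿ` of the coordinates of the chart at `p`. -/
def chartDomain (p : M) : Set (Euc n) := (extChartAt (𝓡∂ n) p).target

variable (n) in
/-- The expression of a map in the coordinates of the chart at `p`. -/
def chartRep (w : M → E) (p : M) : Euc n → E := w ∘ (extChartAt (𝓡∂ n) p).symm

omit [NormedAddCommGroup E] [NormedSpace ℝ E] in
theorem chartRep_apply (w : M → E) (p : M) {z : M} (hz : z ∈ (extChartAt (𝓡∂ n) p).source) :
    chartRep n w p (extChartAt (𝓡∂ n) p z) = w z := by
  rw [chartRep, Function.comp_apply, (extChartAt (𝓡∂ n) p).left_inv hz]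

theorem exists_chartDomain_eq_inter (p : M) :
    ∃ O : Set (Euc n), IsOpen O ∧ chartDomain n p = O ∩ {y : Euc n | 0 ≤ y 0} := by
  refine ⟨(𝓡∂ n).symm ⁻¹' (chartAt (EuclideanHalfSpace n) p).target,
    (chartAt (EuclideanHalfSpace n) p).open_target.preimage (𝓡∂ n).continuous_symm, ?_⟩
  rw [chartDomain, extChartAt_target, range_modelWithCornersEuclideanHalfSpace]

theorem measurableSet_chartDomain (p : M) : MeasurableSet (chartDomain n p) := by
  obtain ⟨O, hO, h⟩ := exists_chartDomain_eq_inter (n := n) p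
  rw [h]
  exact hO.measurableSet.inter (isClosed_le continuous_const
    (by fun_prop : Continuous fun y : Euc n => y 0)).measurableSet

theorem uniqueDiffOn_chartDomain (p : M) : UniqueDiffOn ℝ (chartDomain n p) :=
  uniqueDiffOn_extChartAt_target p

theorem fderivWithin_range_eq (f : Euc n → E) (p : M) {y : Euc n} (hy : y ∈ chartDomain n p) :
    fderivWithin ℝ f (range (𝓡∂ n)) y = fderivWithin ℝ f (chartDomain n p) y :=
  (fderivWithin_congr_set (extChartAt_target_eventuallyEq_of_mem hy)).symm

variable [IsManifold (𝓡∂ n) ∞ M]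

theorem contDiffOn_chartRep {w : M → E} (hw : ContMDiff (𝓡∂ n) 𝓘(ℝ, E) ∞ w) (p : M) :
    ContDiffOn ℝ ∞ (chartRep n w p) (chartDomain n p) :=
  contMDiffOn_iff_contDiffOn.1 (hw.comp_contMDiffOn (contMDiffOn_extChartAt_symm p))

variable (n) in
/-- The Jacobi matrix of the transition from the chart at `p` to the chart at `q`, at `z`. -/
def transitionMatrix (p q z : M) : Matrix (Fin n) (Fin n) ℝ :=
  Matrix.of fun k i => tangentCoordChange (𝓡∂ n) p q z (EuclideanSpace.single i 1) k

theorem fderivWithin_chartRep_change {w : M → E} (hw : ContMDiff (𝓡∂ n) 𝓘(ℝ, E) ∞ w) {p q z : M}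
    (hp : z ∈ (extChartAt (𝓡∂ n) p).source) (hq : z ∈ (extChartAt (𝓡∂ n) q).source) :
    fderivWithin ℝ (chartRep n w p) (chartDomain n p) (extChartAt (𝓡∂ n) p z) =
      (fderivWithin ℝ (chartRep n w q) (chartDomain n q) (extChartAt (𝓡∂ n) q z)).comp
        (tangentCoordChange (𝓡∂ n) p q z) := by
  have : IsManifold (𝓡∂ n) 1 M := IsManifold.of_le (n := ∞) (by simp)
  set y := extChartAt (𝓡∂ n) p z with hy
  have hyT : y ∈ chartDomain n p := (extChartAt (𝓡∂ n) p).map_source hp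
  have hyq : extChartAt (𝓡∂ n) q z ∈ chartDomain n q := (extChartAt (𝓡∂ n) q).map_source hq
  have hsy : (extChartAt (𝓡∂ n) p).symm y = z := (extChartAt (𝓡∂ n) p).left_inv hp
  rw [← fderivWithin_range_eq _ p hyT]
  have h1 : HasFDerivWithinAt (extChartAt (𝓡∂ n) q ∘ (extChartAt (𝓡∂ n) p).symm)
      (tangentCoordChange (𝓡∂ n) p q z) (range (𝓡∂ n)) y :=
    hasFDerivWithinAt_tangentCoordChange ⟨hp, hq⟩
  have h2 : HasFDerivWithinAt (chartRep n w q)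
      (fderivWithin ℝ (chartRep n w q) (chartDomain n q) (extChartAt (𝓡∂ n) q z)) (range (𝓡∂ n))
      ((extChartAt (𝓡∂ n) q ∘ (extChartAt (𝓡∂ n) p).symm) y) := by
    rw [Function.comp_apply, hsy]
    have h3 := ((contDiffOn_chartRep hw q).differentiableOn (by simp) _ hyq).hasFDerivWithinAt
    exact h3.mono_of_mem_nhdsWithin
      (extChartAt_target_mem_nhdsWithin_of_mem hyq)
  have h4 := h2.comp y h1 fun y' _ => ?_
  · have h5 : chartRep n w p =ᶠ[𝓝[range (𝓡∂ n)] y]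
        chartRep n w q ∘ (extChartAt (𝓡∂ n) q ∘ (extChartAt (𝓡∂ n) p).symm) := by
      have hc : (extChartAt (𝓡∂ n) p).symm ⁻¹' (extChartAt (𝓡∂ n) q).source ∈ 𝓝 y :=
        (continuousAt_extChartAt_symm'' hyT).preimage_mem_nhds
          (by rw [hsy]; exact (isOpen_extChartAt_source q).mem_nhds hq)
      filter_upwards [mem_nhdsWithin_of_mem_nhds hc] with y' hy'
      simp only [chartRep, Function.comp_apply]
      rw [(extChartAt (𝓡∂ n) q).left_inv hy']
    have h6 := h4.congr_of_eventuallyEq h5 ?_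
    · exact h6.fderivWithin ((𝓡∂ n).uniqueDiffOn y (extChartAt_target_subset_range p hyT))
    · simp only [chartRep, Function.comp_apply]
      rw [hsy, (extChartAt (𝓡∂ n) q).left_inv hq]
  · exact mem_range_self _

theorem sum_transitionMatrix_smul (p q z : M) (i : Fin n) :
    tangentCoordChange (𝓡∂ n) p q z (EuclideanSpace.single i 1) =
      ∑ k, transitionMatrix n p q z k i • EuclideanSpace.single k (1 : ℝ) := by
  have h := (EuclideanSpace.basisFun (Fin n) ℝ).sum_repr
    (tangentCoordChange (𝓡∂ n) p q z (EuclideanSpace.single i 1))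
  simp only [EuclideanSpace.basisFun_apply] at h
  exact h.symm

theorem partialDeriv_change {w : M → E} (hw : ContMDiff (𝓡∂ n) 𝓘(ℝ, E) ∞ w) {p q z : M}
    (hp : z ∈ (extChartAt (𝓡∂ n) p).source) (hq : z ∈ (extChartAt (𝓡∂ n) q).source) (i : Fin n) :
    partialDeriv (chartDomain n p) (chartRep n w p) i (extChartAt (𝓡∂ n) p z) =
      ∑ k, transitionMatrix n p q z k i •
        partialDeriv (chartDomain n q) (chartRep n w q) k (extChartAt (𝓡∂ n) q z) := by
  rw [partialDeriv, fderivWithin_chartRep_change hw hp hq, ContinuousLinearMap.comp_apply,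
    sum_transitionMatrix_smul, map_sum]
  simp only [map_smul]
  rfl

theorem transitionMatrix_mul {p q z : M} (hp : z ∈ (extChartAt (𝓡∂ n) p).source)
    (hq : z ∈ (extChartAt (𝓡∂ n) q).source) :
    transitionMatrix n q p z * transitionMatrix n p q z = 1 := by
  have : IsManifold (𝓡∂ n) 1 M := IsManifold.of_le (n := ∞) (by simp)
  ext j i
  have h := tangentCoordChange_comp (I := 𝓡∂ n) (w := p) (x := q) (y := p) (z := z)
    (v := EuclideanSpace.single i 1) ⟨⟨hp, hq⟩, hp⟩
  rw [tangentCoordChange_self hp, sum_transitionMatrix_smul, map_sum] at h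
  have h2 := congrArg (fun v : Euc n => v j) h
  simp only [map_smul] at h2
  rw [Matrix.mul_apply, Matrix.one_apply]
  have h3 : ∑ k, transitionMatrix n p q z k i * transitionMatrix n q p z j k =
      (EuclideanSpace.single i (1 : ℝ)).ofLp j := by
    rw [← h2]
    simp only [WithLp.ofLp_sum, WithLp.ofLp_smul, Finset.sum_apply, Pi.smul_apply, smul_eq_mul]
    rfl
  rw [Finset.sum_congr rfl fun k _ => mul_comm _ _, h3, PiLp.single_apply]

theorem isUnit_det_transitionMatrix {p q z : M} (hp : z ∈ (extChartAt (𝓡∂ n) p).source)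
    (hq : z ∈ (extChartAt (𝓡∂ n) q).source) : IsUnit (transitionMatrix n p q z).det := by
  refine IsUnit.of_mul_eq_one (transitionMatrix n q p z).det ?_
  rw [mul_comm, ← Matrix.det_mul, transitionMatrix_mul hp hq, Matrix.det_one]

theorem det_tangentCoordChange (p q z : M) :
    (tangentCoordChange (𝓡∂ n) p q z).det = (transitionMatrix n p q z).det := by
  rw [ContinuousLinearMap.det, ← LinearMap.det_toMatrix
    (EuclideanSpace.basisFun (Fin n) ℝ).toBasis]
  congr 1

end Charts

/-! ### The area measure in a chart -/

section Area

open Topology Filter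

variable {n : ℕ} [NeZero n] {M : Type*} [TopologicalSpace M]
  [ChartedSpace (EuclideanHalfSpace n) M] [IsManifold (𝓡∂ n) ∞ M]

omit [IsManifold (𝓡∂ n) ∞ M] in
theorem chartGram_eq (c : Euc (n + 1) → ℝ) (x : M → Euc (n + 1)) (p : M) {y : Euc n}
    (hy : y ∈ chartDomain n p) : chartGram c x p y = Matrix.of fun i j =>
      metric c (chartRep n x p y) (partialDeriv (chartDomain n p) (chartRep n x p) i y)
        (partialDeriv (chartDomain n p) (chartRep n x p) j y) := by
  unfold chartGram partialDeriv
  rw [← fderivWithin_range_eq _ p hy]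
  rfl

/-- The matrix of a bilinear form of two differentials under a change of chart. -/
theorem of_form_change {E : Type*} [NormedAddCommGroup E] [NormedSpace ℝ E]
    (β : E →ₗ[ℝ] E →ₗ[ℝ] ℝ) {v w : M → E}
    (hv : ContMDiff (𝓡∂ n) 𝓘(ℝ, E) ∞ v) (hw : ContMDiff (𝓡∂ n) 𝓘(ℝ, E) ∞ w) {p q z : M}
    (hp : z ∈ (extChartAt (𝓡∂ n) p).source) (hq : z ∈ (extChartAt (𝓡∂ n) q).source) :
    (Matrix.of fun i j =>
      β (partialDeriv (chartDomain n p) (chartRep n v p) i (extChartAt (𝓡∂ n) p z))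
        (partialDeriv (chartDomain n p) (chartRep n w p) j (extChartAt (𝓡∂ n) p z))) =
    (transitionMatrix n p q z).transpose * (Matrix.of fun i j =>
      β (partialDeriv (chartDomain n q) (chartRep n v q) i (extChartAt (𝓡∂ n) q z))
        (partialDeriv (chartDomain n q) (chartRep n w q) j (extChartAt (𝓡∂ n) q z))) *
      transitionMatrix n p q z := by
  ext i j
  simp only [Matrix.of_apply, Matrix.mul_apply, Matrix.transpose_apply,
    partialDeriv_change hv hp hq, partialDeriv_change hw hp hq, map_sum, map_smul,
    LinearMap.sum_apply, LinearMap.smul_apply, smul_eq_mul]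
  refine Finset.sum_congr rfl fun k _ => ?_
  rw [Finset.mul_sum, Finset.sum_mul]
  refine Finset.sum_congr rfl fun l _ => ?_
  ring

theorem chartGram_change (c : Euc (n + 1) → ℝ) {x : M → Euc (n + 1)}
    (hx : ContMDiff (𝓡∂ n) 𝓘(ℝ, Euc (n + 1)) ∞ x) {p q z : M}
    (hp : z ∈ (extChartAt (𝓡∂ n) p).source) (hq : z ∈ (extChartAt (𝓡∂ n) q).source) :
    chartGram c x p (extChartAt (𝓡∂ n) p z) =
      (transitionMatrix n p q z).transpose * chartGram c x q (extChartAt (𝓡∂ n) q z) *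
        transitionMatrix n p q z := by
  rw [chartGram_eq c x p ((extChartAt (𝓡∂ n) p).map_source hp),
    chartGram_eq c x q ((extChartAt (𝓡∂ n) q).map_source hq), chartRep_apply x p hp,
    chartRep_apply x q hq]
  exact of_form_change (c (x z) • innerₗ (Euc (n + 1))) hx hx hp hq

variable [MeasurableSpace M] [BorelSpace M]

omit [IsManifold (𝓡∂ n) ∞ M] [MeasurableSpace M] [BorelSpace M] in
theorem chartDomain_inter_preimage (p : M) {s : Set M} (hs : s ⊆ (extChartAt (𝓡∂ n) p).source) :
    chartDomain n p ∩ (extChartAt (𝓡∂ n) p).symm ⁻¹' s = extChartAt (𝓡∂ n) p '' s :=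
  ((extChartAt (𝓡∂ n) p).image_eq_target_inter_inv_preimage hs).symm

omit [IsManifold (𝓡∂ n) ∞ M] in
theorem measurableSet_chart_image (p : M) {s : Set M} (hs : MeasurableSet s)
    (hsp : s ⊆ (extChartAt (𝓡∂ n) p).source) : MeasurableSet (extChartAt (𝓡∂ n) p '' s) := by
  rw [← chartDomain_inter_preimage p hsp]
  have h := ((continuousOn_extChartAt_symm (I := 𝓡∂ n) p).domRestrict.measurable hs)
  have h2 := (measurableSet_chartDomain p).subtype_image h
  convert h2 using 1
  ext y
  simp [chartDomain, and_comm]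

omit [IsManifold (𝓡∂ n) ∞ M] in
theorem aemeasurable_extChartAt_symm (p : M) (g : Euc n → ENNReal) :
    AEMeasurable (extChartAt (𝓡∂ n) p).symm
      ((volume.restrict (extChartAt (𝓡∂ n) p).target).withDensity g) :=
  ((continuousOn_extChartAt_symm p).aemeasurable (measurableSet_chartDomain p)).mono_ac
    (withDensity_absolutelyContinuous _ _)

omit [IsManifold (𝓡∂ n) ∞ M] in
theorem chartArea_apply (c : Euc (n + 1) → ℝ) (x : M → Euc (n + 1)) (p : M) {s : Set M}
    (hs : MeasurableSet s) (hsp : s ⊆ (extChartAt (𝓡∂ n) p).source) :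
    chartArea c x p s = ∫⁻ y in extChartAt (𝓡∂ n) p '' s,
      ENNReal.ofReal (√(chartGram c x p y).det) := by
  rw [chartArea, Measure.map_apply_of_aemeasurable (aemeasurable_extChartAt_symm p _) hs,
    withDensity_apply', Measure.restrict_restrict' (by exact measurableSet_chartDomain p),
    inter_comm]
  rw [← chartDomain_inter_preimage p hsp]
  rfl

omit [IsManifold (𝓡∂ n) ∞ M] in
theorem chartArea_compl_source (c : Euc (n + 1) → ℝ) (x : M → Euc (n + 1)) (p : M) :
    chartArea c x p (extChartAt (𝓡∂ n) p).sourceᶜ = 0 := by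
  rw [chartArea, Measure.map_apply_of_aemeasurable (aemeasurable_extChartAt_symm p _)
    (isOpen_extChartAt_source p).measurableSet.compl, withDensity_apply',
    Measure.restrict_restrict' (by exact measurableSet_chartDomain p)]
  have : (extChartAt (𝓡∂ n) p).symm ⁻¹' (extChartAt (𝓡∂ n) p).sourceᶜ ∩
      (extChartAt (𝓡∂ n) p).target = ∅ := by
    ext y
    simp only [mem_inter_iff, mem_preimage, mem_compl_iff, mem_empty_iff_false, iff_false, not_and]
    intro h hy
    exact h ((extChartAt (𝓡∂ n) p).map_target hy)
  rw [this]
  simp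

/-- The area measures of two charts agree on the overlap of their domains, by the change of
variables formula. -/
theorem chartArea_eq_of_subset (c : Euc (n + 1) → ℝ) {x : M → Euc (n + 1)}
    (hx : ContMDiff (𝓡∂ n) 𝓘(ℝ, Euc (n + 1)) ∞ x) (p q : M) {s : Set M} (hs : MeasurableSet s)
    (hp : s ⊆ (extChartAt (𝓡∂ n) p).source) (hq : s ⊆ (extChartAt (𝓡∂ n) q).source) :
    chartArea c x p s = chartArea c x q s := by
  have : IsManifold (𝓡∂ n) 1 M := IsManifold.of_le (n := ∞) (by simp)
  rw [chartArea_apply c x p hs hp, chartArea_apply c x q hs hq]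
  set τ : Euc n → Euc n := extChartAt (𝓡∂ n) q ∘ (extChartAt (𝓡∂ n) p).symm with hτ
  have hτz : ∀ z ∈ s, τ (extChartAt (𝓡∂ n) p z) = extChartAt (𝓡∂ n) q z := fun z hz => by
    rw [hτ, Function.comp_apply, (extChartAt (𝓡∂ n) p).left_inv (hp hz)]
  have himg : extChartAt (𝓡∂ n) q '' s = τ '' (extChartAt (𝓡∂ n) p '' s) := by
    rw [image_image]
    exact image_congr fun z hz => (hτz z hz).symm
  rw [himg, lintegral_image_eq_lintegral_abs_det_fderiv_mul volume
    (measurableSet_chart_image p hs hp)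
    (f' := fun y => tangentCoordChange (𝓡∂ n) p q ((extChartAt (𝓡∂ n) p).symm y))]
  · refine setLIntegral_congr_fun (measurableSet_chart_image p hs hp) ?_
    rintro _ ⟨z, hz, rfl⟩
    beta_reduce
    rw [hτz z hz, (extChartAt (𝓡∂ n) p).left_inv (hp hz), chartGram_change c hx (hp hz) (hq hz),
      det_tangentCoordChange, ← ENNReal.ofReal_mul (abs_nonneg _), Matrix.det_mul, Matrix.det_mul,
      Matrix.det_transpose, mul_right_comm, ← pow_two, Real.sqrt_mul (sq_nonneg _),
      Real.sqrt_sq_eq_abs]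
  · rintro _ ⟨z, hz, rfl⟩
    rw [(extChartAt (𝓡∂ n) p).left_inv (hp hz)]
    refine (hasFDerivWithinAt_tangentCoordChange ⟨hp hz, hq hz⟩).mono ?_
    rintro _ ⟨w, hw, rfl⟩
    exact extChartAt_target_subset_range p ((extChartAt (𝓡∂ n) p).map_source (hp hw))
  · rintro _ ⟨z, hz, rfl⟩ _ ⟨w, hw, rfl⟩ h
    rw [hτz z hz, hτz w hw] at h
    rw [(extChartAt (𝓡∂ n) q).injOn (hq hz) (hq hw) h]

/-- On the domain of a chart the area measure is the area measure of that chart. -/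
theorem area_restrict_source (c : Euc (n + 1) → ℝ) {x : M → Euc (n + 1)}
    (hx : ContMDiff (𝓡∂ n) 𝓘(ℝ, Euc (n + 1)) ∞ x) (p : M) :
    (area c x).restrict (extChartAt (𝓡∂ n) p).source = chartArea c x p := by
  set U := (extChartAt (𝓡∂ n) p).source with hU
  have hUm : MeasurableSet U := (isOpen_extChartAt_source p).measurableSet
  have hpU : (chartArea c x p).restrict U = chartArea c x p :=
    Measure.restrict_eq_self_of_ae_mem (by
      rw [ae_iff]
      exact chartArea_compl_source c x p)
  refine le_antisymm ?_ ?_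
  -- an upper bound in the lattice of measures that is sharp on `U` and trivial off `U`
  · have hle : area c x ≤ chartArea c x p + (⊤ : Measure M).restrict Uᶜ := by
      refine iSup_le fun q => Measure.le_iff.2 fun s hs => ?_
      have hVm : MeasurableSet (extChartAt (𝓡∂ n) q).source :=
        (isOpen_extChartAt_source q).measurableSet
      rw [← measure_inter_add_sdiff s hUm]
      refine add_le_add ?_ ?_
      · have h1 : chartArea c x q (s ∩ U) =
            chartArea c x q (s ∩ U ∩ (extChartAt (𝓡∂ n) q).source) := by
          exact (measure_inter_conull (chartArea_compl_source c x q)).symm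
        rw [h1, chartArea_eq_of_subset c hx q p ((hs.inter hUm).inter hVm) inter_subset_right
          fun z hz => hz.1.2]
        exact measure_mono fun z hz => hz.1.1
      · change _ ≤ (⊤ : Measure M).restrict Uᶜ s
        rw [Measure.restrict_apply hs, Set.sdiff_eq]
        exact Measure.le_iff'.1 le_top _
    calc (area c x).restrict U ≤ (chartArea c x p + (⊤ : Measure M).restrict Uᶜ).restrict U :=
          Measure.restrict_mono_measure hle U
      _ = chartArea c x p := by
          rw [Measure.restrict_add, hpU, Measure.restrict_restrict hUm, inter_compl_self,
            Measure.restrict_empty, add_zero]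
  · rw [← hpU]
    exact Measure.restrict_mono_measure (le_iSup (chartArea c x) p) U

/-- The integral against the area measure of a function supported in the domain of a chart. -/
theorem integral_area_of_eq_zero_off_source (c : Euc (n + 1) → ℝ) {x : M → Euc (n + 1)}
    (hx : ContMDiff (𝓡∂ n) 𝓘(ℝ, Euc (n + 1)) ∞ x) (p : M)
    (hgram : ContinuousOn (chartGram c x p) (chartDomain n p)) {F : M → ℝ}
    (hF : ∀ z ∉ (extChartAt (𝓡∂ n) p).source, F z = 0)
    (hFc : ContinuousOn (chartRep n F p) (chartDomain n p))
    (hi : IntegrableOn (fun y => chartRep n F p y * √(chartGram c x p y).det) (chartDomain n p)) :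
    Integrable F (area c x) ∧ ∫ z, F z ∂(area c x) =
      ∫ y in chartDomain n p, chartRep n F p y * √(chartGram c x p y).det := by
  set U := (extChartAt (𝓡∂ n) p).source with hU
  have hUm : MeasurableSet U := (isOpen_extChartAt_source p).measurableSet
  have hFU : ContinuousOn F U := by
    refine (hFc.comp (continuousOn_extChartAt p) fun z hz =>
      (extChartAt (𝓡∂ n) p).map_source hz).congr fun z hz => ?_
    rw [Function.comp_apply, chartRep_apply F p hz]
  have hFm : AEStronglyMeasurable F (chartArea c x p) := by
    rw [← area_restrict_source c hx p]
    exact (hFU.aemeasurable hUm).aestronglyMeasurable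
  have hdens : AEMeasurable (fun y => Real.toNNReal (√(chartGram c x p y).det))
      (volume.restrict (chartDomain n p)) := by
    have h1 : ContinuousOn (fun y => √(chartGram c x p y).det) (chartDomain n p) :=
      Real.continuous_sqrt.comp_continuousOn (Continuous.comp_continuousOn
        (g := fun A : Matrix (Fin n) (Fin n) ℝ => A.det) continuous_id.matrix_det hgram)
    exact (h1.aemeasurable (measurableSet_chartDomain p)).real_toNNReal
  have hsm : ∀ y, Real.toNNReal (√(chartGram c x p y).det) • F ((extChartAt (𝓡∂ n) p).symm y) =
      chartRep n F p y * √(chartGram c x p y).det := fun y => by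
    rw [NNReal.smul_def, Real.coe_toNNReal _ (Real.sqrt_nonneg _), smul_eq_mul, mul_comm]
    rfl
  have hrestr : ∫ z, F z ∂(area c x) = ∫ z, F z ∂(chartArea c x p) := by
    rw [← area_restrict_source c hx p]
    exact (setIntegral_eq_integral_of_forall_compl_eq_zero hF).symm
  refine ⟨?_, ?_⟩
  · rw [← integrableOn_iff_integrable_of_support_subset (s := U)
      (Function.support_subset_iff'.2 hF), IntegrableOn, area_restrict_source c hx p]
    refine (integrable_map_measure hFm (aemeasurable_extChartAt_symm p _)).2 ?_
    refine (integrable_withDensity_iff_integrable_smul₀ hdens).2 ?_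
    simp only [Function.comp_apply, hsm]
    exact hi
  · rw [hrestr, chartArea, integral_map (aemeasurable_extChartAt_symm p _) hFm]
    refine (integral_withDensity_eq_integral_smul₀ hdens _).trans ?_
    simp only [hsm]

end Area

/-! ### Hypersurfaces in the hyperboloid model -/

section Model

open Topology Filter Matrix

variable {n : ℕ} {W : Type*} [NormedAddCommGroup W] [NormedSpace ℝ W]

/-- A local isometry `Φ` from the conformally flat space `(U, c • δ)` into the hyperboloid
`{B(w, w) = -1}`. -/
structure HyperboloidModel (B : LorentzForm n W) (c : Euc (n + 1) → ℝ) (U : Set (Euc (n + 1)))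
    (Φ : Euc (n + 1) → W) : Prop where
  isOpen : IsOpen U
  contDiffOn : ContDiffOn ℝ ∞ Φ U
  form_self : ∀ y ∈ U, B.form (Φ y) (Φ y) = -1
  form_fderiv : ∀ y ∈ U, ∀ v w, B.form (fderiv ℝ Φ y v) (fderiv ℝ Φ y w) = metric c y v w
  factor_pos : ∀ y ∈ U, 0 < c y
  differentiableAt_factor : ∀ y ∈ U, DifferentiableAt ℝ c y

namespace HyperboloidModel

variable {B : LorentzForm n W} {c : Euc (n + 1) → ℝ} {U : Set (Euc (n + 1))}
  {Φ : Euc (n + 1) → W} (hΦ : HyperboloidModel B c U Φ)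
include hΦ

theorem contDiffAt {y : Euc (n + 1)} (hy : y ∈ U) : ContDiffAt ℝ ∞ Φ y :=
  hΦ.contDiffOn.contDiffAt (hΦ.isOpen.mem_nhds hy)

theorem contDiffAt_fderiv {y : Euc (n + 1)} (hy : y ∈ U) : ContDiffAt ℝ ∞ (fderiv ℝ Φ) y :=
  (hΦ.contDiffAt hy).fderiv_right (by simp)

theorem form_fderiv_self {y : Euc (n + 1)} (hy : y ∈ U) (v : Euc (n + 1)) :
    B.form (Φ y) (fderiv ℝ Φ y v) = 0 := by
  have hd : HasFDerivAt Φ (fderiv ℝ Φ y) y :=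
    ((hΦ.contDiffAt hy).differentiableAt (by simp)).hasFDerivAt
  have h1 := B.form.hasFDerivAt_of_bilinear hd hd
  have h2 : (fun y => B.form (Φ y) (Φ y)) =ᶠ[𝓝 y] fun _ => -1 := by
    filter_upwards [hΦ.isOpen.mem_nhds hy] with z hz using hΦ.form_self z hz
  have h3 := (h1.congr_of_eventuallyEq h2.symm).unique (hasFDerivAt_const (-1 : ℝ) y)
  have h4 := DFunLike.congr_fun h3 v
  simp only [_root_.add_apply, ContinuousLinearMap.precompR_apply,
    ContinuousLinearMap.compL_apply,
    ContinuousLinearMap.comp_apply, ContinuousLinearMap.precompL_apply, _root_.zero_apply] at h4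
  rw [B.symm (fderiv ℝ Φ y v)] at h4
  linarith

/-- The tangential part of the second derivative of `Φ` is the Levi-Civita connection: both sides
are symmetric in `v, w` and compatible with the metric, so that they agree as in Koszul's formula.
-/
theorem form_fderiv_fderiv {y : Euc (n + 1)} (hy : y ∈ U) (v w z : Euc (n + 1)) :
    B.form (fderiv ℝ (fderiv ℝ Φ) y v w) (fderiv ℝ Φ y z) = metric c y (christoffel c y v w) z := by
  have hd : HasFDerivAt (fderiv ℝ Φ) (fderiv ℝ (fderiv ℝ Φ) y) y :=
    ((hΦ.contDiffAt_fderiv hy).differentiableAt (by simp)).hasFDerivAt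
  have h2 : (2 : WithTop ℕ∞) ≤ ∞ := one_add_one_eq_two (R := WithTop ℕ∞) ▸ two_le_infty
  have hsymm : ∀ a b, fderiv ℝ (fderiv ℝ Φ) y a b = fderiv ℝ (fderiv ℝ Φ) y b a := fun a b =>
    ((hΦ.contDiffAt hy).isSymmSndFDerivAt (by simpa using h2)).eq a b
  have hmetric : ∀ a b, metric c y a b = metric c y b a := fun a b => by
    unfold metric; rw [real_inner_comm]
  have key : ∀ a b e, B.form (fderiv ℝ (fderiv ℝ Φ) y a b) (fderiv ℝ Φ y e) +
      B.form (fderiv ℝ (fderiv ℝ Φ) y a e) (fderiv ℝ Φ y b) =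
      metric c y (christoffel c y a b) e + metric c y (christoffel c y a e) b := by
    intro a b e
    have hb : HasFDerivAt (fun y => fderiv ℝ Φ y b)
      ((ContinuousLinearMap.apply ℝ W b).comp (fderiv ℝ (fderiv ℝ Φ) y)) y :=
      (ContinuousLinearMap.apply ℝ W b).hasFDerivAt.comp y hd
    have he : HasFDerivAt (fun y => fderiv ℝ Φ y e)
      ((ContinuousLinearMap.apply ℝ W e).comp (fderiv ℝ (fderiv ℝ Φ) y)) y :=
      (ContinuousLinearMap.apply ℝ W e).hasFDerivAt.comp y hd
    have h1 := B.form.hasFDerivAt_of_bilinear hb he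
    have h2 : (fun y => B.form (fderiv ℝ Φ y b) (fderiv ℝ Φ y e)) =ᶠ[𝓝 y]
        fun y => metric c y b e := by
      filter_upwards [hΦ.isOpen.mem_nhds hy] with z hz using hΦ.form_fderiv z hz b e
    have h3 := christoffel_compat c y (hΦ.differentiableAt_factor y hy) (hΦ.factor_pos y hy).ne'
      a b e
    rw [← h2.fderiv_eq, h1.fderiv] at h3
    simp only [_root_.add_apply, ContinuousLinearMap.precompR_apply,
      ContinuousLinearMap.precompL_apply, ContinuousLinearMap.compL_apply,
      ContinuousLinearMap.comp_apply, ContinuousLinearMap.apply_apply] at h3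
    rw [B.symm (fderiv ℝ Φ y b), hmetric b] at h3
    linarith
  have k1 := key v w z
  have k2 := key z w v
  have k3 := key w v z
  rw [hsymm z w, hsymm z v, christoffel_symm c y z w, christoffel_symm c y z v] at k2
  rw [hsymm w v, christoffel_symm c y w v] at k3
  linarith

end HyperboloidModel

end Model

section Lift

open Topology Filter Matrix

variable {n : ℕ} [NeZero n] {M : Type*} [TopologicalSpace M]
  [ChartedSpace (EuclideanHalfSpace n) M] [IsManifold (𝓡∂ n) ∞ M]
  {W : Type*} [NormedAddCommGroup W] [NormedSpace ℝ W]
  {B : LorentzForm n W} {c : Euc (n + 1) → ℝ} {U D S : Set (Euc (n + 1))}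
  {Φ : Euc (n + 1) → W} {N : Euc (n + 1) → Euc (n + 1)} {θ : ℝ} {x ν : M → Euc (n + 1)}

omit [IsManifold (𝓡∂ n) ∞ M] in
theorem tangentMap_single {w : M → Euc (n + 1)} (hw : ContMDiff (𝓡∂ n) 𝓘(ℝ, Euc (n + 1)) ∞ w)
    (p : M) (i : Fin n) : tangentMap w p (EuclideanSpace.single i 1) =
      partialDeriv (chartDomain n p) (chartRep n w p) i (extChartAt (𝓡∂ n) p p) := by
  have h : MDifferentiableAt (𝓡∂ n) 𝓘(ℝ, Euc (n + 1)) w p := (hw p).mdifferentiableAt (by simp)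
  rw [partialDeriv, ← fderivWithin_range_eq _ p (mem_extChartAt_target p), tangentMap]
  exact DFunLike.congr_fun h.mfderiv (EuclideanSpace.single i (1 : ℝ))

/-- The position of a hypersurface in the hyperboloid. -/
def liftPos (Φ : Euc (n + 1) → W) (x : M → Euc (n + 1)) : M → W := Φ ∘ x

/-- The normal of a hypersurface as a vector tangent to the hyperboloid. -/
def liftNormal (Φ : Euc (n + 1) → W) (x ν : M → Euc (n + 1)) (p : M) : W :=
  fderiv ℝ Φ (x p) (ν p)

variable (hΦ : HyperboloidModel B c U Φ) (h : IsCapillary c D S N θ x ν) (hU : ∀ p, x p ∈ U)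
include hΦ h hU

omit [IsManifold (𝓡∂ n) ∞ M] in
theorem contMDiff_liftPos : ContMDiff (𝓡∂ n) 𝓘(ℝ, W) ∞ (liftPos Φ x) := fun p =>
  (hΦ.contDiffAt (hU p)).contMDiffAt.comp p (h.smooth p)

omit [IsManifold (𝓡∂ n) ∞ M] in
theorem contMDiff_liftNormal : ContMDiff (𝓡∂ n) 𝓘(ℝ, W) ∞ (liftNormal Φ x ν) := fun p =>
  ((hΦ.contDiffAt_fderiv (hU p)).contMDiffAt.comp p (h.smooth p)).clm_apply (h.smooth_normal p)

theorem partialDeriv_liftPos (p : M) {y : Euc n} (hy : y ∈ chartDomain n p) (i : Fin n) :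
    partialDeriv (chartDomain n p) (chartRep n (liftPos Φ x) p) i y =
      fderiv ℝ Φ (chartRep n x p y) (partialDeriv (chartDomain n p) (chartRep n x p) i y) := by
  have h1 : HasFDerivWithinAt (chartRep n x p)
      (fderivWithin ℝ (chartRep n x p) (chartDomain n p) y) (chartDomain n p) y :=
    ((contDiffOn_chartRep h.smooth p).differentiableOn (by simp) y hy).hasFDerivWithinAt
  have h2 : HasFDerivAt Φ (fderiv ℝ Φ (chartRep n x p y)) (chartRep n x p y) :=
    ((hΦ.contDiffAt (hU _)).differentiableAt (by simp)).hasFDerivAt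
  have h3 : HasFDerivWithinAt (chartRep n (liftPos Φ x) p) _ (chartDomain n p) y :=
    h2.comp_hasFDerivWithinAt y h1
  rw [partialDeriv, h3.fderivWithin (uniqueDiffOn_chartDomain p y hy)]
  rfl

theorem partialDeriv_liftNormal (p : M) {y : Euc n} (hy : y ∈ chartDomain n p) (i : Fin n) :
    partialDeriv (chartDomain n p) (chartRep n (liftNormal Φ x ν) p) i y =
      fderiv ℝ (fderiv ℝ Φ) (chartRep n x p y)
        (partialDeriv (chartDomain n p) (chartRep n x p) i y) (chartRep n ν p y) +
      fderiv ℝ Φ (chartRep n x p y) (partialDeriv (chartDomain n p) (chartRep n ν p) i y) := by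
  have h1 : HasFDerivWithinAt (chartRep n x p)
      (fderivWithin ℝ (chartRep n x p) (chartDomain n p) y) (chartDomain n p) y :=
    ((contDiffOn_chartRep h.smooth p).differentiableOn (by simp) y hy).hasFDerivWithinAt
  have h1' : HasFDerivWithinAt (chartRep n ν p)
      (fderivWithin ℝ (chartRep n ν p) (chartDomain n p) y) (chartDomain n p) y :=
    ((contDiffOn_chartRep h.smooth_normal p).differentiableOn (by simp) y hy).hasFDerivWithinAt
  have h2 : HasFDerivAt (fderiv ℝ Φ) (fderiv ℝ (fderiv ℝ Φ) (chartRep n x p y))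
      (chartRep n x p y) :=
    ((hΦ.contDiffAt_fderiv (hU _)).differentiableAt (by simp)).hasFDerivAt
  have h3 : HasFDerivWithinAt (chartRep n (liftNormal Φ x ν) p) _ (chartDomain n p) y :=
    (h2.comp_hasFDerivWithinAt y h1).clm_apply h1'
  rw [partialDeriv, h3.fderivWithin (uniqueDiffOn_chartDomain p y hy), add_comm]
  rfl

theorem gramMatrix_liftPos (p : M) {y : Euc n} (hy : y ∈ chartDomain n p) :
    gramMatrix B (chartDomain n p) (chartRep n (liftPos Φ x) p) (chartRep n (liftPos Φ x) p) y =
      chartGram c x p y := by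
  rw [chartGram_eq c x p hy]
  ext i j
  simp only [gramMatrix, Matrix.of_apply]
  rw [partialDeriv_liftPos hΦ h hU p hy, partialDeriv_liftPos hΦ h hU p hy]
  exact hΦ.form_fderiv _ (hU _) _ _

theorem gramMatrix_liftPos_eq_firstForm (p : M) :
    gramMatrix B (chartDomain n p) (chartRep n (liftPos Φ x) p) (chartRep n (liftPos Φ x) p)
      (extChartAt (𝓡∂ n) p p) = firstForm c x p := by
  rw [gramMatrix_liftPos hΦ h hU p (mem_extChartAt_target p),
    chartGram_eq c x p (mem_extChartAt_target p), chartRep_apply x p (mem_extChartAt_source p)]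
  ext i j
  simp only [firstForm, Matrix.of_apply, tangentMap_single h.smooth]

/-- Pairing with tangent vectors sees only the tangential part of the derivative of the lifted
normal, which is the covariant derivative of `ν`. -/
theorem gramMatrix_liftNormal_eq_secondForm (p : M) :
    gramMatrix B (chartDomain n p) (chartRep n (liftNormal Φ x ν) p) (chartRep n (liftPos Φ x) p)
      (extChartAt (𝓡∂ n) p p) = secondForm c x ν p := by
  have hy : extChartAt (𝓡∂ n) p p ∈ chartDomain n p := mem_extChartAt_target p
  ext i j
  simp only [gramMatrix, secondForm, Matrix.of_apply, covDerivAlong, tangentMap_single h.smooth,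
    tangentMap_single h.smooth_normal]
  rw [partialDeriv_liftPos hΦ h hU p hy, partialDeriv_liftNormal hΦ h hU p hy,
    chartRep_apply x p (mem_extChartAt_source p), chartRep_apply ν p (mem_extChartAt_source p),
    map_add, _root_.add_apply, hΦ.form_fderiv _ (hU _), hΦ.form_fderiv_fderiv (hU _)]
  unfold metric
  rw [inner_add_left]
  ring

omit hΦ h hU in
/-- The Gram matrices of two chart expressions of lifted maps are congruent. -/
theorem gramMatrix_change {v w : M → W} (hv : ContMDiff (𝓡∂ n) 𝓘(ℝ, W) ∞ v)
    (hw : ContMDiff (𝓡∂ n) 𝓘(ℝ, W) ∞ w) {p q z : M}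
    (hp : z ∈ (extChartAt (𝓡∂ n) p).source) (hq : z ∈ (extChartAt (𝓡∂ n) q).source) :
    gramMatrix B (chartDomain n p) (chartRep n v p) (chartRep n w p) (extChartAt (𝓡∂ n) p z) =
    (transitionMatrix n p q z).transpose * gramMatrix B (chartDomain n q) (chartRep n v q)
      (chartRep n w q) (extChartAt (𝓡∂ n) q z) * transitionMatrix n p q z :=
  of_form_change (B.form.toLinearMap₁₂) hv hw hp hq

omit [IsManifold (𝓡∂ n) ∞ M] in
theorem posDef_firstForm (p : M) : (firstForm c x p).PosDef := by
  have hc := hΦ.factor_pos _ (hU p)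
  refine Matrix.PosDef.of_dotProduct_mulVec_pos ?_ fun v hv => ?_
  · ext i j
    simp [firstForm, metric, real_inner_comm]
  · have hT : tangentMap x p (WithLp.toLp 2 v) ≠ 0 := fun h0 => hv (by
      have := h.immersion p (h0.trans (map_zero _).symm)
      simpa using this)
    have hv2 : tangentMap x p (WithLp.toLp 2 v) =
        ∑ i, v i • tangentMap x p (EuclideanSpace.single i 1) := by
      rw [← Finset.sum_congr rfl fun i _ => map_smul (tangentMap x p) (v i) _, ← map_sum]
      congr 1
      have := (EuclideanSpace.basisFun (Fin n) ℝ).sum_repr (WithLp.toLp 2 v)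
      simpa using this.symm
    have key : star v ⬝ᵥ firstForm c x p *ᵥ v = c (x p) *
        ⟪tangentMap x p (WithLp.toLp 2 v), tangentMap x p (WithLp.toLp 2 v)⟫_ℝ := by
      rw [hv2, sum_inner, Finset.mul_sum]
      simp only [dotProduct, Matrix.mulVec, firstForm, metric, Matrix.of_apply, star_trivial]
      refine Finset.sum_congr rfl fun i _ => ?_
      rw [inner_sum, Finset.mul_sum, Finset.mul_sum]
      refine Finset.sum_congr rfl fun j _ => ?_
      rw [real_inner_smul_left, real_inner_smul_right]
      ring
    rw [key]
    exact mul_pos hc (real_inner_self_pos.2 hT)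

/-- In every chart, a hypersurface of a model lifts to a patch of the hyperboloid. -/
theorem isPatch_lift (p : M) : IsPatch B (chartDomain n p) (chartRep n (liftPos Φ x) p)
    (chartRep n (liftNormal Φ x ν) p) := by
  have hf := contMDiff_liftPos hΦ h hU
  refine ⟨uniqueDiffOn_chartDomain p, contDiffOn_chartRep hf p,
    contDiffOn_chartRep (contMDiff_liftNormal hΦ h hU) p, fun y _ => hΦ.form_self _ (hU _),
    fun y _ => (hΦ.form_fderiv _ (hU _) _ _).trans (h.unit_normal _),
    fun y _ => hΦ.form_fderiv_self (hU _) _, fun y hy i => ?_, fun y hy => ?_⟩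
  all_goals
    set z := (extChartAt (𝓡∂ n) p).symm y with hz
    have hzp : z ∈ (extChartAt (𝓡∂ n) p).source := (extChartAt (𝓡∂ n) p).map_target hy
    have hyz : extChartAt (𝓡∂ n) p z = y := (extChartAt (𝓡∂ n) p).right_inv hy
    have hzz := mem_extChartAt_source (I := 𝓡∂ n) z
  · rw [partialDeriv_liftPos hΦ h hU p hy]
    refine (hΦ.form_fderiv _ (hU z) _ _).trans ?_
    change metric c (x z) (ν z) _ = 0
    rw [← hyz, partialDeriv_change h.smooth hzp hzz]
    simp only [← tangentMap_single h.smooth]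
    unfold metric
    rw [inner_sum, Finset.mul_sum]
    refine Finset.sum_eq_zero fun k _ => ?_
    have := h.normal z (EuclideanSpace.single k 1)
    unfold metric at this
    rw [real_inner_smul_right, mul_left_comm, this, mul_zero]
  · rw [← hyz, gramMatrix_change hf hf hzp hzz, gramMatrix_liftPos_eq_firstForm hΦ h hU]
    exact (posDef_firstForm hΦ h hU z).conjTranspose_mul_mul_same
      (Matrix.mulVec_injective_of_isUnit
        ((Matrix.isUnit_iff_isUnit_det _).2 (isUnit_det_transitionMatrix hzp hzz)))

/-- The second fundamental form is symmetric: in the interior by equality of mixed partial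
derivatives, on the boundary by continuity. -/
theorem gramMatrix_liftNormal_transpose (p : M) {y : Euc n} (hy : y ∈ chartDomain n p) :
    (gramMatrix B (chartDomain n p) (chartRep n (liftNormal Φ x ν) p)
      (chartRep n (liftPos Φ x) p) y).transpose =
    gramMatrix B (chartDomain n p) (chartRep n (liftNormal Φ x ν) p)
      (chartRep n (liftPos Φ x) p) y := by
  have P := isPatch_lift hΦ h hU p
  have hc := continuousOn_gramMatrix B P.uniqueDiffOn P.contDiffOn_normal P.contDiffOn
  have h1 : EqOn (fun y => (gramMatrix B (chartDomain n p) (chartRep n (liftNormal Φ x ν) p)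
      (chartRep n (liftPos Φ x) p) y).transpose) (gramMatrix B (chartDomain n p)
        (chartRep n (liftNormal Φ x ν) p) (chartRep n (liftPos Φ x) p))
      (interior (chartDomain n p)) := fun y hy =>
    P.gramMatrix_normal_transpose (mem_interior_iff_mem_nhds.1 hy)
  exact h1.of_subset_closure (Continuous.comp_continuousOn
    (g := fun A : Matrix (Fin n) (Fin n) ℝ => A.transpose) continuous_id.matrix_transpose hc) hc
    interior_subset (extChartAt_target_subset_closure_interior) hy

end Lift

/-! ### The weak Minkowski formula on the manifold -/

section Weak

open Matrix

variable {n : ℕ}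

/-- The weak integrand does not depend on the coordinates: `P` is the Jacobi matrix of a change of
coordinates. -/
theorem weakIntegrand_congr (P g h : Matrix (Fin n) (Fin n) ℝ) (hP : IsUnit P.det)
    (a b t ψ : ℝ) (w dψ : Fin n → ℝ) :
    weakIntegrand (Pᵀ * g * P) (Pᵀ * h * P) a b t ψ (Pᵀ *ᵥ w) (Pᵀ *ᵥ dψ) =
      weakIntegrand g h a b t ψ w dψ := by
  have h1 : Pᵀ * g * P + t • (Pᵀ * h * P) = Pᵀ * (g + t • h) * P := by
    rw [Matrix.mul_add, Matrix.add_mul, Matrix.mul_smul, Matrix.smul_mul]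
  have h2 : vecMulVec (Pᵀ *ᵥ dψ) (Pᵀ *ᵥ w) = Pᵀ * vecMulVec dψ w * P := by
    rw [mul_vecMulVec, vecMulVec_mul, mulVec_transpose P w]
  have h3 : P.det ^ 2 ≠ 0 := pow_ne_zero 2 hP.ne_zero
  unfold weakIntegrand
  rw [h1, h2, trace_mul_adjugate_congr, trace_mul_adjugate_congr, trace_mul_adjugate_congr,
    det_mul, det_mul, det_transpose, ← mul_div_mul_left _ g.det h3]
  congr 1 <;> ring

theorem weakIntegrand_sum {ι : Type*} (s : Finset ι) (g h : Matrix (Fin n) (Fin n) ℝ) (a b t : ℝ)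
    (ψ : ι → ℝ) (w : Fin n → ℝ) (dψ : ι → Fin n → ℝ) :
    ∑ i ∈ s, weakIntegrand g h a b t (ψ i) w (dψ i) =
      weakIntegrand g h a b t (∑ i ∈ s, ψ i) w (∑ i ∈ s, dψ i) := by
  have h1 : vecMulVec (∑ i ∈ s, dψ i) w = ∑ i ∈ s, vecMulVec (dψ i) w := by
    ext k l
    simp [vecMulVec_apply, Matrix.sum_apply, Finset.sum_mul]
  unfold weakIntegrand
  rw [h1, ← Finset.sum_div, Finset.sum_add_distrib, Finset.sum_mul, Matrix.sum_mul, trace_sum]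

/-- The weak integrand of the constant test function `1` is a polynomial in `t` whose coefficients
are the integrands of the Minkowski formulae. -/
theorem weakIntegrand_one_zero {g h : Matrix (Fin n) (Fin n) ℝ} (hg : g.PosDef) (hh : hᵀ = h)
    (a b t : ℝ) (w : Fin n → ℝ) : weakIntegrand g h a b t 1 w 0 =
      ∑ j : Fin n, t ^ (j : ℕ) * ((((n : ℝ) - (j : ℕ)) * relEsymm g h j) * a -
        (((j : ℕ) + 1 : ℝ) * relEsymm g h (j + 1)) * b) := by
  have hd := hg.det_pos.ne'
  unfold weakIntegrand
  rw [trace_mul_adjugate_add_smul hg hh, trace_snd_mul_adjugate_add_smul hg hh, zero_vecMulVec,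
    Matrix.zero_mul, trace_zero, add_zero, one_mul, div_eq_iff hd,
    Finset.sum_range_succ, Finset.sum_range_succ' (fun k : ℕ => (k : ℝ) * _ * _),
    Fin.sum_univ_eq_sum_range (fun j => t ^ j * ((((n : ℝ) - j) * relEsymm g h j) * a -
        ((j + 1 : ℝ) * relEsymm g h (j + 1)) * b)) n]
  simp only [Nat.cast_zero, zero_mul, sub_self, add_zero, Nat.add_sub_cancel]
  rw [Finset.mul_sum, Finset.mul_sum, Finset.mul_sum, Finset.mul_sum, ← Finset.sum_sub_distrib,
    Finset.sum_mul]
  refine Finset.sum_congr rfl fun j _ => ?_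
  push_cast
  ring

/-- A polynomial in `t` whose integral vanishes for every `t` has coefficients of vanishing
integral. -/
theorem integral_coeff_eq_zero {α : Type*} [MeasurableSpace α] {μ : Measure α}
    {A : Fin n → α → ℝ} (hA : ∀ t : ℝ, Integrable (fun z => ∑ j : Fin n, t ^ (j : ℕ) * A j z) μ ∧
      ∫ z, ∑ j : Fin n, t ^ (j : ℕ) * A j z ∂μ = 0) (j : Fin n) :
    Integrable (A j) μ ∧ ∫ z, A j z ∂μ = 0 := by
  set V : Matrix (Fin n) (Fin n) ℝ := vandermonde fun i : Fin n => (i : ℝ) with hV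
  have hdet : IsUnit V.det := isUnit_iff_ne_zero.2 (det_vandermonde_ne_zero_iff.2 fun i k hik => by
    exact Fin.ext (by exact_mod_cast hik))
  have key : A j = fun z => ∑ i, V⁻¹ j i * ∑ l : Fin n, (i : ℝ) ^ (l : ℕ) * A l z := by
    funext z
    have h1 : (V⁻¹ * V) *ᵥ (fun l => A l z) = fun l => A l z := by
      rw [nonsing_inv_mul _ hdet, one_mulVec]
    rw [← mulVec_mulVec] at h1
    exact (congrFun h1 j).symm
  have hi : ∀ i ∈ Finset.univ, Integrable
      (fun z => V⁻¹ j i * ∑ l : Fin n, (i : ℝ) ^ (l : ℕ) * A l z) μ := fun i _ =>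
    (hA i).1.const_mul _
  rw [key]
  refine ⟨integrable_finsetSum _ hi, ?_⟩
  rw [integral_finsetSum _ hi]
  exact Finset.sum_eq_zero fun i _ => by rw [integral_const_mul, (hA i).2, mul_zero]

end Weak

section Global

open Topology Filter Matrix

variable {n : ℕ} [NeZero n] {M : Type*} [TopologicalSpace M]
  [ChartedSpace (EuclideanHalfSpace n) M] [IsManifold (𝓡∂ n) ∞ M]
  {W : Type*} [NormedAddCommGroup W] [NormedSpace ℝ W]

/-- `patchIntegrand` at a point of a manifold, in the chart at that point. -/
def manifoldIntegrand (B : LorentzForm n W) (f N u : M → W) (t : ℝ) (ψ : M → ℝ) (z : M) : ℝ :=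
  patchIntegrand B (chartDomain n z) (chartRep n f z) (chartRep n N z) (chartRep n u z) t
    (chartRep n ψ z) (extChartAt (𝓡∂ n) z z)

theorem manifoldIntegrand_eq (B : LorentzForm n W) {f N : M → W} (u : M → W) (t : ℝ) {ψ : M → ℝ}
    (hf : ContMDiff (𝓡∂ n) 𝓘(ℝ, W) ∞ f) (hN : ContMDiff (𝓡∂ n) 𝓘(ℝ, W) ∞ N)
    (hψ : ContMDiff (𝓡∂ n) 𝓘(ℝ, ℝ) ∞ ψ) {p z : M} (hz : z ∈ (extChartAt (𝓡∂ n) p).source) :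
    manifoldIntegrand B f N u t ψ z =
      patchIntegrand B (chartDomain n p) (chartRep n f p) (chartRep n N p) (chartRep n u p) t
        (chartRep n ψ p) (extChartAt (𝓡∂ n) p z) := by
  have hzz := mem_extChartAt_source (I := 𝓡∂ n) z
  unfold manifoldIntegrand patchIntegrand
  rw [gramMatrix_change hf hf hz hzz, gramMatrix_change hN hf hz hzz]
  simp only [chartRep_apply _ p hz, chartRep_apply _ z hzz]
  rw [← weakIntegrand_congr (transitionMatrix n p z z) _ _ (isUnit_det_transitionMatrix hz hzz)]
  congr 1
  · funext j
    simp only [mulVec, dotProduct, transpose_apply, partialDeriv_change hf hz hzz, map_sum,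
      map_smul, smul_eq_mul]
  · funext j
    simp only [mulVec, dotProduct, transpose_apply, partialDeriv_change hψ hz hzz, smul_eq_mul]

omit [IsManifold (𝓡∂ n) ∞ M] in
theorem manifoldIntegrand_eq_zero_of_notMem_tsupport (B : LorentzForm n W) (f N u : M → W) (t : ℝ)
    {ψ : M → ℝ} {z : M} (hz : z ∉ tsupport ψ) : manifoldIntegrand B f N u t ψ z = 0 := by
  have h1 : ψ =ᶠ[𝓝 z] 0 := notMem_tsupport_iff_eventuallyEq.1 hz
  have h2 : chartRep n ψ z =ᶠ[𝓝 (extChartAt (𝓡∂ n) z z)] fun _ => 0 := by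
    have hc := continuousAt_extChartAt_symm (I := 𝓡∂ n) z
    rw [ContinuousAt, extChartAt_to_inv] at hc
    exact hc.eventually h1
  have h3 : ∀ i, partialDeriv (chartDomain n z) (chartRep n ψ z) i (extChartAt (𝓡∂ n) z z) = 0 :=
    fun i => by
      rw [partialDeriv, (h2.filter_mono nhdsWithin_le_nhds).fderivWithin_eq h2.self_of_nhds,
        fderivWithin_const_apply]
      rfl
  unfold manifoldIntegrand patchIntegrand weakIntegrand
  simp only [h3, h2.self_of_nhds]
  have h4 : vecMulVec (fun _ : Fin n => (0 : ℝ)) (fun j => B.form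
      (chartRep n u z (extChartAt (𝓡∂ n) z z)) (partialDeriv (chartDomain n z) (chartRep n f z) j
        (extChartAt (𝓡∂ n) z z))) = 0 := zero_vecMulVec _
  rw [h4]
  simp

theorem mem_boundary_of_apply_zero_eq_zero (p : M) {y : Euc n} (hy : y ∈ chartDomain n p)
    (h0 : y 0 = 0) : (extChartAt (𝓡∂ n) p).symm y ∈ (𝓡∂ n).boundary M := by
  have hs : (extChartAt (𝓡∂ n) p).symm y ∈ (chartAt (EuclideanHalfSpace n) p).source := by
    rw [← extChartAt_source (𝓡∂ n)]
    exact (extChartAt (𝓡∂ n) p).map_target hy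
  refine (ModelWithCorners.isBoundaryPoint_iff_of_mem_atlas (n := ∞) (by simp)
    (chart_mem_atlas (EuclideanHalfSpace n) p) hs).2 ?_
  change extChartAt (𝓡∂ n) p ((extChartAt (𝓡∂ n) p).symm y) ∈ frontier (chartDomain n p)
  rw [(extChartAt (𝓡∂ n) p).right_inv hy]
  refine ⟨subset_closure hy, fun hi => ?_⟩
  have h1 := interior_mono (extChartAt_target_subset_range (I := 𝓡∂ n) p) hi
  rw [interior_range_modelWithCornersEuclideanHalfSpace] at h1
  exact absurd h0 (ne_of_gt h1)

variable {B : LorentzForm n W} {c : Euc (n + 1) → ℝ} {U D S : Set (Euc (n + 1))}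
  {Φ : Euc (n + 1) → W} {N : Euc (n + 1) → Euc (n + 1)} {θ : ℝ} {x ν : M → Euc (n + 1)}

/-- The field `r (q + κ f + ϑ N)` along a hypersurface with lifted position `f` and lifted normal
`N`. -/
def liftField (Φ : Euc (n + 1) → W) (x ν : M → Euc (n + 1)) (r : W →L[ℝ] W) (q : W) (κ ϑ : ℝ)
    (z : M) : W :=
  r (q + κ • liftPos Φ x z + ϑ • liftNormal Φ x ν z)

variable [CompactSpace M] [T2Space M] [MeasurableSpace M] [BorelSpace M]
  (hΦ : HyperboloidModel B c U Φ) (h : IsCapillary c D S N θ x ν) (hU : ∀ p, x p ∈ U)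
  {r : W →L[ℝ] W} (hr : ∀ v w, B.form (r v) w = -B.form v (r w)) {q : W} {κ ϑ : ℝ}
  (hqf : ∀ z ∈ (𝓡∂ n).boundary M, B.form q (liftPos Φ x z) = κ)
  (hqN : ∀ z ∈ (𝓡∂ n).boundary M, B.form q (liftNormal Φ x ν z) = -ϑ)
  (hq : B.form q q + κ ^ 2 - ϑ ^ 2 ≠ 0)
include hΦ h hU hr hqf hqN hq

omit [T2Space M] in
/-- The weak Minkowski formula for a test function supported in the domain of a chart. -/
theorem integral_manifoldIntegrand_eq_zero (t : ℝ) {ψ : M → ℝ}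
    (hψ : ContMDiff (𝓡∂ n) 𝓘(ℝ, ℝ) ∞ ψ) (p : M)
    (hp : tsupport ψ ⊆ (extChartAt (𝓡∂ n) p).source) :
    Integrable (manifoldIntegrand B (liftPos Φ x) (liftNormal Φ x ν) (liftField Φ x ν r q κ ϑ) t ψ)
      (area c x) ∧ ∫ z, manifoldIntegrand B (liftPos Φ x) (liftNormal Φ x ν)
        (liftField Φ x ν r q κ ϑ) t ψ z ∂(area c x) = 0 := by
  have hf := contMDiff_liftPos hΦ h hU
  have hN := contMDiff_liftNormal hΦ h hU
  have P := isPatch_lift hΦ h hU p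
  have hψc := contDiffOn_chartRep hψ p
  obtain ⟨O, hO, hT⟩ := exists_chartDomain_eq_inter (n := n) p
  set T := chartDomain n p with hTdef
  set f := chartRep n (liftPos Φ x) p with hfdef
  set ν' := chartRep n (liftNormal Φ x ν) p with hνdef
  set F := manifoldIntegrand B (liftPos Φ x) (liftNormal Φ x ν) (liftField Φ x ν r q κ ϑ) t ψ
    with hF
  have hFrep : ∀ y ∈ T, chartRep n F p y =
      patchIntegrand B T f ν' (rotField r q κ ϑ f ν') t (chartRep n ψ p) y := by
    intro y hy
    have := manifoldIntegrand_eq B (liftField Φ x ν r q κ ϑ) t hf hN hψ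
      ((extChartAt (𝓡∂ n) p).map_target hy)
    rw [(extChartAt (𝓡∂ n) p).right_inv hy] at this
    exact this
  -- `chartRep` takes arbitrary values off `T`, where the test function has to vanish
  set ψ' : Euc n → ℝ := T.indicator (chartRep n ψ p) with hψ'
  have hψeq : EqOn ψ' (chartRep n ψ p) T := fun y hy => indicator_of_mem hy _
  have hpatch : ∀ y ∈ T, chartRep n F p y * √(chartGram c x p y).det =
      patchIntegrand B T f ν' (rotField r q κ ϑ f ν') t ψ' y * √(gramMatrix B T f f y).det := by
    intro y hy
    rw [hFrep y hy, gramMatrix_liftPos hΦ h hU p hy]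
    unfold patchIntegrand partialDeriv
    rw [hψeq hy, fderivWithin_congr hψeq (hψeq hy)]
  have hTm : MeasurableSet T := measurableSet_chartDomain p
  obtain ⟨hint, hzero⟩ := P.integral_patchIntegrand_eq_zero hO hT hr (q := q) (κ := κ) (ϑ := ϑ)
    (fun y hy h0 => hqf _ (mem_boundary_of_apply_zero_eq_zero p hy h0))
    (fun y hy h0 => hqN _ (mem_boundary_of_apply_zero_eq_zero p hy h0)) hq t
    (ψ := ψ') (hψc.congr hψeq) (K := extChartAt (𝓡∂ n) p '' tsupport ψ)
    ((isClosed_tsupport ψ).isCompact.image_of_continuousOn ((continuousOn_extChartAt p).mono hp))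
    (by
      rintro _ ⟨z, hz, rfl⟩
      exact (extChartAt (𝓡∂ n) p).map_source (hp hz))
    (fun y hy => by
      by_cases hyT : y ∈ T
      · rw [hψeq hyT]
        refine image_eq_zero_of_notMem_tsupport (f := ψ) fun hz => hy ⟨_, hz, ?_⟩
        exact (extChartAt (𝓡∂ n) p).right_inv hyT
      · exact indicator_of_notMem hyT _)
  have hu : ContinuousOn (rotField r q κ ϑ f ν') T := P.continuousOn_rotField r q κ ϑ
  obtain ⟨h1, h2⟩ := integral_area_of_eq_zero_off_source c h.smooth p (F := F)
    ((continuousOn_gramMatrix B P.uniqueDiffOn P.contDiffOn P.contDiffOn).congr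
      fun y hy => (gramMatrix_liftPos hΦ h hU p hy).symm)
    (fun z hz => manifoldIntegrand_eq_zero_of_notMem_tsupport B _ _ _ t fun hz' => hz (hp hz'))
    ((P.continuousOn_patchIntegrand hu t hψc).congr hFrep)
    ((integrableOn_congr_fun hpatch hTm).2 hint)
  exact ⟨h1, h2.trans ((setIntegral_congr_fun hTm hpatch).trans hzero)⟩

/-- The Minkowski formulae of a capillary hypersurface of the hyperboloid: sum the weak formula over
a partition of unity, and take the coefficient of `t ^ (k - 1)`. -/
theorem integral_meanCurv_eq_zero {k : ℕ} (hk : k ∈ Icc 1 n) :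
    Integrable (fun z => meanCurv c x ν (k - 1) z *
        B.form (liftField Φ x ν r q κ ϑ z) (liftPos Φ x z) -
      meanCurv c x ν k z * B.form (liftField Φ x ν r q κ ϑ z) (liftNormal Φ x ν z)) (area c x) ∧
    ∫ z, (meanCurv c x ν (k - 1) z *
        B.form (liftField Φ x ν r q κ ϑ z) (liftPos Φ x z) -
      meanCurv c x ν k z * B.form (liftField Φ x ν r q κ ϑ z) (liftNormal Φ x ν z))
        ∂(area c x) = 0 := by
  obtain ⟨ρ, hρ⟩ := SmoothPartitionOfUnity.exists_isSubordinate_chartAt_source (𝓡∂ n) M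
  set s : Finset M := ρ.locallyFinite.finite_nonempty_of_compact.toFinset with hs
  have hsum : ∀ z, ∑ i ∈ s, ρ i z = 1 := fun z => by
    rw [← ρ.sum_eq_one (mem_univ z), finsum_eq_sum_of_support_subset]
    intro i hi
    simp only [hs, Finite.coe_toFinset, mem_ofPred_eq]
    exact ⟨z, hi⟩
  set u := liftField Φ x ν r q κ ϑ with hu
  set G : ℝ → M → ℝ := fun t z => weakIntegrand (firstForm c x z) (secondForm c x ν z)
    (B.form (u z) (liftPos Φ x z)) (B.form (u z) (liftNormal Φ x ν z)) t 1
    (fun j => B.form (u z) (partialDeriv (chartDomain n z) (chartRep n (liftPos Φ x) z) j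
      (extChartAt (𝓡∂ n) z z))) 0 with hG
  have hGsum : ∀ t, G t = fun z => ∑ i ∈ s, manifoldIntegrand B (liftPos Φ x) (liftNormal Φ x ν)
      u t (ρ i) z := fun t => by
    funext z
    have hzz := mem_extChartAt_source (I := 𝓡∂ n) z
    have hT := mem_extChartAt_target (I := 𝓡∂ n) z
    -- the derivatives of the partition functions add up to the derivative of `1`
    have hd : ∑ i ∈ s, (fun j => partialDeriv (chartDomain n z) (chartRep n (ρ i) z) j
        (extChartAt (𝓡∂ n) z z)) = 0 := by
      funext j
      have h1 : ∀ i ∈ s, DifferentiableWithinAt ℝ (chartRep n (ρ i) z) (chartDomain n z)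
          (extChartAt (𝓡∂ n) z z) := fun i _ =>
        (contDiffOn_chartRep (ρ i).contMDiff z).differentiableOn (by simp) _ hT
      have h2 := fderivWithin_fun_sum (uniqueDiffOn_chartDomain z _ hT) h1
      have h3 : (fun y => ∑ i ∈ s, chartRep n (ρ i) z y) = fun _ => 1 := funext fun y => hsum _
      rw [h3, fderivWithin_const_apply] at h2
      have h4 := DFunLike.congr_fun h2 (EuclideanSpace.single j (1 : ℝ))
      rw [_root_.sum_apply] at h4
      rw [Finset.sum_apply]
      exact h4.symm
    unfold manifoldIntegrand patchIntegrand
    rw [weakIntegrand_sum, hd, gramMatrix_liftPos_eq_firstForm hΦ h hU,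
      gramMatrix_liftNormal_eq_secondForm hΦ h hU]
    simp only [chartRep_apply _ z hzz, hsum]
    rfl
  have hGint : ∀ t, Integrable (G t) (area c x) ∧ ∫ z, G t z ∂(area c x) = 0 := fun t => by
    have hi : ∀ i ∈ s, _ := fun i _ => integral_manifoldIntegrand_eq_zero hΦ h hU hr hqf hqN hq t
      (ρ i).contMDiff i (by rw [extChartAt_source]; exact hρ i)
    rw [hGsum t]
    refine ⟨integrable_finsetSum _ fun i hi' => (hi i hi').1, ?_⟩
    rw [integral_finsetSum _ fun i hi' => (hi i hi').1]
    exact Finset.sum_eq_zero fun i hi' => (hi i hi').2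
  have hsymm : ∀ z, (secondForm c x ν z)ᵀ = secondForm c x ν z := fun z => by
    rw [← gramMatrix_liftNormal_eq_secondForm hΦ h hU]
    exact gramMatrix_liftNormal_transpose hΦ h hU z (mem_extChartAt_target z)
  have hpoly : ∀ t z, G t z = _ := fun t z =>
    weakIntegrand_one_zero (posDef_firstForm hΦ h hU z) (hsymm z) _ _ t _
  have hcoeff := integral_coeff_eq_zero (μ := area c x) (n := n) (fun t => by
    have := hGint t
    rw [show G t = _ from funext (hpoly t)] at this
    exact this)
  obtain ⟨j, rfl⟩ : ∃ j, k = j + 1 := ⟨k - 1, (Nat.sub_add_cancel hk.1).symm⟩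
  have hjn : j < n := hk.2
  obtain ⟨h1, h2⟩ := hcoeff ⟨j, hjn⟩
  -- both coefficients are the same multiple of a normalised mean curvature
  set m : ℝ := ((n : ℝ) - j) * n.choose j with hm
  have hm' : m = (j + 1) * n.choose (j + 1) := by
    have := Nat.choose_succ_right_eq n j
    have h3 := congrArg (Nat.cast (R := ℝ)) this
    push_cast [Nat.cast_sub hjn.le] at h3
    rw [hm]
    linarith
  have hc0 : (n.choose j : ℝ) ≠ 0 := by exact_mod_cast (Nat.choose_pos hjn.le).ne'
  have hc1 : (n.choose (j + 1) : ℝ) ≠ 0 := by exact_mod_cast (Nat.choose_pos hjn).ne'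
  have hm0 : m ≠ 0 := by
    rw [hm']
    exact mul_ne_zero (by positivity) hc1
  have hfun : ∀ z, meanCurv c x ν (j + 1 - 1) z * B.form (u z) (liftPos Φ x z) -
      meanCurv c x ν (j + 1) z * B.form (u z) (liftNormal Φ x ν z) = m⁻¹ *
      ((((n : ℝ) - j) * relEsymm (firstForm c x z) (secondForm c x ν z) j) *
          B.form (u z) (liftPos Φ x z) -
        ((j + 1 : ℝ) * relEsymm (firstForm c x z) (secondForm c x ν z) (j + 1)) *
          B.form (u z) (liftNormal Φ x ν z)) := fun z => by
    have e : ∀ i, relEsymm (firstForm c x z) (secondForm c x ν z) i =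
      (principalCurvatures c x ν z).esymm i := fun i => rfl
    have e0 : meanCurv c x ν j z =
        m⁻¹ * (((n : ℝ) - j) * (principalCurvatures c x ν z).esymm j) := by
      rw [meanCurv, eq_inv_mul_iff_mul_eq₀ hm0, hm]
      field_simp
    have e1 : meanCurv c x ν (j + 1) z =
        m⁻¹ * ((j + 1 : ℝ) * (principalCurvatures c x ν z).esymm (j + 1)) := by
      rw [meanCurv, eq_inv_mul_iff_mul_eq₀ hm0, hm']
      field_simp
    rw [Nat.add_sub_cancel, e0, e1, e, e]
    ring
  simp only [hfun]
  refine ⟨h1.const_mul _, ?_⟩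
  rw [integral_const_mul, h2, mul_zero]

end Global

/-! ### Minkowski space -/

section Minkowski

open Matrix

variable {n : ℕ}

/-- The Minkowski form `-s s' + ⟨v, v'⟩` on `ℝ × ℝ^m`. -/
def minkowskiForm (m : ℕ) : ℝ × Euc m →L[ℝ] ℝ × Euc m →L[ℝ] ℝ :=
  (isBoundedBilinearMap_inner (𝕜 := ℝ) (E := Euc m)).toContinuousLinearMap.bilinearComp
      (ContinuousLinearMap.snd ℝ ℝ (Euc m)) (ContinuousLinearMap.snd ℝ ℝ (Euc m)) -
    (ContinuousLinearMap.mul ℝ ℝ).bilinearComp (ContinuousLinearMap.fst ℝ ℝ (Euc m))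
      (ContinuousLinearMap.fst ℝ ℝ (Euc m))

theorem minkowskiForm_apply {m : ℕ} (v w : ℝ × Euc m) :
    minkowskiForm m v w = ⟪v.2, w.2⟫_ℝ - v.1 * w.1 := rfl

/-- The coordinates of a vector of `ℝ × ℝ^{n+1}`. -/
def minkowskiCoord (n : ℕ) : ℝ × Euc (n + 1) →ₗ[ℝ] Fin (n + 2) → ℝ where
  toFun v := Fin.cons v.1 v.2.ofLp
  map_add' v w := by
    funext i
    refine Fin.cases ?_ (fun j => ?_) i <;> simp
  map_smul' t v := by
    funext i
    refine Fin.cases ?_ (fun j => ?_) i <;> simp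

/-- The determinant of the coordinates, as an alternating form. -/
def minkowskiVol (n : ℕ) : (ℝ × Euc (n + 1)) [⋀^Fin (n + 2)]→L[ℝ] ℝ where
  __ := Matrix.detRowAlternating.compLinearMap (minkowskiCoord n)
  cont := by
    have h : Continuous fun m : Fin (n + 2) → ℝ × Euc (n + 1) =>
        (Matrix.of fun i => minkowskiCoord n (m i)).det :=
      Continuous.matrix_det (continuous_matrix fun i j =>
        (continuous_apply j).comp ((minkowskiCoord n).continuous_of_finiteDimensional.comp
          (continuous_apply i)))
    exact h

theorem minkowskiVol_apply (m : Fin (n + 2) → ℝ × Euc (n + 1)) :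
    minkowskiVol n m = (Matrix.of fun i => minkowskiCoord n (m i)).det := rfl

/-- Minkowski space `ℝ × ℝ^{n+1}`. -/
def minkowski (n : ℕ) : LorentzForm n (ℝ × Euc (n + 1)) where
  form := minkowskiForm (n + 1)
  symm v w := by
    rw [minkowskiForm_apply, minkowskiForm_apply, real_inner_comm, mul_comm]
  vol := minkowskiVol n
  finrank_eq := by
    rw [Module.finrank_prod, Module.finrank_self, finrank_euclideanSpace_fin]
    ring
  vol_mul_vol m m' := by
    have h : (Matrix.of fun i j => minkowskiForm (n + 1) (m i) (m' j)) =
        (Matrix.of fun i => minkowskiCoord n (m i)) * diagonal (Fin.cons (-1) fun _ => 1) *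
          (Matrix.of fun i => minkowskiCoord n (m' i))ᵀ := by
      ext i j
      rw [Matrix.mul_apply, Fin.sum_univ_succ]
      simp only [mul_diagonal, transpose_apply, of_apply, minkowskiCoord, LinearMap.coe_mk,
        AddHom.coe_mk, Fin.cons_zero, Fin.cons_succ, minkowskiForm_apply]
      rw [PiLp.inner_apply]
      simp only [RCLike.inner_apply, conj_trivial]
      rw [Finset.sum_congr rfl fun k _ => mul_comm ((m' j).2.ofLp k) _]
      simp only [mul_one]
      ring
    rw [h, det_mul, det_mul, det_transpose, det_diagonal, Fin.prod_univ_succ, minkowskiVol_apply,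
      minkowskiVol_apply]
    simp

theorem minkowski_form_apply (v w : ℝ × Euc (n + 1)) :
    (minkowski n).form v w = ⟪v.2, w.2⟫_ℝ - v.1 * w.1 := rfl

/-- The infinitesimal boost in the plane of the time axis and the last coordinate axis. -/
def boost (n : ℕ) : ℝ × Euc (n + 1) →L[ℝ] ℝ × Euc (n + 1) :=
  ((innerSL ℝ lastVec).comp (ContinuousLinearMap.snd ℝ ℝ (Euc (n + 1)))).prod
    ((ContinuousLinearMap.fst ℝ ℝ (Euc (n + 1))).smulRight lastVec)

theorem boost_apply (v : ℝ × Euc (n + 1)) : boost n v = (⟪lastVec, v.2⟫_ℝ, v.1 • lastVec) := rfl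

/-- A multiple of the boost is skew for the Minkowski form. -/
theorem form_boost (σ : ℝ) (v w : ℝ × Euc (n + 1)) :
    (minkowski n).form ((σ • boost n) v) w = -(minkowski n).form v ((σ • boost n) w) := by
  simp only [_root_.smul_apply, map_smul, boost_apply, minkowski_form_apply, smul_eq_mul,
    real_inner_smul_left, real_inner_smul_right]
  rw [real_inner_comm lastVec v.2]
  ring

theorem inner_lastVec (y : Euc (n + 1)) : ⟪y, lastVec⟫_ℝ = y (Fin.last n) := by
  simp [lastVec, EuclideanSpace.inner_single_right]

theorem inner_lastVec_lastVec : ⟪(lastVec : Euc (n + 1)), lastVec⟫_ℝ = 1 := by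
  rw [inner_lastVec]
  simp [lastVec]

end Minkowski

/-! ### The two models as hyperboloid models -/

section Charts

open Topology

variable {n : ℕ}

theorem hasFDerivAt_norm_sq (y : Euc (n + 1)) :
    HasFDerivAt (fun y : Euc (n + 1) => ‖y‖ ^ 2) (2 • innerSL ℝ y) y :=
  (hasStrictFDerivAt_norm_sq y).hasFDerivAt

/-- The isometry from the Poincaré ball onto the hyperboloid, inverse to the stereographic
projection from `(-1, 0)`; its first component is `(1 + |y|²) / (1 - |y|²)`. -/
def ballModel (y : Euc (n + 1)) : ℝ × Euc (n + 1) :=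
  (2 / (1 - ‖y‖ ^ 2) - 1, (2 / (1 - ‖y‖ ^ 2)) • y)

theorem one_sub_norm_sq_pos {y : Euc (n + 1)} (hy : ‖y‖ < 1) : 0 < 1 - ‖y‖ ^ 2 := by
  have := norm_nonneg y
  nlinarith

theorem fderiv_ballModel {y : Euc (n + 1)} (hy : ‖y‖ < 1) (v : Euc (n + 1)) :
    fderiv ℝ ballModel y v = (4 / (1 - ‖y‖ ^ 2) ^ 2 * ⟪y, v⟫_ℝ,
      (4 / (1 - ‖y‖ ^ 2) ^ 2 * ⟪y, v⟫_ℝ) • y + (2 / (1 - ‖y‖ ^ 2)) • v) := by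
  have hD := (one_sub_norm_sq_pos hy).ne'
  have h1 := ((hasFDerivAt_norm_sq y).const_sub 1)
  have h2 := ((hasDerivAt_inv hD).comp_hasFDerivAt y h1).const_mul 2
  have h3 : HasFDerivAt (fun y : Euc (n + 1) => 2 / (1 - ‖y‖ ^ 2))
      ((4 / (1 - ‖y‖ ^ 2) ^ 2) • innerSL ℝ y) y := by
    refine (h2.congr_fderiv ?_).congr_of_eventuallyEq (.of_forall fun z => div_eq_mul_inv _ _)
    ext w
    simp
    field_simp
    ring
  have h4 := (h3.sub_const 1).prodMk (h3.smul (hasFDerivAt_id y))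
  rw [HasFDerivAt.fderiv (f := ballModel) h4]
  ext1
  · simp
  · simp [add_comm]

theorem hyperboloidModel_ball : HyperboloidModel (minkowski n) ballFactor
    (Metric.ball (0 : Euc (n + 1)) 1) ballModel where
  isOpen := Metric.isOpen_ball
  contDiffOn := by
    have h : ContDiffOn ℝ ∞ (fun y : Euc (n + 1) => 2 / (1 - ‖y‖ ^ 2)) (Metric.ball 0 1) :=
      contDiffOn_const.div (contDiff_const.sub (contDiff_norm_sq ℝ)).contDiffOn fun y hy =>
        (one_sub_norm_sq_pos (mem_ball_zero_iff.1 hy)).ne'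
    exact (h.sub contDiffOn_const).prodMk (h.smul contDiffOn_id)
  form_self y hy := by
    have hD := (one_sub_norm_sq_pos (mem_ball_zero_iff.1 hy)).ne'
    simp only [minkowski_form_apply, ballModel, real_inner_smul_left, real_inner_smul_right]
    rw [real_inner_self_eq_norm_sq]
    field_simp
    ring
  form_fderiv y hy v w := by
    have hy' := mem_ball_zero_iff.1 hy
    have hD := (one_sub_norm_sq_pos hy').ne'
    rw [fderiv_ballModel hy', fderiv_ballModel hy', minkowski_form_apply]
    simp only [inner_add_left, inner_add_right, real_inner_smul_left, real_inner_smul_right,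
      metric, ballFactor]
    rw [real_inner_comm y v, real_inner_self_eq_norm_sq]
    field_simp
    ring
  factor_pos y hy := by
    have := one_sub_norm_sq_pos (mem_ball_zero_iff.1 hy)
    unfold ballFactor
    positivity
  differentiableAt_factor y hy := by
    have := (one_sub_norm_sq_pos (mem_ball_zero_iff.1 hy)).ne'
    have h := ((hasFDerivAt_norm_sq y).const_sub 1).differentiableAt
    exact ((h.pow 2).inv (pow_ne_zero 2 this)).const_mul 4

/-- The isometry from the Poincaré half-space onto the hyperboloid that maps the last coordinate
vector to `(1, 0)` and the ideal point at infinity to the null direction `(1, lastVec)`. -/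
def halfSpaceModel (y : Euc (n + 1)) : ℝ × Euc (n + 1) :=
  ((y (Fin.last n))⁻¹ * ((1 + ‖y‖ ^ 2) / 2), (y (Fin.last n))⁻¹ • y +
    ((y (Fin.last n))⁻¹ * ((‖y‖ ^ 2 - 1) / 2) - 1) • lastVec)

theorem fderiv_halfSpaceModel {y : Euc (n + 1)} (hy : 0 < y (Fin.last n)) (v : Euc (n + 1)) :
    fderiv ℝ halfSpaceModel y v =
      ((y (Fin.last n))⁻¹ * ⟪y, v⟫_ℝ -
        ((y (Fin.last n))⁻¹ ^ 2 * v (Fin.last n)) * ((1 + ‖y‖ ^ 2) / 2),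
      (y (Fin.last n))⁻¹ • v - ((y (Fin.last n))⁻¹ ^ 2 * v (Fin.last n)) • y +
        ((y (Fin.last n))⁻¹ * ⟪y, v⟫_ℝ -
          ((y (Fin.last n))⁻¹ ^ 2 * v (Fin.last n)) * ((‖y‖ ^ 2 - 1) / 2)) • lastVec) := by
  have h0 : HasFDerivAt (fun y : Euc (n + 1) => y (Fin.last n))
      (EuclideanSpace.proj (𝕜 := ℝ) (Fin.last n)) y :=
    (EuclideanSpace.proj (𝕜 := ℝ) (Fin.last n) : Euc (n + 1) →L[ℝ] ℝ).hasFDerivAt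
  have h1 := (hasDerivAt_inv hy.ne').comp_hasFDerivAt y h0
  have h2 : HasFDerivAt (fun y : Euc (n + 1) => (1 + ‖y‖ ^ 2) / 2) (innerSL ℝ y) y := by
    refine (((hasFDerivAt_norm_sq y).const_add 1).mul_const (2⁻¹ : ℝ)).congr_fderiv ?_
    ext w
    simp
  have h3 : HasFDerivAt (fun y : Euc (n + 1) => (‖y‖ ^ 2 - 1) / 2) (innerSL ℝ y) y := by
    refine (((hasFDerivAt_norm_sq y).sub_const 1).mul_const (2⁻¹ : ℝ)).congr_fderiv ?_
    ext w
    simp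
  have h4 := (h1.mul h2).prodMk ((h1.smul (hasFDerivAt_id y)).add
    (((h1.mul h3).sub_const 1).smul_const (lastVec : Euc (n + 1))))
  rw [HasFDerivAt.fderiv (f := halfSpaceModel) h4]
  ext1
  · simp
    ring
  · simp
    module

theorem hyperboloidModel_halfSpace : HyperboloidModel (minkowski n) halfSpaceFactor
    {y : Euc (n + 1) | 0 < y (Fin.last n)} halfSpaceModel where
  isOpen := isOpen_lt continuous_const (by fun_prop)
  contDiffOn := by
    have h : ContDiffOn ℝ ∞ (fun y : Euc (n + 1) => (y (Fin.last n))⁻¹)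
        {y : Euc (n + 1) | 0 < y (Fin.last n)} :=
      ContDiffOn.inv (by fun_prop) fun y hy => ne_of_gt hy
    have h2 : ContDiff ℝ ∞ fun y : Euc (n + 1) => ‖y‖ ^ 2 := contDiff_norm_sq ℝ
    exact (h.mul ((contDiff_const.add h2).div_const 2).contDiffOn).prodMk
      ((h.smul contDiffOn_id).add (((h.mul ((h2.sub contDiff_const).div_const 2).contDiffOn).sub
        contDiffOn_const).smul contDiffOn_const))
  form_self y hy := by
    have hy0 : y (Fin.last n) ≠ 0 := ne_of_gt hy
    simp only [minkowski_form_apply, halfSpaceModel, inner_add_left, inner_add_right,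
      real_inner_smul_left, real_inner_smul_right]
    rw [real_inner_comm y lastVec, real_inner_self_eq_norm_sq, inner_lastVec_lastVec,
      inner_lastVec]
    field_simp
    ring
  form_fderiv y hy v w := by
    have hy0 : y (Fin.last n) ≠ 0 := ne_of_gt hy
    rw [fderiv_halfSpaceModel hy, fderiv_halfSpaceModel hy, minkowski_form_apply]
    simp only [inner_add_left, inner_add_right, inner_sub_left, inner_sub_right,
      real_inner_smul_left, real_inner_smul_right, metric, halfSpaceFactor]
    rw [real_inner_comm y lastVec, real_inner_comm w lastVec, real_inner_comm y v,
      inner_lastVec_lastVec, real_inner_self_eq_norm_sq, inner_lastVec, inner_lastVec,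
      inner_lastVec]
    field_simp
    ring
  factor_pos y hy := by
    have : 0 < y (Fin.last n) := hy
    unfold halfSpaceFactor
    positivity
  differentiableAt_factor y hy := by
    have : y (Fin.last n) ≠ 0 := ne_of_gt hy
    have h : DifferentiableAt ℝ (fun y : Euc (n + 1) => y (Fin.last n) ^ 2) y := by fun_prop
    exact (h.inv (pow_ne_zero 2 this)).const_mul 1

end Charts

/-! ### The two Minkowski formulae -/

section Ball

variable {n : ℕ} {y : Euc (n + 1)}

/-- The unit normal of `P` lifts to a constant vector, as `P` is totally geodesic. -/
theorem fderiv_ballModel_normalP (hy : y ∈ planeP) :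
    fderiv ℝ ballModel y (normalP y) = (0, -lastVec) := by
  have hD := (one_sub_norm_sq_pos hy.1).ne'
  rw [fderiv_ballModel hy.1, normalP, inner_neg_right, real_inner_smul_right, hy.2]
  ext1
  · simp
  · simp only [mul_zero, neg_zero, zero_smul, zero_add, smul_neg, smul_smul]
    rw [div_mul_div_cancel₀ hD, div_self two_ne_zero, one_smul]

/-- The field `Y_{n+1}` is the Killing field of the boost. -/
theorem boost_ballModel (hy : ‖y‖ < 1) :
    boost n (ballModel y) = fderiv ℝ ballModel y (killingY y) := by
  have hD := (one_sub_norm_sq_pos hy).ne'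
  have h : ⟪y, killingY y⟫_ℝ = ⟪y, lastVec⟫_ℝ * ((1 - ‖y‖ ^ 2) / 2) := by
    rw [killingY, inner_sub_right, real_inner_smul_right, real_inner_smul_right,
      real_inner_self_eq_norm_sq]
    ring
  rw [fderiv_ballModel hy, h, boost_apply, ballModel, killingY]
  ext1
  · simp only [real_inner_smul_right]
    rw [real_inner_comm]
    field_simp
    ring
  · simp only [smul_sub, smul_smul]
    match_scalars
    · field_simp
      ring
    · field_simp
      ring

/-- The position vector of the ball is the tangential part of the constant vector `(-1, 0)`. -/
theorem fderiv_ballModel_self (hy : ‖y‖ < 1) :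
    fderiv ℝ ballModel y y = (-1, 0) + (2 / (1 - ‖y‖ ^ 2) - 1) • ballModel y := by
  have hD := (one_sub_norm_sq_pos hy).ne'
  rw [fderiv_ballModel hy, ballModel, real_inner_self_eq_norm_sq]
  ext1
  · simp only [Prod.fst_add, Prod.smul_fst, smul_eq_mul]
    field_simp
    ring
  · simp only [Prod.snd_add, Prod.smul_snd]
    match_scalars
    field_simp
    ring

end Ball

section HalfSpace

variable {n : ℕ} {y : Euc (n + 1)} {φ : ℝ} {a : Euc (n + 1)}

theorem surfaceL_eq (hφ : φ ∈ Ico 0 (Real.pi / 2)) (hy : y ∈ surfaceL φ a) :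
    Real.sin φ * ⟪y, a⟫_ℝ = Real.cos φ * (y (Fin.last n) - 1) := by
  have hc : Real.cos φ ≠ 0 := (Real.cos_pos_of_mem_Ioo
    ⟨lt_of_lt_of_le (by linarith [Real.pi_pos]) hφ.1, hφ.2⟩).ne'
  rw [hy.2, Real.tan_eq_sin_div_cos]
  field_simp

/-- The unit normal of `L_{φ,a}` lifts to a constant vector plus `cos φ` times the position, as
`L_{φ,a}` is umbilical. -/
theorem fderiv_halfSpaceModel_normalL (hφ : φ ∈ Ico 0 (Real.pi / 2)) (ha : ⟪a, lastVec⟫_ℝ = 0)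
    (hy : y ∈ surfaceL φ a) : fderiv ℝ halfSpaceModel y (normalL φ a y) =
      (-Real.cos φ, -(Real.cos φ) • lastVec + Real.sin φ • a) +
        Real.cos φ • halfSpaceModel y := by
  have hy0 : y (Fin.last n) ≠ 0 := hy.1.ne'
  have hs := surfaceL_eq hφ hy
  have h1 : ⟪y, normalL φ a y⟫_ℝ = -(y (Fin.last n) * Real.cos φ) := by
    rw [normalL, real_inner_smul_right, inner_add_right, real_inner_smul_right,
      real_inner_smul_right, hs, inner_lastVec]
    ring
  have h2 : (normalL φ a y) (Fin.last n) = -(y (Fin.last n) * Real.cos φ) := by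
    rw [← inner_lastVec, normalL, real_inner_smul_left, inner_add_left, real_inner_smul_left,
      real_inner_smul_left, ha, inner_lastVec_lastVec]
    ring
  rw [fderiv_halfSpaceModel hy.1, h1, h2, normalL, halfSpaceModel]
  ext1
  · simp only [Prod.fst_add, Prod.smul_fst, smul_eq_mul]
    field_simp
    ring
  · simp only [Prod.snd_add, Prod.smul_snd]
    match_scalars
    all_goals
      field_simp
      try ring

/-- The position vector of the half-space is the Killing field of the boost. -/
theorem boost_halfSpaceModel (hy : 0 < y (Fin.last n)) :
    boost n (halfSpaceModel y) = fderiv ℝ halfSpaceModel y y := by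
  have hy0 := hy.ne'
  rw [fderiv_halfSpaceModel hy, boost_apply, halfSpaceModel, real_inner_self_eq_norm_sq]
  ext1
  · simp only [inner_add_right, real_inner_smul_right]
    rw [real_inner_comm, inner_lastVec, inner_lastVec_lastVec]
    field_simp
    ring
  · match_scalars
    all_goals
      field_simp
      try ring

/-- Minus the last coordinate vector is the tangential part of a constant null vector. -/
theorem fderiv_halfSpaceModel_lastVec (hy : 0 < y (Fin.last n)) :
    fderiv ℝ halfSpaceModel y lastVec =
      -((-1, -lastVec) + (y (Fin.last n))⁻¹ • halfSpaceModel y) := by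
  have hy0 := hy.ne'
  have h : (lastVec : Euc (n + 1)) (Fin.last n) = 1 := by
    rw [← inner_lastVec, inner_lastVec_lastVec]
  rw [fderiv_halfSpaceModel hy, halfSpaceModel, h, inner_lastVec]
  ext1
  · simp only [Prod.fst_add, Prod.smul_fst, smul_eq_mul, Prod.fst_neg]
    field_simp
    ring
  · simp only [Prod.snd_add, Prod.smul_snd, Prod.snd_neg]
    match_scalars
    all_goals
      field_simp
      try ring

end HalfSpace

section Capillary

variable {n : ℕ} [NeZero n] {M : Type*} [TopologicalSpace M]
  [ChartedSpace (EuclideanHalfSpace n) M] [IsManifold (𝓡∂ n) ∞ M]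

omit [IsManifold (𝓡∂ n) ∞ M] in
theorem IsCapillary.mem_of_subset {c : Euc (n + 1) → ℝ} {D S U : Set (Euc (n + 1))}
    {N : Euc (n + 1) → Euc (n + 1)} {θ : ℝ} {x ν : M → Euc (n + 1)}
    (h : IsCapillary c D S N θ x ν) (hD : D ⊆ U) (hS : S ⊆ U) (p : M) : x p ∈ U := by
  rcases (𝓡∂ n).interior_union_boundary_eq_univ (M := M) ▸ mem_univ p with hp | hp
  · exact hD (h.maps_interior p hp).1
  · exact hS (h.maps_boundary p hp)

/-- The value at the boundary of `B(v, v)` for the vector `v` of `IsPatch.flux_eq_zero`, which has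
to be nonzero. -/
theorem one_sub_cos_sq_ne_zero {θ : ℝ} (hθ : θ ∈ Ioo 0 Real.pi) : 1 - Real.cos θ ^ 2 ≠ 0 := by
  rw [← Real.sin_sq]
  exact pow_ne_zero 2 (Real.sin_pos_of_mem_Ioo hθ).ne'

variable {c : Euc (n + 1) → ℝ} {D S U : Set (Euc (n + 1))} {N : Euc (n + 1) → Euc (n + 1)}
    {Φ : Euc (n + 1) → ℝ × Euc (n + 1)} {θ : ℝ} {x ν : M → Euc (n + 1)}

omit [IsManifold (𝓡∂ n) ∞ M] in
/-- The contact angle condition in the hyperboloid. -/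
theorem form_fderiv_normal (hΦ : HyperboloidModel (minkowski n) c U Φ)
    (h : IsCapillary c D S N θ x ν) (hU : ∀ p, x p ∈ U) {p : M} (hp : p ∈ (𝓡∂ n).boundary M) :
    (minkowski n).form (fderiv ℝ Φ (x p) (N (x p))) (liftNormal Φ x ν p) = -Real.cos θ := by
  rw [liftNormal, hΦ.form_fderiv _ (hU p), ← h.contact_angle p hp, metric, metric,
    inner_neg_right, mul_neg, neg_neg]

end Capillary

section Skew

variable {n : ℕ} {W : Type*} [NormedAddCommGroup W] [NormedSpace ℝ W] (B : LorentzForm n W)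
  {r : W →L[ℝ] W} (hr : ∀ v w, B.form (r v) w = -B.form v (r w))
include hr

theorem LorentzForm.form_skew_self (v : W) : B.form (r v) v = 0 := by
  have h := hr v v
  rw [B.symm v] at h
  linarith

/-- The `κ`-term drops out. -/
theorem LorentzForm.form_skew_left (q f N : W) (κ ϑ : ℝ) :
    B.form (r (q + κ • f + ϑ • N)) f = B.form (r q) f - ϑ * B.form (r f) N := by
  rw [map_add, map_add, map_smul, map_smul, map_add, map_add, map_smul, map_smul,
    _root_.add_apply, _root_.add_apply, _root_.smul_apply, _root_.smul_apply,
    B.form_skew_self hr, hr N f, B.symm N]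
  simp only [smul_eq_mul]
  ring

/-- The `ϑ`-term drops out. -/
theorem LorentzForm.form_skew_right (q f N : W) (κ ϑ : ℝ) :
    B.form (r (q + κ • f + ϑ • N)) N = B.form (r q) N + κ * B.form (r f) N := by
  rw [map_add, map_add, map_smul, map_smul, map_add, map_add, map_smul, map_smul,
    _root_.add_apply, _root_.add_apply, _root_.smul_apply, _root_.smul_apply,
    B.form_skew_self hr]
  simp only [smul_eq_mul]
  ring

end Skew

section Formulae

variable {n : ℕ} [NeZero n] {M : Type*} [TopologicalSpace M]
  [ChartedSpace (EuclideanHalfSpace n) M] [IsManifold (𝓡∂ n) ∞ M] [CompactSpace M] [T2Space M]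
  [MeasurableSpace M] [BorelSpace M] {x ν : M → Euc (n + 1)} {θ : ℝ} {k : ℕ}

theorem integral_ballIntegrand (hθ : θ ∈ Ioo 0 Real.pi) (hk : k ∈ Icc 1 n)
    (h : IsCapillary ballFactor halfBall planeP normalP θ x ν) :
    Integrable (ballIntegrand θ x ν k) (area ballFactor x) ∧
      ∫ p, ballIntegrand θ x ν k p ∂(area ballFactor x) = 0 := by
  have hΦ := hyperboloidModel_ball (n := n)
  have hx : ∀ p, ‖x p‖ < 1 := fun p => h.mem_of_subset (U := {y | ‖y‖ < 1})
    (fun y hy => hy.1) (fun y hy => hy.1) p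
  have hU : ∀ p, x p ∈ Metric.ball (0 : Euc (n + 1)) 1 := fun p => mem_ball_zero_iff.2 (hx p)
  have hr := form_boost (n := n) 1
  -- the plane `P` is mapped into `{B(q, w) = 0}`
  set q : ℝ × Euc (n + 1) := (0, -lastVec) with hq
  have hrq : ((1 : ℝ) • boost n) q = (-1, 0) := by
    rw [one_smul, boost_apply, hq, inner_neg_right, inner_lastVec_lastVec, zero_smul]
  have key := integral_meanCurv_eq_zero hΦ h hU hr (q := q) (κ := 0) (ϑ := Real.cos θ)
    (fun z hz => by
      have hz0 : ⟪x z, lastVec⟫_ℝ = 0 := (h.maps_boundary z hz).2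
      rw [liftPos, Function.comp_apply, minkowski_form_apply, ballModel, hq, inner_neg_left,
        real_inner_smul_right, real_inner_comm, hz0]
      ring)
    (fun z hz => by
      rw [← form_fderiv_normal hΦ h hU hz, fderiv_ballModel_normalP (h.maps_boundary z hz)])
    (by
      rw [minkowski_form_apply, hq, inner_neg_neg, inner_lastVec_lastVec]
      convert one_sub_cos_sq_ne_zero hθ using 1
      ring) hk
  have hfun : ballIntegrand θ x ν k = fun z => meanCurv ballFactor x ν (k - 1) z *
        (minkowski n).form (liftField ballModel x ν ((1 : ℝ) • boost n) q 0 (Real.cos θ) z)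
          (liftPos ballModel x z) - meanCurv ballFactor x ν k z *
        (minkowski n).form (liftField ballModel x ν ((1 : ℝ) • boost n) q 0 (Real.cos θ) z)
          (liftNormal ballModel x ν z) := by
    funext z
    have hD := (one_sub_norm_sq_pos (hx z)).ne'
    have e1 : (minkowski n).form (boost n (liftPos ballModel x z)) (liftNormal ballModel x ν z) =
        metric ballFactor (x z) (killingY (x z)) (ν z) := by
      rw [liftPos, Function.comp_apply, boost_ballModel (hx z)]
      exact hΦ.form_fderiv _ (hU z) _ _
    have e2 : (minkowski n).form (-1, 0) (liftNormal ballModel x ν z) =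
        metric ballFactor (x z) (x z) (ν z) := by
      rw [← hΦ.form_fderiv _ (hU z), fderiv_ballModel_self (hx z), map_add, map_smul,
        _root_.add_apply, _root_.smul_apply, hΦ.form_fderiv_self (hU z), smul_zero, add_zero]
      rfl
    have e3 : (minkowski n).form (-1, 0) (liftPos ballModel x z) = potV0 (x z) := by
      rw [liftPos, Function.comp_apply, minkowski_form_apply, ballModel, potV0, inner_zero_left]
      field_simp
      ring
    unfold liftField
    rw [(minkowski n).form_skew_left hr, (minkowski n).form_skew_right hr, hrq, e2, e3, one_smul,
      e1, ballIntegrand]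
    ring
  rw [hfun]
  exact key

theorem integral_halfSpaceIntegrand (hθ : θ ∈ Ioo 0 Real.pi) (hk : k ∈ Icc 1 n) {φ : ℝ}
    (hφ : φ ∈ Ico 0 (Real.pi / 2)) {a : Euc (n + 1)} (ha : ⟪a, lastVec⟫_ℝ = 0)
    (haa : ⟪a, a⟫_ℝ = 1)
    (h : IsCapillary halfSpaceFactor (domainL φ a) (surfaceL φ a) (normalL φ a) θ x ν) :
    Integrable (halfSpaceIntegrand θ φ x ν k) (area halfSpaceFactor x) ∧
      ∫ p, halfSpaceIntegrand θ φ x ν k p ∂(area halfSpaceFactor x) = 0 := by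
  have hΦ := hyperboloidModel_halfSpace (n := n)
  have hU : ∀ p, x p ∈ {y : Euc (n + 1) | 0 < y (Fin.last n)} :=
    h.mem_of_subset (fun y hy => hy.1) (fun y hy => hy.1)
  have hc : Real.cos φ ≠ 0 := (Real.cos_pos_of_mem_Ioo
    ⟨lt_of_lt_of_le (by linarith [Real.pi_pos]) hφ.1, hφ.2⟩).ne'
  have hr := form_boost (n := n) (1 / Real.cos φ)
  have ha' : ⟪lastVec, a⟫_ℝ = 0 := by rw [real_inner_comm, ha]
  -- `L_{φ,a}` is mapped into `{B(q, w) = cos φ}`; the factor `1 / cos φ` of the boost makes the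
  -- image of `q` the constant null vector `(-1, -lastVec)`, whatever `φ` and `a` are
  set q : ℝ × Euc (n + 1) := (-Real.cos φ, -(Real.cos φ) • lastVec + Real.sin φ • a) with hq
  have hrq : ((1 / Real.cos φ) • boost n) q = (-1, -lastVec) := by
    rw [_root_.smul_apply, boost_apply, hq, inner_add_right, real_inner_smul_right,
      real_inner_smul_right, inner_lastVec_lastVec, ha', Prod.smul_mk, smul_smul]
    ext1
    · simp only [smul_eq_mul]
      field_simp
      ring
    · rw [mul_neg, one_div_mul_cancel hc, neg_one_smul]
  have hqf : ∀ y ∈ surfaceL φ a, (minkowski n).form q (halfSpaceModel y) = Real.cos φ := by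
    intro y hy
    have hy0 : y (Fin.last n) ≠ 0 := hy.1.ne'
    have hs := surfaceL_eq hφ hy
    rw [minkowski_form_apply, hq, halfSpaceModel]
    simp only [inner_add_left, inner_add_right, real_inner_smul_left, real_inner_smul_right]
    rw [inner_lastVec_lastVec, ha, real_inner_comm y lastVec, inner_lastVec, real_inner_comm y a,
      hs]
    field_simp
    ring
  have key := integral_meanCurv_eq_zero hΦ h hU hr (q := q) (κ := Real.cos φ) (ϑ := Real.cos θ)
    (fun z hz => hqf _ (h.maps_boundary z hz))
    (fun z hz => by
      rw [← form_fderiv_normal hΦ h hU hz,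
        fderiv_halfSpaceModel_normalL hφ ha (h.maps_boundary z hz), map_add, map_smul,
        _root_.add_apply, _root_.smul_apply]
      rw [show (minkowski n).form (halfSpaceModel (x z)) (liftNormal halfSpaceModel x ν z) = 0 from
        hΦ.form_fderiv_self (hU z) _, smul_zero, add_zero])
    (by
      have e : (minkowski n).form q q = Real.sin φ ^ 2 := by
        rw [minkowski_form_apply, hq]
        simp only [inner_add_left, inner_add_right, real_inner_smul_left, real_inner_smul_right]
        rw [inner_lastVec_lastVec, ha, ha', haa]
        ring
      rw [e, Real.sin_sq_add_cos_sq]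
      exact one_sub_cos_sq_ne_zero hθ) hk
  have hfun : halfSpaceIntegrand θ φ x ν k = fun z => meanCurv halfSpaceFactor x ν (k - 1) z *
        (minkowski n).form (liftField halfSpaceModel x ν ((1 / Real.cos φ) • boost n) q
          (Real.cos φ) (Real.cos θ) z) (liftPos halfSpaceModel x z) -
      meanCurv halfSpaceFactor x ν k z *
        (minkowski n).form (liftField halfSpaceModel x ν ((1 / Real.cos φ) • boost n) q
          (Real.cos φ) (Real.cos θ) z) (liftNormal halfSpaceModel x ν z) := by
    funext z
    have hz : 0 < x z (Fin.last n) := hU z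
    have e1 : (minkowski n).form (((1 / Real.cos φ) • boost n) (liftPos halfSpaceModel x z))
        (liftNormal halfSpaceModel x ν z) =
        1 / Real.cos φ * metric halfSpaceFactor (x z) (x z) (ν z) := by
      rw [_root_.smul_apply, liftPos, Function.comp_apply, boost_halfSpaceModel hz, map_smul,
        _root_.smul_apply, smul_eq_mul]
      congr 1
      exact hΦ.form_fderiv _ (hU z) _ _
    have e2 : (minkowski n).form (-1, -lastVec) (liftNormal halfSpaceModel x ν z) =
        -metric halfSpaceFactor (x z) lastVec (ν z) := by
      rw [← hΦ.form_fderiv _ (hU z), fderiv_halfSpaceModel_lastVec hz, map_neg, map_add, map_smul,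
        _root_.neg_apply, _root_.add_apply, _root_.smul_apply, hΦ.form_fderiv_self (hU z),
        smul_zero, add_zero, neg_neg]
      rfl
    have e3 : (minkowski n).form (-1, -lastVec) (liftPos halfSpaceModel x z) = potV (x z) := by
      rw [liftPos, Function.comp_apply, minkowski_form_apply, halfSpaceModel, potV]
      simp only [inner_add_right, inner_neg_left, real_inner_smul_right]
      rw [inner_lastVec_lastVec, real_inner_comm, inner_lastVec]
      field_simp
      ring
    have e4 : metric halfSpaceFactor (x z) (conformalX (x z)) (ν z) =
        metric halfSpaceFactor (x z) (x z) (ν z) - metric halfSpaceFactor (x z) lastVec (ν z) := by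
      rw [conformalX, metric, metric, metric, inner_sub_left, mul_sub]
    unfold liftField
    rw [(minkowski n).form_skew_left hr, (minkowski n).form_skew_right hr, hrq, e1, e2, e3,
      halfSpaceIntegrand, e4]
    field_simp
    ring
  rw [hfun]
  exact key

end Formulae

end HypCapillary

end

theorem mainTheorem10 {n : ℕ} [NeZero n] {M : Type*} [TopologicalSpace M]
    [ChartedSpace (EuclideanHalfSpace n) M] [IsManifold (𝓡∂ n) ∞ M] [CompactSpace M] [T2Space M]
    [MeasurableSpace M] [BorelSpace M] (x ν : M → Euc (n + 1))
    (θ : ℝ) (hθ : θ ∈ Ioo 0 Real.pi) (k : ℕ) (hk : k ∈ Icc 1 n) :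
    (IsCapillary ballFactor halfBall planeP normalP θ x ν →
      Integrable (ballIntegrand θ x ν k) (area ballFactor x) ∧
        ∫ p, ballIntegrand θ x ν k p ∂(area ballFactor x) = 0) ∧
    (∀ φ ∈ Ico 0 (Real.pi / 2), ∀ a : Euc (n + 1), ⟪a, lastVec⟫_ℝ = 0 → ⟪a, a⟫_ℝ = 1 →
      IsCapillary halfSpaceFactor (domainL φ a) (surfaceL φ a) (normalL φ a) θ x ν →
      Integrable (halfSpaceIntegrand θ φ x ν k) (area halfSpaceFactor x) ∧
        ∫ p, halfSpaceIntegrand θ φ x ν k p ∂(area halfSpaceFactor x) = 0) :=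
  ⟨integral_ballIntegrand hθ hk, fun _ hφ _ ha haa => integral_halfSpaceIntegrand hθ hk hφ ha haa⟩
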